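/- **Setting.** Let $m\ge 1$, and let $d_1,\dots,d_m$, $r_1,\dots,r_m\ge 1$ be integers. Write $d^*=\prod_k d_k$, $r^*=\prod_k r_k$, $d_k^-=\prod_{l\ne k}d_l$ and $\mathrm{DoF}_m=r^*+\sum_k d_kr_k$. For a tensor $T\in\mathbb R^{d_1\times\cdots\times d_m}$ let $\mathfrak M_k(T)\in\mathbb R^{d_k\times d_k^-}$ be its mode-$k$ matricization, and let $\|T\|_1$, $\|T\|_{\mathrm F}$, $\|T\|_\infty$ be the entrywise $\ell_1$, $\ell_2$, $\ell_\infty$ norms. For a matrix, $\|A\|_{2,\infty}$ is the largest Euclidean norm of a row. The Tucker rank of $T$ is $(\operatorname{rank}\mathfrak M_k(T))_k$. If the columns of $U_k$ form an orthonormal basis of the column space of $\mathfrak M_k(T)$, put $\mu(T)=\max_k\|U_k\|_{2,\infty}^2d_k/r_k$. Let $\mathbb M_{\mathbf r,\mu}$ be the set of tensors $T$ with $\operatorname{rank}\mathfrak M_k(T)\le r_k$ for all $k$ and $\mu(T)\le\mu$. Let $\mathcal P_{\mathbb T}$ be the orthogonal projection onto the tangent space $\mathbb T$ at $T$ of the manifold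 of tensors with the same Tucker rank as $T$. Let $T^*$ have Tucker rank exactly $\mathbf r=(r_1,\dots,r_m)$. Put $\mu^*=\mu(T^*)$, $\kappa=\max_k\sigma_1(\mathfrak M_k(T^*))/\min_k\sigma_{r_k}(\mathfrak M_k(T^*))$ and $$C^*=(5m+1)^2\,6^m\,\kappa^m\,(\mu^*)^{m(m+1)/2}\,(r^*)^{(m+1)/2}.$$ Observe $Y=T^*+\Xi+S$. The entries of $\Xi$ are i.i.d. copies of a random variable $\xi$ with density $h_\xi$ such that, for some $\varepsilon,b_0,b_1>0$: $\gamma=(\mathbb E|\xi|^{2+\varepsilon})^{1/(2+\varepsilon)}<\infty$, $\mathbb P(\xi\le 0)=\tfrac12$, $h_\xi(x)\ge b_0^{-1}$ for $|x|\le C^*\gamma$, and $h_\xi(x)\le b_1^{-1}$ for all $x\in\mathbb R$. The tensor $S$ is $\alpha$-fraction sparse with $\alpha\in(0,1)$: each row of each $\mathfrak M_k(S)$ has at most $\alpha d_k^-$ non-zero entries; these entries are arbitrary (they may depend on $\Xi$). Let $\mu>0$. **Lemma (two-phase regularity of the absolute loss).** There are absolute constants $c,c_2>0$ and, for each $m$,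 a constant $c_1>0$ that depends only on $m$, such that in the above setting, with probability exceeding $$1-c\sum_{k=1}^m d_k(d_k^-)^{-1-\min\{1,\varepsilon\}}-\exp(-\mathrm{DoF}_m/2),$$ the following facts hold. (1) For all $T\in\mathbb R^{d_1\times\cdots\times d_m}$ and any sub-gradient $G\in\partial\|T-Y\|_1$, $$\|\mathcal P_{\mathbb T}(G)\|_{\mathrm F}\le (d^*)^{1/2},$$ $$\|T-Y\|_1-\|T^*-Y\|_1\ge\|T-T^*\|_\infty^{-1}\left(\|T-T^*\|_{\mathrm F}^2-2\alpha d^*\|T-T^*\|_\infty^2\right)-6d^*\gamma .$$ Furthermore, if $T\in\mathbb M_{\mathbf r,\mu}$, then for each $k\le m$ and $j\le d_k$, $$\|\mathfrak M_k(\mathcal P_{\mathbb T}(G))\|_{2,\infty}\le(3\mu r_kd_k^-)^{1/2}$$ and, with $\Delta=\mathfrak M_k(T-T^*)_{j,\cdot}$, $$\|\mathfrak M_k(T-Y)_{j,\cdot}\|_1-\|\mathfrak M_k(T^*-Y)_{j,\cdot}\|_1\ge\|\Delta\|_\infty^{-1}\left(\|\Delta\|_{\mathrm F}^2-2\alpha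 d_k^-\|\Delta\|_\infty^2\right)-6d_k^-\gamma .$$ (If the sup norm is $0$, the term that contains its inverse is read as $0$.) (2) For all $T\in\mathbb M_{\mathbf r,\mu}$ and any sub-gradient $G\in\partial\|T-Y\|_1$, if $\|T-T^*\|_\infty\le C^*\gamma$ and $$\|T-T^*\|_{\mathrm F}\ge c_1b_0\max\left\{\mathrm{DoF}_m^{1/2},\ \alpha\left((m+1)\max\{\mu^*,\mu\}^m r^*d^*\right)^{1/2}\right\},$$ then $$\|\mathcal P_{\mathbb T}(G)\|_{\mathrm F}\le c_2(m+1)^{1/2}b_1^{-1}\|T-T^*\|_{\mathrm F},\qquad \|T-Y\|_1-\|T^*-Y\|_1\ge\frac{\|T-T^*\|_{\mathrm F}^2}{2b_0}.$$ -/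

import Mathlib

open MeasureTheory ProbabilityTheory

namespace RobustTensor

noncomputable section

/-- Real tensors of size `d 0 × ⋯ × d (m-1)`; the Euclidean norm is the Frobenius norm. -/
abbrev Tensor {m : ℕ} (d : Fin m → ℕ) : Type :=
  EuclideanSpace ℝ ((k : Fin m) → Fin (d k))

/-- The column indices of the mode-`k` matricization: all coordinates except the `k`-th one. -/
abbrev CoIndex {m : ℕ} (d : Fin m → ℕ) (k : Fin m) : Type :=
  (l : {l : Fin m // l ≠ k}) → Fin (d l)

/-- The mode-`k` matricization. Its row `j` lists the entries of the `j`-th slice in mode `k`. -/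
def matricize {m : ℕ} {d : Fin m → ℕ} (k : Fin m) (T : Tensor d) :
    Matrix (Fin (d k)) (CoIndex d k) ℝ :=
  Matrix.of fun j c => T ((Equiv.piSplitAt k fun l => Fin (d l)).symm (j, c))

/-- `d^* = d_1 ⋯ d_m` (also used for `r^*`). -/
def dStar {m : ℕ} (d : Fin m → ℕ) : ℝ := ∏ k, (d k : ℝ)

/-- `d_k^- = ∏_{l ≠ k} d_l`. -/
def dMinus {m : ℕ} (d : Fin m → ℕ) (k : Fin m) : ℝ := ∏ l ∈ Finset.univ.erase k, (d l : ℝ)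

/-- `DoF_m = r_1 ⋯ r_m + ∑_k d_k r_k`. -/
def dof {m : ℕ} (d r : Fin m → ℕ) : ℝ := (∏ k, (r k : ℝ)) + ∑ k, (d k : ℝ) * (r k : ℝ)

/-- The entrywise `ℓ₁` norm of a family of reals (a tensor, or a row of a matrix). -/
def l1Norm {ι : Type*} [Fintype ι] (x : ι → ℝ) : ℝ := ∑ i, |x i|

/-- The entrywise sup norm of a finite family of reals. -/
def linfNorm {ι : Type*} (x : ι → ℝ) : ℝ := ⨆ i, |x i|

/-- The Euclidean norm of a finite family of reals. -/
def l2Norm {ι : Type*} [Fintype ι] (x : ι → ℝ) : ℝ := Real.sqrt (∑ i, x i ^ 2)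

/-- The `(2,∞)`-norm of a matrix: the largest Euclidean norm of a row. -/
def twoInfNorm {ι κ : Type*} [Fintype κ] (A : Matrix ι κ ℝ) : ℝ := ⨆ i, l2Norm (A i)

/-- The Tucker rank of `T` is `r`. -/
def HasTuckerRank {m : ℕ} {d : Fin m → ℕ} (r : Fin m → ℕ) (T : Tensor d) : Prop :=
  ∀ k, (matricize k T).rank = r k

/-- The column space of the mode-`k` matricization. -/
def modeSpace {m : ℕ} {d : Fin m → ℕ} (T : Tensor d) (k : Fin m) :
    Submodule ℝ (EuclideanSpace ℝ (Fin (d k))) :=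
  LinearMap.range (Matrix.toEuclideanLin (matricize k T))

/-- The factor `U_k` of a Tucker decomposition `T = C · ⟦U_1, …, U_m⟧`: a matrix whose columns are
an orthonormal basis of the column space of the mode-`k` matricization. Another choice of the basis
multiplies `U_k` by an orthogonal matrix from the right, which changes neither the norms of its rows
nor its column space. -/
def tuckerFactor {m : ℕ} {d : Fin m → ℕ} (T : Tensor d) (k : Fin m) :
    Matrix (Fin (d k)) (Fin (Module.finrank ℝ (modeSpace T k))) ℝ :=
  Matrix.of fun i a => (stdOrthonormalBasis ℝ (modeSpace T k) a : EuclideanSpace ℝ (Fin (d k))) i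

/-- The incoherence parameter `μ(T) = max_k ‖U_k‖_{2,∞}² d_k / r_k`. -/
def incoherence {m : ℕ} {d : Fin m → ℕ} (r : Fin m → ℕ) (T : Tensor d) : ℝ :=
  ⨆ k, twoInfNorm (tuckerFactor T k) ^ 2 * (d k : ℝ) / (r k : ℝ)

/-- The set `𝕄_{r,μ}` of `μ`-incoherent tensors of Tucker rank at most `r`. -/
def incoherentTensors {m : ℕ} (d r : Fin m → ℕ) (μ : ℝ) : Set (Tensor d) :=
  {T | (∀ k, (matricize k T).rank ≤ r k) ∧ incoherence r T ≤ μ}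

/-- `σ_{n+1}(A)`, the singular values being listed in decreasing order, from index `0` on. -/
def singVal {ι κ : Type*} [Fintype ι] [Fintype κ] [DecidableEq κ]
    (A : Matrix ι κ ℝ) (n : ℕ) : ℝ :=
  (Matrix.toEuclideanLin A).singularValues n

/-- The condition number: `max_k σ_1(M_k(T))` over `min_k σ_{r_k}(M_k(T))`. -/
def condNumber {m : ℕ} {d : Fin m → ℕ} (r : Fin m → ℕ) (T : Tensor d) : ℝ :=
  (⨆ k, singVal (matricize k T) 0) / (⨅ k, singVal (matricize k T) (r k - 1))

/-- The Tucker product `C ↦ C · ⟦U_1, …, U_m⟧`, with entries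
`∑_a C_{a_1 ⋯ a_m} (U_1)_{i_1 a_1} ⋯ (U_m)_{i_m a_m}`, as a linear map. -/
def tuckerMap {m : ℕ} {d s : Fin m → ℕ} (U : (k : Fin m) → Matrix (Fin (d k)) (Fin (s k)) ℝ) :
    Tensor s →ₗ[ℝ] Tensor d :=
  Matrix.toEuclideanLin
    (Matrix.of fun (i : (k : Fin m) → Fin (d k)) (a : (k : Fin m) → Fin (s k)) =>
      ∏ k, U k (i k) (a k))

/-- The mode-`k` product of `T` with a square matrix `A`, with entries
`∑_j A_{i_k j} T_{i_1 ⋯ i_{k-1} j i_{k+1} ⋯ i_m}`. -/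
def modeProd {m : ℕ} {d : Fin m → ℕ} (k : Fin m) (T : Tensor d)
    (A : Matrix (Fin (d k)) (Fin (d k)) ℝ) : Tensor d :=
  WithLp.toLp 2 fun i => ∑ j, A (i k) j * T (Function.update i k j)

/-- The tangent space at `T = C · ⟦U_1, …, U_m⟧` of the manifold of the tensors that have the same
Tucker rank as `T`: the tensors `C' · ⟦U_1, …, U_m⟧ + ∑_k C · ⟦U_1, …, V_k, …, U_m⟧` with an
arbitrary core `C'` and arbitrary matrices `V_k`. As `U_kᵀ U_k = 1`, the `k`-th summand is the mode
product of `T` with `A = V_k U_kᵀ`, and each mode product of `T` with a matrix `A` is of that form,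
with `V_k = A U_k`. -/
def tangentSpace {m : ℕ} {d : Fin m → ℕ} (T : Tensor d) : Submodule ℝ (Tensor d) :=
  LinearMap.range (tuckerMap (tuckerFactor T)) ⊔
    ⨆ k, Submodule.span ℝ (Set.range (modeProd k T))

/-- The orthogonal projection onto the tangent space at `T`. -/
def tangentProj {m : ℕ} {d : Fin m → ℕ} (T G : Tensor d) : Tensor d :=
  (tangentSpace T).starProjection G

/-- `G` is a sub-gradient at `T` of the function `X ↦ ‖X - Y‖₁`. -/
def IsL1Subgradient {m : ℕ} {d : Fin m → ℕ} (Y T G : Tensor d) : Prop :=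
  ∀ X : Tensor d, l1Norm (T - Y) + inner ℝ G (X - T) ≤ l1Norm (X - Y)

/-- Each slice of `S` has at most an `α` fraction of non-zero entries. -/
def IsFractionSparse {m : ℕ} {d : Fin m → ℕ} (α : ℝ) (S : Tensor d) : Prop :=
  ∀ (k : Fin m) (j : Fin (d k)),
    (Set.ncard {c : CoIndex d k | matricize k S j c ≠ 0} : ℝ) ≤ α * dMinus d k

/-- The constant `(5m+1)² 6^m κ^m μ^{m(m+1)/2} R^{(m+1)/2}`. -/
def noiseConst (m : ℕ) (μ R κ : ℝ) : ℝ :=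
  (5 * (m : ℝ) + 1) ^ 2 * 6 ^ m * κ ^ m * μ ^ ((m : ℝ) * ((m : ℝ) + 1) / 2) *
    R ^ (((m : ℝ) + 1) / 2)

/-- `γ = (𝔼 |ξ|^{2+ε})^{1/(2+ε)}` for `ξ` with law `ν`. -/
def noiseScale (ν : Measure ℝ) (ε : ℝ) : ℝ := (∫ x, |x| ^ (2 + ε) ∂ν) ^ (1 / (2 + ε))

/-- The noise condition on a law `ν` with density `h`: finite moment of order `2 + ε`, median zero,
density at most `b₁⁻¹` everywhere and at least `b₀⁻¹` on `[-K γ, K γ]`. -/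
structure NoiseCondition (ν : Measure ℝ) (h : ℝ → ℝ) (ε b₀ b₁ K : ℝ) : Prop where
  eps_pos : 0 < ε
  b₀_pos : 0 < b₀
  b₁_pos : 0 < b₁
  moment : Integrable (fun x => |x| ^ (2 + ε)) ν
  median : ν (Set.Iic 0) = 1 / 2
  density_measurable : Measurable h
  density_nonneg : ∀ x, 0 ≤ h x
  density : ν = volume.withDensity fun x => ENNReal.ofReal (h x)
  lower : ∀ x, |x| ≤ K * noiseScale ν ε → b₀⁻¹ ≤ h x
  upper : ∀ x, h x ≤ b₁⁻¹

end

end RobustTensor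

open RobustTensor

/-! The good event depends on the noise alone and provides two bounds: every slice of `Ξ` has small
`ℓ₁` norm, and the centred loss process is small at all low-rank tensors simultaneously. Everything
else is deterministic, which is why the outliers may depend on `Ξ`.

First phase. With `Δ = T - T*`, the triangle inequality gives a loss increase of at least `‖Δ‖₁`
minus twice the `ℓ₁` norm of the noise and twice the mass of `Δ` on the outliers; moreover `‖Δ‖_F² ≤
‖Δ‖_∞ ‖Δ‖₁`. The noise sums come from truncation and a fourth-moment bound
(`measure_sum_abs_gt_le`). The gradient bounds use that subgradient entries lie in `[-1, 1]`,
together with a slicewise estimate for the tangent projection (`sum_row_starProjection_le`).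

Second phase. Since the median is zero, the mean of `|δ - ξ| - |ξ|` lies between `δ²/b₀` (for small
`δ`) and `δ²/b₁`, so the mean loss is quadratic (`integral_lossDiff_eq`). Two errors have to be
absorbed. The fluctuation: `|δ - x| - |x|` is bounded by `|δ|` whatever the tails of the noise, so
the centred loss has sub-Gaussian increments. Tensors of bounded Tucker rank are a Lipschitz image
of a ball in a space of dimension comparable to `DoF`, and chaining bounds the process there by a
multiple of `‖Δ‖_F DoF^{1/2}`, at each of finitely many dyadic scales of `‖Δ‖_F`. The outliers: `Δ`
and tangent vectors split into `m + 1` orthogonal pieces, each incoherent in all modes but at most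
one. A sparse set can therefore carry only a small part of their norm (`norm_restrictTo_le`), which
yields the term with `α`. Once `‖Δ‖_F` exceeds the stated threshold, both errors together are at
most half of the quadratic term. For the gradient, the subgradient inequality is tested in the
direction of `P_T(G)`, rescaled to length `‖Δ‖_F` (`two_phase_of_deviation`). -/

namespace RobustTensor

/-! ### Algebra of mode products and matricizations. -/

section ModeProduct

variable {m : ℕ} {d : Fin m → ℕ}

theorem modeProd_apply (k : Fin m) (T : Tensor d) (A : Matrix (Fin (d k)) (Fin (d k)) ℝ)
    (i : (k : Fin m) → Fin (d k)) :
    modeProd k T A i = ∑ j, A (i k) j * T (Function.update i k j) := rfl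

theorem modeProd_add (k : Fin m) (S T : Tensor d) (A : Matrix (Fin (d k)) (Fin (d k)) ℝ) :
    modeProd k (S + T) A = modeProd k S A + modeProd k T A := by
  ext i; simp [modeProd_apply, mul_add, Finset.sum_add_distrib]

theorem modeProd_sub (k : Fin m) (S T : Tensor d) (A : Matrix (Fin (d k)) (Fin (d k)) ℝ) :
    modeProd k (S - T) A = modeProd k S A - modeProd k T A := by
  ext i; simp [modeProd_apply, mul_sub, Finset.sum_sub_distrib]

theorem modeProd_smul (k : Fin m) (a : ℝ) (T : Tensor d) (A : Matrix (Fin (d k)) (Fin (d k)) ℝ) :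
    modeProd k (a • T) A = a • modeProd k T A := by
  ext i; simp [modeProd_apply, Finset.mul_sum, mul_left_comm]

theorem modeProd_zero (k : Fin m) (A : Matrix (Fin (d k)) (Fin (d k)) ℝ) :
    modeProd k (0 : Tensor d) A = 0 := by
  ext i; simp [modeProd_apply]

theorem modeProd_mat_add (k : Fin m) (T : Tensor d) (A B : Matrix (Fin (d k)) (Fin (d k)) ℝ) :
    modeProd k T (A + B) = modeProd k T A + modeProd k T B := by
  ext i; simp [modeProd_apply, add_mul, Finset.sum_add_distrib]

theorem modeProd_mat_sub (k : Fin m) (T : Tensor d) (A B : Matrix (Fin (d k)) (Fin (d k)) ℝ) :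
    modeProd k T (A - B) = modeProd k T A - modeProd k T B := by
  ext i; simp [modeProd_apply, sub_mul, Finset.sum_sub_distrib]

theorem modeProd_mat_smul (k : Fin m) (T : Tensor d) (a : ℝ)
    (A : Matrix (Fin (d k)) (Fin (d k)) ℝ) :
    modeProd k T (a • A) = a • modeProd k T A := by
  ext i; simp [modeProd_apply, Finset.mul_sum, mul_assoc]

theorem modeProd_one (k : Fin m) (T : Tensor d) : modeProd k T 1 = T := by
  ext i; simp [modeProd_apply, Matrix.one_apply]

theorem modeProd_mul (k : Fin m) (T : Tensor d) (A B : Matrix (Fin (d k)) (Fin (d k)) ℝ) :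
    modeProd k T (A * B) = modeProd k (modeProd k T B) A := by
  ext i
  simp only [modeProd_apply, Matrix.mul_apply, Finset.sum_mul, Finset.mul_sum,
    Function.update_self, Function.update_idem]
  rw [Finset.sum_comm]
  simp [mul_assoc]

theorem modeProd_comm {k l : Fin m} (h : k ≠ l) (T : Tensor d)
    (A : Matrix (Fin (d k)) (Fin (d k)) ℝ) (B : Matrix (Fin (d l)) (Fin (d l)) ℝ) :
    modeProd k (modeProd l T B) A = modeProd l (modeProd k T A) B := by
  ext i
  simp only [modeProd_apply, Finset.mul_sum, Function.update_of_ne h, Function.update_of_ne h.symm]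
  rw [Finset.sum_comm]
  refine Finset.sum_congr rfl fun a _ => Finset.sum_congr rfl fun b _ => ?_
  rw [Function.update_comm h]; ring

/-- The index with `k`-th coordinate `j` and other coordinates `c`. -/
def joinIndex (k : Fin m) (j : Fin (d k)) (c : CoIndex d k) : (k : Fin m) → Fin (d k) :=
  (Equiv.piSplitAt k fun l => Fin (d l)).symm (j, c)

theorem matricize_apply (k : Fin m) (T : Tensor d) (j : Fin (d k)) (c : CoIndex d k) :
    matricize k T j c = T (joinIndex k j c) := rfl

@[simp]
theorem joinIndex_self (k : Fin m) (j : Fin (d k)) (c : CoIndex d k) :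
    joinIndex k j c k = j := by
  simp [joinIndex, Equiv.piSplitAt]

@[simp]
theorem update_joinIndex (k : Fin m) (j j' : Fin (d k)) (c : CoIndex d k) :
    Function.update (joinIndex k j c) k j' = joinIndex k j' c := by
  ext l
  by_cases h : l = k
  · subst h; simp
  · simp [joinIndex, Equiv.piSplitAt, h]

theorem sum_eq_sum_joinIndex {M : Type*} [AddCommMonoid M] (k : Fin m)
    (f : ((k : Fin m) → Fin (d k)) → M) :
    ∑ i, f i = ∑ j, ∑ c, f (joinIndex k j c) := by
  rw [← Fintype.sum_prod_type', ← (Equiv.piSplitAt k fun l => Fin (d l)).symm.sum_comp]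
  rfl

theorem matricize_modeProd (k : Fin m) (T : Tensor d) (A : Matrix (Fin (d k)) (Fin (d k)) ℝ) :
    matricize k (modeProd k T A) = A * matricize k T := by
  ext j c
  simp [matricize_apply, modeProd_apply, Matrix.mul_apply]

theorem matricize_add (k : Fin m) (S T : Tensor d) :
    matricize k (S + T) = matricize k S + matricize k T := rfl

theorem matricize_sub (k : Fin m) (S T : Tensor d) :
    matricize k (S - T) = matricize k S - matricize k T := rfl

theorem matricize_smul (k : Fin m) (a : ℝ) (T : Tensor d) :
    matricize k (a • T) = a • matricize k T := rfl

theorem matricize_injective (k : Fin m) :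
    Function.Injective (matricize k : Tensor d → Matrix (Fin (d k)) (CoIndex d k) ℝ) := by
  intro S T h
  ext i
  have := congrFun (congrFun h (i k)) (fun l => i l)
  rw [matricize_apply, matricize_apply] at this
  have e : joinIndex k (i k) (fun l => i l) = i :=
    (Equiv.piSplitAt k fun l => Fin (d l)).symm_apply_apply i
  rwa [e] at this

theorem norm_sq_eq_sum (T : Tensor d) : ‖T‖ ^ 2 = ∑ i, T i ^ 2 := by
  simp [EuclideanSpace.norm_sq_eq]

theorem norm_sq_eq_sum_matricize (k : Fin m) (T : Tensor d) :
    ‖T‖ ^ 2 = ∑ j, ∑ c, matricize k T j c ^ 2 := by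
  rw [norm_sq_eq_sum, sum_eq_sum_joinIndex k]; rfl

theorem inner_eq_sum (S T : Tensor d) : inner ℝ S T = ∑ i, S i * T i := by
  simp [PiLp.inner_apply, mul_comm]

/-- Adjointness is what makes orthogonal complements of spaces invariant under mode-`k` products
again invariant, and symmetric idempotents act as orthogonal projections. -/
theorem inner_modeProd (k : Fin m) (S T : Tensor d) (A : Matrix (Fin (d k)) (Fin (d k)) ℝ) :
    inner ℝ (modeProd k S A) T = inner ℝ S (modeProd k T A.transpose) := by
  rw [inner_eq_sum, inner_eq_sum, sum_eq_sum_joinIndex k, sum_eq_sum_joinIndex k, Finset.sum_comm,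
    Finset.sum_comm (f := fun j c => S (joinIndex k j c) * _)]
  refine Finset.sum_congr rfl fun c _ => ?_
  simp only [modeProd_apply, joinIndex_self, update_joinIndex, Finset.sum_mul, Finset.mul_sum,
    Matrix.transpose_apply]
  rw [Finset.sum_comm]
  refine Finset.sum_congr rfl fun a _ => Finset.sum_congr rfl fun b _ => by ring

theorem norm_modeProd_le (k : Fin m) (T : Tensor d) (A : Matrix (Fin (d k)) (Fin (d k)) ℝ)
    {a : ℝ} (ha : 0 ≤ a) (hA : ∀ x : Fin (d k) → ℝ, ∑ i, (A.mulVec x i) ^ 2 ≤ a ^ 2 * ∑ i, x i ^ 2) :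
    ‖modeProd k T A‖ ≤ a * ‖T‖ := by
  refine abs_le_of_sq_le_sq' ?_ (by positivity) |>.2
  rw [mul_pow, norm_sq_eq_sum_matricize k, norm_sq_eq_sum_matricize k T, matricize_modeProd,
    Finset.sum_comm, Finset.sum_comm (γ := Fin (d k)), Finset.mul_sum]
  exact Finset.sum_le_sum fun c _ => hA fun j => matricize k T j c

theorem sum_row_modeProd_le (k : Fin m) (T : Tensor d) (A : Matrix (Fin (d k)) (Fin (d k)) ℝ)
    (j : Fin (d k)) :
    ∑ c, matricize k (modeProd k T A) j c ^ 2 ≤ (∑ a, A j a ^ 2) * ‖T‖ ^ 2 := by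
  rw [norm_sq_eq_sum_matricize k T, matricize_modeProd, Finset.sum_comm, Finset.mul_sum]
  exact Finset.sum_le_sum fun c _ =>
    Finset.sum_mul_sq_le_sq_mul_sq Finset.univ (A j) fun a => matricize k T a c

end ModeProduct

/-! ### Tucker factors, incoherence, and the structure of the tangent space. -/

section Factors

variable {m : ℕ} {d : Fin m → ℕ}

theorem l2Norm_sq {ι : Type*} [Fintype ι] (x : ι → ℝ) : l2Norm x ^ 2 = ∑ i, x i ^ 2 :=
  Real.sq_sqrt (Finset.sum_nonneg fun _ _ => sq_nonneg _)

theorem l2Norm_nonneg {ι : Type*} [Fintype ι] (x : ι → ℝ) : 0 ≤ l2Norm x := Real.sqrt_nonneg _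

theorem l2Norm_le_twoInfNorm {ι κ : Type*} [Finite ι] [Fintype κ] (A : Matrix ι κ ℝ) (i : ι) :
    l2Norm (A i) ≤ twoInfNorm A :=
  le_ciSup (f := fun i => l2Norm (A i)) (Set.finite_range _).bddAbove i

theorem finrank_modeSpace (T : Tensor d) (k : Fin m) :
    Module.finrank ℝ (modeSpace T k) = (matricize k T).rank := by
  rw [Matrix.rank_eq_finrank_range_toLin _ (PiLp.basisFun 2 ℝ _) (PiLp.basisFun 2 ℝ _)]
  rfl

theorem tuckerFactor_transpose_mul (T : Tensor d) (k : Fin m) :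
    (tuckerFactor T k).transpose * tuckerFactor T k = 1 := by
  ext a b
  have h := orthonormal_iff_ite.1 (stdOrthonormalBasis ℝ (modeSpace T k)).orthonormal a b
  rw [Submodule.coe_inner, PiLp.inner_apply] at h
  simpa [Matrix.mul_apply, tuckerFactor, Matrix.one_apply, mul_comm] using h

/-- The matrix of the orthogonal projection onto the column space of the mode-`k` matricization. -/
noncomputable def factorProj (T : Tensor d) (k : Fin m) : Matrix (Fin (d k)) (Fin (d k)) ℝ :=
  tuckerFactor T k * (tuckerFactor T k).transpose

theorem factorProj_transpose (T : Tensor d) (k : Fin m) :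
    (factorProj T k).transpose = factorProj T k := by
  simp [factorProj, Matrix.transpose_mul]

theorem factorProj_mul_tuckerFactor (T : Tensor d) (k : Fin m) :
    factorProj T k * tuckerFactor T k = tuckerFactor T k := by
  rw [factorProj, Matrix.mul_assoc, tuckerFactor_transpose_mul, Matrix.mul_one]

theorem factorProj_mul_self (T : Tensor d) (k : Fin m) :
    factorProj T k * factorProj T k = factorProj T k := by
  nth_rw 2 [factorProj]
  rw [← Matrix.mul_assoc, factorProj_mul_tuckerFactor, factorProj]

theorem factorProj_mul_matricize (T : Tensor d) (k : Fin m) :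
    factorProj T k * matricize k T = matricize k T := by
  set b := stdOrthonormalBasis ℝ (modeSpace T k)
  ext i c
  let v : modeSpace T k := ⟨Matrix.toEuclideanLin (matricize k T) (EuclideanSpace.single c 1), _, rfl⟩
  have hv (j) : (v : EuclideanSpace ℝ (Fin (d k))) j = matricize k T j c := by
    simp [v, Matrix.toLpLin_apply]
  have h := congrArg (fun w : modeSpace T k => (w : EuclideanSpace ℝ (Fin (d k))) i) (b.sum_repr v)
  simp only [Submodule.coe_sum, Submodule.coe_smul, hv] at h
  rw [← h, WithLp.ofLp_sum, Finset.sum_apply, factorProj, Matrix.mul_assoc, Matrix.mul_apply]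
  refine Finset.sum_congr rfl fun a _ => ?_
  rw [b.repr_apply_apply, Submodule.coe_inner, PiLp.inner_apply]
  simp [Matrix.mul_apply, tuckerFactor, hv, b, mul_comm]

theorem modeProd_factorProj (T : Tensor d) (k : Fin m) : modeProd k T (factorProj T k) = T :=
  matricize_injective k (by rw [matricize_modeProd, factorProj_mul_matricize])

theorem sum_factorProj_row (T : Tensor d) (k : Fin m) (j : Fin (d k)) :
    ∑ a, factorProj T k j a ^ 2 = l2Norm (tuckerFactor T k j) ^ 2 := by
  have h1 : ∑ a, factorProj T k j a ^ 2 = (factorProj T k * factorProj T k) j j := by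
    rw [Matrix.mul_apply]
    refine Finset.sum_congr rfl fun a _ => ?_
    rw [← Matrix.transpose_apply (factorProj T k) j a, factorProj_transpose, sq]
  rw [h1, factorProj_mul_self, l2Norm_sq, factorProj, Matrix.mul_apply]
  simp [sq]

theorem twoInfNorm_sq_le_incoherence (r : Fin m → ℕ) (T : Tensor d) (k : Fin m) :
    twoInfNorm (tuckerFactor T k) ^ 2 * (d k : ℝ) / (r k : ℝ) ≤ incoherence r T :=
  le_ciSup (f := fun k => twoInfNorm (tuckerFactor T k) ^ 2 * (d k : ℝ) / (r k : ℝ))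
    (Set.finite_range _).bddAbove k

theorem l2Norm_tuckerFactor_sq_le {r : Fin m → ℕ} (hr : ∀ k, 1 ≤ r k) (T : Tensor d) {μ : ℝ}
    (hμ : incoherence r T ≤ μ) (k : Fin m) (j : Fin (d k)) :
    l2Norm (tuckerFactor T k j) ^ 2 ≤ μ * r k / d k := by
  have hd : (0 : ℝ) < d k := by exact_mod_cast j.pos
  have hr' : (0 : ℝ) < r k := by exact_mod_cast hr k
  have h := (twoInfNorm_sq_le_incoherence r T k).trans hμ
  rw [div_le_iff₀ hr'] at h
  rw [le_div_iff₀ hd]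
  refine le_trans ?_ h
  gcongr
  · exact l2Norm_nonneg _
  · exact l2Norm_le_twoInfNorm _ _

/-- The squared row norms of `U_k` sum to the trace of `U_kᵀ U_k = 1`, which is the rank. This
bounds `μ r_k` from below, and `μ*` from below by one. -/
theorem rank_le_mul_incoherence {r : Fin m → ℕ} (hr : ∀ k, 1 ≤ r k) (T : Tensor d) {μ : ℝ}
    (hμ : incoherence r T ≤ μ) (k : Fin m) (hd : 1 ≤ d k) :
    ((matricize k T).rank : ℝ) ≤ μ * r k := by
  have h1 : ∑ j, l2Norm (tuckerFactor T k j) ^ 2 = (matricize k T).rank := by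
    have h := congrArg Matrix.trace (tuckerFactor_transpose_mul T k)
    rw [Matrix.trace_one, Fintype.card_fin] at h
    rw [← finrank_modeSpace, ← h]
    simp only [l2Norm_sq, Matrix.trace, Matrix.diag, Matrix.mul_apply, Matrix.transpose_apply]
    rw [Finset.sum_comm]
    simp [sq]
  have hd' : (0 : ℝ) < d k := by exact_mod_cast hd
  rw [← h1]
  calc _ ≤ ∑ j : Fin (d k), μ * r k / d k :=
        Finset.sum_le_sum fun j _ => l2Norm_tuckerFactor_sq_le hr T hμ k j
    _ = μ * r k := by simp; field_simp

/-- The mode-`k` product with a fixed matrix, as a linear map. -/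
noncomputable def modeProdLin (k : Fin m) (A : Matrix (Fin (d k)) (Fin (d k)) ℝ) :
    Tensor d →ₗ[ℝ] Tensor d where
  toFun T := modeProd k T A
  map_add' S T := modeProd_add k S T A
  map_smul' a T := modeProd_smul k a T A

/-- The mode-`k` product of a fixed tensor with a matrix, as a linear map. -/
noncomputable def matProdLin (k : Fin m) (T : Tensor d) :
    Matrix (Fin (d k)) (Fin (d k)) ℝ →ₗ[ℝ] Tensor d where
  toFun A := modeProd k T A
  map_add' A B := modeProd_mat_add k T A B
  map_smul' a A := modeProd_mat_smul k T a A

theorem tuckerMap_apply {s : Fin m → ℕ} (U : (k : Fin m) → Matrix (Fin (d k)) (Fin (s k)) ℝ)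
    (C : Tensor s) (i : (k : Fin m) → Fin (d k)) :
    tuckerMap U C i = ∑ a, (∏ k, U k (i k) (a k)) * C a := by
  simp [tuckerMap, Matrix.toLpLin_apply, Matrix.mulVec, dotProduct]

theorem modeProd_tuckerMap {s : Fin m → ℕ} (U : (k : Fin m) → Matrix (Fin (d k)) (Fin (s k)) ℝ)
    (C : Tensor s) (k : Fin m) (A : Matrix (Fin (d k)) (Fin (d k)) ℝ) (hA : A * U k = U k) :
    modeProd k (tuckerMap U C) A = tuckerMap U C := by
  ext i
  simp only [modeProd_apply, tuckerMap_apply, Finset.mul_sum]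
  rw [Finset.sum_comm]
  refine Finset.sum_congr rfl fun a _ => ?_
  have h := congrFun (congrFun hA (i k)) (a k)
  rw [Matrix.mul_apply] at h
  rw [← Finset.mul_prod_erase Finset.univ _ (Finset.mem_univ k), ← h, Finset.sum_mul,
    Finset.sum_mul]
  refine Finset.sum_congr rfl fun j _ => ?_
  rw [← Finset.mul_prod_erase Finset.univ _ (Finset.mem_univ k), Function.update_self]
  have : ∏ l ∈ Finset.univ.erase k, U l (Function.update i k j l) (a l)
      = ∏ l ∈ Finset.univ.erase k, U l (i l) (a l) :=
    Finset.prod_congr rfl fun l hl => by rw [Function.update_of_ne (Finset.ne_of_mem_erase hl)]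
  rw [this]; ring

theorem modeProd_mem_tangentSpace (T : Tensor d) (k : Fin m)
    (A : Matrix (Fin (d k)) (Fin (d k)) ℝ) : modeProd k T A ∈ tangentSpace T :=
  le_sup_right (a := LinearMap.range (tuckerMap (tuckerFactor T)))
    (Submodule.mem_iSup_of_mem k (Submodule.subset_span ⟨A, rfl⟩))

/-- Every generator of the tangent space other than the mode-`k` products of `T` is fixed by the
mode-`k` projection: the core part because its factors are those of `T`, a mode-`l` product because
it commutes with mode `k`. This splitting is all that is used later about tangent vectors. -/
theorem exists_add_of_mem_tangentSpace {T Z : Tensor d} (hZ : Z ∈ tangentSpace T) (k : Fin m) :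
    ∃ (Z' : Tensor d) (A : Matrix (Fin (d k)) (Fin (d k)) ℝ),
      modeProd k Z' (factorProj T k) = Z' ∧ Z = Z' + modeProd k T A := by
  have h : tangentSpace T ≤ LinearMap.eqLocus (modeProdLin k (factorProj T k)) LinearMap.id ⊔
      LinearMap.range (matProdLin k T) := by
    refine sup_le (le_sup_of_le_left ?_) (iSup_le fun l => ?_)
    · rintro _ ⟨C, rfl⟩
      exact modeProd_tuckerMap _ C k _ (factorProj_mul_tuckerFactor T k)
    · by_cases hl : l = k
      · subst hl
        refine le_sup_of_le_right (Submodule.span_le.2 ?_)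
        rintro _ ⟨A, rfl⟩
        exact ⟨A, rfl⟩
      · refine le_sup_of_le_left (Submodule.span_le.2 ?_)
        rintro _ ⟨A, rfl⟩
        change modeProd k (modeProd l T A) _ = modeProd l T A
        rw [modeProd_comm (Ne.symm hl), modeProd_factorProj]
  obtain ⟨Z', hZ', _, ⟨A, rfl⟩, rfl⟩ := Submodule.mem_sup.1 (h hZ)
  exact ⟨Z', A, hZ', rfl⟩

theorem modeProd_one_sub_of_mem_tangentSpace {T Z : Tensor d} (hZ : Z ∈ tangentSpace T)
    {k l : Fin m} (hl : l ≠ k) :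
    modeProd l (modeProd k Z (1 - factorProj T k)) (factorProj T l)
      = modeProd k Z (1 - factorProj T k) := by
  obtain ⟨Z', A, hZ', rfl⟩ := exists_add_of_mem_tangentSpace hZ k
  have h0 : modeProd k Z' (1 - factorProj T k) = 0 := by
    rw [modeProd_mat_sub, modeProd_one, hZ', sub_self]
  rw [modeProd_add, h0, zero_add, ← modeProd_mul, modeProd_comm hl, modeProd_factorProj]

theorem matrix_rank_add_le {ι κ : Type*} [Fintype ι] [Fintype κ] (A B : Matrix ι κ ℝ) :
    (A + B).rank ≤ A.rank + B.rank := by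
  rw [Matrix.rank, Matrix.mulVecLin_add]
  refine le_trans (Submodule.finrank_mono ?_) (Submodule.finrank_add_le_finrank_add_finrank
    (LinearMap.range A.mulVecLin) (LinearMap.range B.mulVecLin))
  rintro _ ⟨x, rfl⟩
  exact Submodule.add_mem_sup ⟨x, rfl⟩ ⟨x, rfl⟩

theorem rank_matricize_smul_le (k : Fin m) (a : ℝ) (T : Tensor d) :
    (matricize k (a • T)).rank ≤ (matricize k T).rank := by
  have h : matricize k (a • T) = (a • (1 : Matrix (Fin (d k)) (Fin (d k)) ℝ)) * matricize k T := by
    rw [matricize_smul, Matrix.smul_mul, Matrix.one_mul]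
  rw [h]
  exact Matrix.rank_mul_le_right _ _

theorem rank_matricize_le_of_fixed (T Z : Tensor d) (k : Fin m)
    (h : modeProd k Z (factorProj T k) = Z) : (matricize k Z).rank ≤ (matricize k T).rank := by
  rw [← h, matricize_modeProd, factorProj, Matrix.mul_assoc]
  refine (Matrix.rank_mul_le_left _ _).trans ((Matrix.rank_le_card_width _).trans ?_)
  rw [Fintype.card_fin, finrank_modeSpace]

/-- One copy of the rank comes from the part fixed by the mode-`k` projection, the other from a
mode-`k` product of `T`. -/
theorem rank_matricize_add_le_of_mem_tangentSpace {T Z : Tensor d} (hZ : Z ∈ tangentSpace T)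
    (k : Fin m) : (matricize k (T + Z)).rank ≤ 2 * (matricize k T).rank := by
  obtain ⟨Z', A, hZ', rfl⟩ := exists_add_of_mem_tangentSpace hZ k
  have e : T + (Z' + modeProd k T A) = Z' + modeProd k T (1 + A) := by
    rw [modeProd_mat_add, modeProd_one]; abel
  rw [e, matricize_add, matricize_modeProd]
  have h1 := rank_matricize_le_of_fixed T Z' k hZ'
  have h2 := Matrix.rank_mul_le_right (1 + A) (matricize k T)
  have h3 := matrix_rank_add_le (matricize k Z') ((1 + A) * matricize k T)
  omega

/-- The mode-`k` products of `T` form a subspace `V` of the tangent space, invariant under all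
mode-`k` products, as is its complement. Hence projecting onto `V` does not enlarge any mode-`k`
slice. What remains of the tangent projection is fixed by `factorProj T k`, so its slice `j` is
controlled by row `j` of that matrix. -/
theorem sum_row_starProjection_le (T G : Tensor d) (k : Fin m) (j : Fin (d k)) :
    ∑ c, matricize k (tangentProj T G) j c ^ 2
      ≤ ∑ c, matricize k G j c ^ 2 + l2Norm (tuckerFactor T k j) ^ 2 * ‖G‖ ^ 2 := by
  set V : Submodule ℝ (Tensor d) := LinearMap.range (matProdLin k T) with hV
  have hVT : V ≤ tangentSpace T := by
    rintro _ ⟨A, rfl⟩; exact modeProd_mem_tangentSpace T k A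
  have hinv (A : Matrix (Fin (d k)) (Fin (d k)) ℝ) {X : Tensor d} (hX : X ∈ V) :
      modeProd k X A ∈ V := by
    obtain ⟨B, rfl⟩ := hX
    exact ⟨A * B, modeProd_mul k T A B⟩
  have hinv' (A : Matrix (Fin (d k)) (Fin (d k)) ℝ) {X : Tensor d} (hX : X ∈ Vᗮ) :
      modeProd k X A ∈ Vᗮ := by
    rw [Submodule.mem_orthogonal'] at hX ⊢
    intro u hu
    rw [inner_modeProd]
    exact hX _ (hinv _ hu)
  have hcomm (A : Matrix (Fin (d k)) (Fin (d k)) ℝ) (X : Tensor d) :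
      V.starProjection (modeProd k X A) = modeProd k (V.starProjection X) A := by
    refine Submodule.eq_starProjection_of_mem_orthogonal
      (hinv A (V.starProjection_apply_mem X)) ?_
    rw [← modeProd_sub]
    exact hinv' A (V.sub_starProjection_mem_orthogonal X)
  set X := tangentProj T G with hX
  have hXG : V.starProjection X = V.starProjection G := by
    have := Submodule.starProjection_comp_starProjection_of_le hVT
    exact congrArg (fun f => f G) this
  set b := X - V.starProjection X with hb
  have hbfix : modeProd k b (factorProj T k) = b := by
    obtain ⟨Z', A, hZ', h⟩ :=
      exists_add_of_mem_tangentSpace ((tangentSpace T).starProjection_apply_mem G) k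
    change X = _ at h
    have hA : V.starProjection (modeProd k T A) = modeProd k T A :=
      Submodule.starProjection_eq_self_iff.2 ⟨A, rfl⟩
    have : b = Z' - V.starProjection Z' := by
      rw [hb, h, map_add, hA]; abel
    rw [this, modeProd_sub, ← hcomm, hZ']
  have hbnorm : ‖b‖ ≤ ‖G‖ := by
    have h1 : ‖b‖ ≤ ‖X‖ := by
      have := Submodule.norm_sq_eq_add_norm_sq_starProjection X V
      rw [Submodule.starProjection_orthogonal_val] at this
      exact abs_le_of_sq_le_sq' (by nlinarith [sq_nonneg ‖V.starProjection X‖]) (norm_nonneg _) |>.2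
    exact h1.trans ((tangentSpace T).norm_starProjection_apply_le G)
  -- The mode product with `E` cuts out slice `j`; as it commutes with the projection onto `V`, the
  -- two parts stay orthogonal on the slice.
  set E : Matrix (Fin (d k)) (Fin (d k)) ℝ := Matrix.single j j 1 with hE
  have hslice (Y : Tensor d) : ‖modeProd k Y E‖ ^ 2 = ∑ c, matricize k Y j c ^ 2 := by
    rw [norm_sq_eq_sum_matricize k, matricize_modeProd, Finset.sum_eq_single j]
    · simp [hE]
    · intro i _ hi; simp [hE, hi]
    · simp
  have hdec : modeProd k X E = modeProd k (V.starProjection G) E + modeProd k b E := by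
    rw [← modeProd_add, hb, hXG]; congr 1; abel
  rw [← hslice, ← hslice G, hdec, @norm_add_sq_real]
  have horth : inner ℝ (modeProd k (V.starProjection G) E) (modeProd k b E) = 0 :=
    Submodule.inner_right_of_mem_orthogonal (hinv E (V.starProjection_apply_mem G))
      (hinv' E (V.sub_starProjection_mem_orthogonal X))
  have h1 : ‖modeProd k (V.starProjection G) E‖ ≤ ‖modeProd k G E‖ := by
    rw [← hcomm]; exact V.norm_starProjection_apply_le _
  have h2 : ‖modeProd k b E‖ ^ 2 ≤ l2Norm (tuckerFactor T k j) ^ 2 * ‖G‖ ^ 2 := by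
    rw [hslice, ← sum_factorProj_row]
    nth_rw 1 [← hbfix]
    refine (sum_row_modeProd_le k b _ j).trans ?_
    gcongr
  have h3 : ‖modeProd k (V.starProjection G) E‖ ^ 2 ≤ ‖modeProd k G E‖ ^ 2 := by gcongr
  linarith

end Factors

/-! ### Incoherent tensors put little mass on sparse sets. -/

section Spikiness

variable {m : ℕ} {d : Fin m → ℕ}

/-- In mode `l`, the tensor `Z` is reproduced by a matrix all of whose rows have squared Euclidean
norm at most `ν`. -/
def IsSpreadIn (ν : ℝ) (l : Fin m) (Z : Tensor d) : Prop :=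
  ∃ A : Matrix (Fin (d l)) (Fin (d l)) ℝ, (∀ j, ∑ a, A j a ^ 2 ≤ ν) ∧ modeProd l Z A = Z

theorem IsSpreadIn.modeProd_of_ne {ν : ℝ} {k l : Fin m} {Z : Tensor d} (h : IsSpreadIn ν l Z)
    (hkl : l ≠ k) (B : Matrix (Fin (d k)) (Fin (d k)) ℝ) : IsSpreadIn ν l (modeProd k Z B) := by
  obtain ⟨A, hA, hZ⟩ := h
  exact ⟨A, hA, by rw [modeProd_comm hkl, hZ]⟩

/-- Bookkeeping for the next induction: freeing the coordinate `l` splits the larger fibre according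
to the value of that coordinate. -/
theorem sum_agree_insert (f : ((k : Fin m) → Fin (d k)) → ℝ) (s : Finset (Fin m)) {l : Fin m}
    (hl : l ∉ s) (i : (k : Fin m) → Fin (d k)) :
    ∑ a, ∑ j, (if ∀ l' ∉ s, j l' = Function.update i l a l' then f j else 0)
      = ∑ j, if ∀ l' ∉ insert l s, j l' = i l' then f j else 0 := by
  rw [Finset.sum_comm]
  refine Finset.sum_congr rfl fun j _ => ?_
  have h (a : Fin (d l)) : (∀ l' ∉ s, j l' = Function.update i l a l')
      ↔ (j l = a ∧ ∀ l' ∉ insert l s, j l' = i l') := by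
    constructor
    · intro h
      refine ⟨by simpa using h l hl, fun l' hl' => ?_⟩
      rw [Finset.mem_insert, not_or] at hl'
      simpa [hl'.1] using h l' hl'.2
    · rintro ⟨h1, h2⟩ l' hl'
      by_cases e : l' = l
      · subst e; simpa using h1
      · simpa [e] using h2 l' (by simp [e, hl'])
  simp_rw [h, ite_and]
  simp

/-- One application of Cauchy–Schwarz per mode in `s`: each replaces the entry by a sum over that
coordinate at the price of a factor `ν l`. -/
theorem sq_entry_le_of_isSpreadIn {Z : Tensor d} {ν : Fin m → ℝ} (hν : ∀ l, 0 ≤ ν l)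
    (s : Finset (Fin m)) (hs : ∀ l ∈ s, IsSpreadIn (ν l) l Z) (i : (k : Fin m) → Fin (d k)) :
    Z i ^ 2 ≤ (∏ l ∈ s, ν l) * ∑ j, if ∀ l' ∉ s, j l' = i l' then Z j ^ 2 else 0 := by
  induction s using Finset.induction_on generalizing i with
  | empty =>
    have h (j : (k : Fin m) → Fin (d k)) : (∀ l' ∉ (∅ : Finset (Fin m)), j l' = i l') ↔ j = i := by
      simp [funext_iff]
    simp only [h]
    simp
  | insert l s hl ih =>
    obtain ⟨A, hA, hZ⟩ := hs l (Finset.mem_insert_self _ _)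
    have h1 : Z i ^ 2 ≤ ν l * ∑ a, Z (Function.update i l a) ^ 2 := by
      nth_rw 1 [← hZ]
      rw [modeProd_apply]
      refine (Finset.sum_mul_sq_le_sq_mul_sq _ _ _).trans ?_
      gcongr
      exact hA _
    refine h1.trans ?_
    rw [Finset.prod_insert hl, mul_assoc, ← sum_agree_insert _ s hl]
    refine mul_le_mul_of_nonneg_left ?_ (hν l)
    rw [Finset.mul_sum]
    refine Finset.sum_le_sum fun a _ => ?_
    exact ih (fun l' hl' => hs l' (Finset.mem_insert_of_mem hl')) _

/-- The tensor with the entries outside `s` replaced by zero. -/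
noncomputable def restrictTo (s : Finset ((k : Fin m) → Fin (d k))) (Z : Tensor d) : Tensor d :=
  WithLp.toLp 2 fun i => if i ∈ s then Z i else 0

theorem restrictTo_add (s : Finset ((k : Fin m) → Fin (d k))) (Y Z : Tensor d) :
    restrictTo s (Y + Z) = restrictTo s Y + restrictTo s Z := by
  ext i; simp only [restrictTo, PiLp.add_apply]; split_ifs <;> simp

theorem norm_sq_restrictTo (s : Finset ((k : Fin m) → Fin (d k))) (Z : Tensor d) :
    ‖restrictTo s Z‖ ^ 2 = ∑ i ∈ s, Z i ^ 2 := by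
  rw [norm_sq_eq_sum, ← Finset.sum_filter_add_sum_filter_not Finset.univ (· ∈ s)]
  simp only [restrictTo]
  rw [Finset.sum_congr rfl (g := fun i => Z i ^ 2),
    Finset.sum_congr (s₁ := Finset.univ.filter (· ∉ s)) rfl (g := fun i => 0)]
  · simp
  · intro i hi; simp [(Finset.mem_filter.1 hi).2]
  · intro i hi; simp [(Finset.mem_filter.1 hi).2]

/-- Spreading in all modes but `k` bounds an entry by the energy of its own mode-`k` slice, so only
the number of points of `s` in each slice matters. Mode `k` itself needs no incoherence. -/
theorem norm_sq_restrictTo_le {Z : Tensor d} {ν : Fin m → ℝ} (hν : ∀ l, 0 ≤ ν l) (k : Fin m)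
    (hZ : ∀ l, l ≠ k → IsSpreadIn (ν l) l Z) (s : Finset ((k : Fin m) → Fin (d k))) {a : ℝ}
    (hs : ∀ j, ((Finset.univ.filter fun c => joinIndex k j c ∈ s).card : ℝ) ≤ a) :
    ‖restrictTo s Z‖ ^ 2 ≤ (∏ l ∈ Finset.univ.erase k, ν l) * a * ‖Z‖ ^ 2 := by
  have h1 (j : Fin (d k)) (c : CoIndex d k) : Z (joinIndex k j c) ^ 2
      ≤ (∏ l ∈ Finset.univ.erase k, ν l) * ∑ c, matricize k Z j c ^ 2 := by
    refine (sq_entry_le_of_isSpreadIn hν (Finset.univ.erase k)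
      (fun l hl => hZ l (Finset.ne_of_mem_erase hl)) _).trans_eq ?_
    congr 1
    rw [sum_eq_sum_joinIndex k, Finset.sum_eq_single j]
    · simp [matricize_apply]
    · intro j' _ hj'; simp [hj']
    · simp
  have hP : 0 ≤ ∏ l ∈ Finset.univ.erase k, ν l := Finset.prod_nonneg fun l _ => hν l
  have h2 : ‖restrictTo s Z‖ ^ 2
      = ∑ j, ∑ c ∈ Finset.univ.filter fun c => joinIndex k j c ∈ s, Z (joinIndex k j c) ^ 2 := by
    rw [norm_sq_restrictTo, ← Finset.univ_inter s, ← Finset.sum_ite_mem, sum_eq_sum_joinIndex k]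
    simp only [Finset.sum_filter, Finset.univ_inter]
  rw [h2, norm_sq_eq_sum_matricize k, Finset.mul_sum]
  refine Finset.sum_le_sum fun j _ => ?_
  refine (Finset.sum_le_sum fun c _ => h1 j c).trans ?_
  rw [Finset.sum_const, nsmul_eq_mul]
  have h0 : 0 ≤ ∑ c, matricize k Z j c ^ 2 := Finset.sum_nonneg fun _ _ => sq_nonneg _
  calc _ ≤ a * ((∏ l ∈ Finset.univ.erase k, ν l) * ∑ c, matricize k Z j c ^ 2) :=
        mul_le_mul_of_nonneg_right (hs j) (mul_nonneg hP h0)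
    _ = _ := by ring

theorem norm_sq_modeProd_add_norm_sq_modeProd (k : Fin m) (Z : Tensor d)
    {P : Matrix (Fin (d k)) (Fin (d k)) ℝ} (hP : P.transpose = P) (hPP : P * P = P) :
    ‖modeProd k Z P‖ ^ 2 + ‖modeProd k Z (1 - P)‖ ^ 2 = ‖Z‖ ^ 2 := by
  have h : inner ℝ (modeProd k Z P) (modeProd k Z (1 - P)) = 0 := by
    rw [inner_modeProd, hP, ← modeProd_mul, mul_sub, mul_one, hPP, sub_self]
    have : modeProd k Z (0 : Matrix (Fin (d k)) (Fin (d k)) ℝ) = 0 := (matProdLin k Z).map_zero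
    rw [this, inner_zero_right]
  have e : modeProd k Z P + modeProd k Z (1 - P) = Z := by
    rw [← modeProd_mat_add, add_sub_cancel, modeProd_one]
  nth_rw 3 [← e]
  rw [@norm_add_sq_real, h]; ring

/-- Splitting off the `1 - P k` part mode by mode leaves `m + 1` mutually orthogonal pieces: one is
fixed by all `P k`, each other one is spread in all modes except one. Each piece loses a factor `β`
on `s`, and Cauchy–Schwarz over the pieces gives `√(m + 1)`. -/
theorem norm_restrictTo_le {ν : Fin m → ℝ} (hν : ∀ l, 0 ≤ ν l) {β : ℝ} (hβ : 0 ≤ β)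
    (hm : 1 ≤ m) (s : Finset ((k : Fin m) → Fin (d k)))
    (hs : ∀ k j, (∏ l ∈ Finset.univ.erase k, ν l) *
      ((Finset.univ.filter fun c => joinIndex k j c ∈ s).card : ℝ) ≤ β ^ 2)
    (P : (k : Fin m) → Matrix (Fin (d k)) (Fin (d k)) ℝ) (hPT : ∀ k, (P k).transpose = P k)
    (hPP : ∀ k, P k * P k = P k) (hPν : ∀ k j, ∑ a, P k j a ^ 2 ≤ ν k)
    (Z : Tensor d)
    (hZ : ∀ k l, l ≠ k → IsSpreadIn (ν l) l (modeProd k Z (1 - P k))) :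
    ‖restrictTo s Z‖ ≤ β * Real.sqrt (m + 1) * ‖Z‖ := by
  have hone (k : Fin m) (Y : Tensor d) (hY : ∀ l, l ≠ k → IsSpreadIn (ν l) l Y) :
      ‖restrictTo s Y‖ ≤ β * ‖Y‖ := by
    have h0 : 0 ≤ ∏ l ∈ Finset.univ.erase k, ν l := Finset.prod_nonneg fun l _ => hν l
    refine abs_le_of_sq_le_sq' ?_ (by positivity) |>.2
    rw [mul_pow]
    rcases h0.eq_or_lt with h0 | h0
    · have := norm_sq_restrictTo_le hν k hY s (a := Fintype.card (CoIndex d k))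
        (fun j => by exact_mod_cast Finset.card_le_univ _)
      rw [← h0, zero_mul, zero_mul] at this
      exact this.trans (by positivity)
    · have := norm_sq_restrictTo_le hν k hY s (a := β ^ 2 / ∏ l ∈ Finset.univ.erase k, ν l)
        (fun j => by rw [le_div_iff₀ h0, mul_comm]; exact hs k j)
      rwa [mul_div_cancel₀ _ h0.ne'] at this
  -- Here `t` is the set of modes still to be split; outside `t` the tensor is already spread.
  have key (t : Finset (Fin m)) : ∀ Y : Tensor d, (∀ l ∉ t, IsSpreadIn (ν l) l Y) →
      (∀ k ∈ t, ∀ l, l ≠ k → IsSpreadIn (ν l) l (modeProd k Y (1 - P k))) →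
      ‖restrictTo s Y‖ ≤ β * Real.sqrt (t.card + 1) * ‖Y‖ := by
    induction t using Finset.induction_on with
    | empty =>
      intro Y hY _
      simpa using hone ⟨0, hm⟩ Y fun l _ => hY l (by simp)
    | insert a t ha ih =>
      intro Y hY hY'
      have e : modeProd a Y (P a) + modeProd a Y (1 - P a) = Y := by
        rw [← modeProd_mat_add, add_sub_cancel, modeProd_one]
      have hPa : IsSpreadIn (ν a) a (modeProd a Y (P a)) :=
        ⟨P a, hPν a, by rw [← modeProd_mul, hPP]⟩
      have h1 := ih (modeProd a Y (P a)) (fun l hl => by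
        by_cases hla : l = a
        · subst hla; exact hPa
        · exact (hY l (by simp [hla, hl])).modeProd_of_ne hla _) (fun k hk l hl => by
        have hka : k ≠ a := fun h => ha (h ▸ hk)
        by_cases hla : l = a
        · subst hla; exact hPa.modeProd_of_ne hl _
        · rw [modeProd_comm hka]
          exact (hY' k (Finset.mem_insert_of_mem hk) l hl).modeProd_of_ne hla _)
      have h2 := hone a (modeProd a Y (1 - P a)) (hY' a (Finset.mem_insert_self _ _))
      have h3 := norm_sq_modeProd_add_norm_sq_modeProd a Y (hPT a) (hPP a)
      have h4 : ‖restrictTo s Y‖ ≤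
          ‖restrictTo s (modeProd a Y (P a))‖ + ‖restrictTo s (modeProd a Y (1 - P a))‖ := by
        nth_rw 1 [← e]
        rw [restrictTo_add]; exact norm_add_le _ _
      rw [Finset.card_insert_of_notMem ha, Nat.cast_add, Nat.cast_one]
      set x := ‖modeProd a Y (P a)‖
      set y := ‖modeProd a Y (1 - P a)‖
      have h5 : Real.sqrt (t.card + 1) * x + y ≤ Real.sqrt (t.card + 1 + 1) * ‖Y‖ := by
        have hx := Real.sq_sqrt (show (0 : ℝ) ≤ t.card + 1 by positivity)
        have hy := Real.sq_sqrt (show (0 : ℝ) ≤ t.card + 1 + 1 by positivity)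
        refine abs_le_of_sq_le_sq' ?_ (by positivity) |>.2
        rw [mul_pow, hy, ← h3]
        nlinarith [sq_nonneg (x - Real.sqrt (t.card + 1) * y)]
      calc _ ≤ β * (Real.sqrt (t.card + 1) * x + y) := by linarith
        _ ≤ β * (Real.sqrt (t.card + 1 + 1) * ‖Y‖) := by gcongr
        _ = _ := by ring
  simpa using key Finset.univ Z (by simp) (fun k _ => hZ k)

/-- The Cauchy–Schwarz bound for the `ℓ₁` norm of a restriction. -/
theorem sum_abs_le_norm_restrictTo (s : Finset ((k : Fin m) → Fin (d k))) (Z : Tensor d) :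
    ∑ i ∈ s, |Z i| ≤ Real.sqrt s.card * ‖restrictTo s Z‖ := by
  refine abs_le_of_sq_le_sq' ?_ (by positivity) |>.2
  rw [mul_pow, Real.sq_sqrt (by positivity), norm_sq_restrictTo]
  simpa using sq_sum_le_card_mul_sum_sq (s := s) (f := fun i => |Z i|)

end Spikiness

/-! ### Low-rank tensors as a Lipschitz image of a low-dimensional ball. -/

section LowRank

open scoped Matrix.Norms.L2Operator

variable {m : ℕ} {d : Fin m → ℕ}

theorem norm_modeProd_le_l2 (k : Fin m) (T : Tensor d) (A : Matrix (Fin (d k)) (Fin (d k)) ℝ) :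
    ‖modeProd k T A‖ ≤ ‖A‖ * ‖T‖ := by
  refine norm_modeProd_le k T A (norm_nonneg _) fun x => ?_
  have h := Matrix.l2_opNorm_mulVec A (WithLp.toLp 2 x)
  have h2 : ‖WithLp.toLp 2 (A.mulVec x)‖ ^ 2 ≤ (‖A‖ * ‖WithLp.toLp 2 x‖) ^ 2 := by
    gcongr; exact h
  simpa [mul_pow, EuclideanSpace.norm_sq_eq] using h2

/-- The tensors supported on the indices below `ρ`. -/
def coreSpace (d ρ : Fin m → ℕ) : Submodule ℝ (Tensor d) where
  carrier := {C | ∀ i, (∃ k, ρ k ≤ i k) → C i = 0}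
  add_mem' ha hb i hi := by simp [ha i hi, hb i hi]
  zero_mem' i _ := rfl
  smul_mem' c x hx i hi := by simp [hx i hi]

/-- The square matrices in which only the first `ρ` columns are non-zero. -/
def factorSpace (n ρ : ℕ) : Submodule ℝ (Matrix (Fin n) (Fin n) ℝ) where
  carrier := {A | ∀ i j : Fin n, ρ ≤ (j : ℕ) → A i j = 0}
  add_mem' ha hb i j hj := by simp [ha i j hj, hb i j hj]
  zero_mem' i _ _ := rfl
  smul_mem' c x hx i j hj := by simp [hx i j hj]

/-- Only an inequality, since `ρ k` may exceed `d k`. Cores and factors keep their full size and are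
padded by zeros, so that mode products with square matrices suffice. -/
theorem finrank_coreSpace_le (d ρ : Fin m → ℕ) :
    Module.finrank ℝ (coreSpace d ρ) ≤ ∏ k, ρ k := by
  let f : coreSpace d ρ →ₗ[ℝ] (((k : Fin m) → Fin (ρ k)) → ℝ) :=
    { toFun := fun C a => if h : ∀ k, (a k : ℕ) < d k then C.1 fun k => ⟨a k, h k⟩ else 0
      map_add' := fun C D => by ext a; simp only [Pi.add_apply]; split_ifs <;> simp
      map_smul' := fun c D => by ext a; simp only [Pi.smul_apply]; split_ifs <;> simp }
  have hf : Function.Injective f := by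
    rw [injective_iff_map_eq_zero]
    intro C hC
    ext i
    by_cases hi : ∃ k, ρ k ≤ i k
    · exact C.2 i hi
    · push Not at hi
      have h := congrFun hC fun k => ⟨i k, hi k⟩
      simpa [f] using h
  simpa using LinearMap.finrank_le_finrank_of_injective hf

theorem finrank_factorSpace_le (n ρ : ℕ) :
    Module.finrank ℝ (factorSpace n ρ) ≤ n * ρ := by
  let f : factorSpace n ρ →ₗ[ℝ] (Fin n × Fin ρ → ℝ) :=
    { toFun := fun A a => if h : (a.2 : ℕ) < n then A.1 a.1 ⟨a.2, h⟩ else 0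
      map_add' := fun C D => by ext a; simp only [Pi.add_apply]; split_ifs <;> simp
      map_smul' := fun c D => by ext a; simp only [Pi.smul_apply]; split_ifs <;> simp }
  have hf : Function.Injective f := by
    rw [injective_iff_map_eq_zero]
    intro A hA
    ext i j
    by_cases hj : ρ ≤ (j : ℕ)
    · exact A.2 i j hj
    · push Not at hj
      have h := congrFun hA (i, ⟨j, hj⟩)
      simpa [f] using h
  simpa using LinearMap.finrank_le_finrank_of_injective hf

/-- The space of the parameters (core and factors) of the tensors of Tucker rank at most `ρ`. -/
abbrev TuckerParam (d ρ : Fin m → ℕ) : Type :=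
  coreSpace d ρ × ((k : Fin m) → factorSpace (d k) (ρ k))

theorem finrank_tuckerParam_le (d ρ : Fin m → ℕ) :
    Module.finrank ℝ (TuckerParam d ρ) ≤ (∏ k, ρ k) + ∑ k, d k * ρ k := by
  rw [Module.finrank_prod, Module.finrank_pi_fintype]
  exact add_le_add (finrank_coreSpace_le d ρ)
    (Finset.sum_le_sum fun k _ => finrank_factorSpace_le _ _)

/-- Successive mode products along a list of modes. -/
noncomputable def modeProds (A : (k : Fin m) → Matrix (Fin (d k)) (Fin (d k)) ℝ) (l : List (Fin m))
    (C : Tensor d) : Tensor d :=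
  l.foldr (fun k T => modeProd k T (A k)) C

theorem modeProds_cons (A : (k : Fin m) → Matrix (Fin (d k)) (Fin (d k)) ℝ) (a : Fin m)
    (l : List (Fin m)) (C : Tensor d) :
    modeProds A (a :: l) C = modeProd a (modeProds A l C) (A a) := rfl

theorem modeProds_zero (A : (k : Fin m) → Matrix (Fin (d k)) (Fin (d k)) ℝ) (l : List (Fin m)) :
    modeProds A l 0 = 0 := by
  induction l with
  | nil => rfl
  | cons a l ih => rw [modeProds_cons, ih, modeProd_zero]

theorem norm_modeProds_le {A : (k : Fin m) → Matrix (Fin (d k)) (Fin (d k)) ℝ}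
    (hA : ∀ k, ‖A k‖ ≤ 2) (l : List (Fin m)) (C : Tensor d) :
    ‖modeProds A l C‖ ≤ 2 ^ l.length * ‖C‖ := by
  induction l with
  | nil => simp [modeProds]
  | cons a l ih =>
    rw [modeProds_cons, List.length_cons, pow_succ']
    calc _ ≤ ‖A a‖ * ‖modeProds A l C‖ := norm_modeProd_le_l2 _ _ _
      _ ≤ 2 * (2 ^ l.length * ‖C‖) := by gcongr; exact hA a
      _ = _ := by ring

/-- Telescoping, one mode at a time: the map is multilinear, with all factors of norm at most two.
-/
theorem norm_modeProds_sub_le {A B : (k : Fin m) → Matrix (Fin (d k)) (Fin (d k)) ℝ}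
    (hA : ∀ k, ‖A k‖ ≤ 2) (hB : ∀ k, ‖B k‖ ≤ 2) {δ : ℝ} (hAB : ∀ k, ‖A k - B k‖ ≤ δ)
    {C D : Tensor d} (hC : ‖C‖ ≤ 2) (hCD : ‖C - D‖ ≤ δ) (l : List (Fin m)) :
    ‖modeProds A l C - modeProds B l D‖ ≤ 2 ^ l.length * (l.length + 1) * δ := by
  have hδ : 0 ≤ δ := (norm_nonneg _).trans hCD
  induction l with
  | nil => simpa [modeProds] using hCD
  | cons a l ih =>
    have e : modeProds A (a :: l) C - modeProds B (a :: l) D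
        = modeProd a (modeProds A l C) (A a - B a)
          + modeProd a (modeProds A l C - modeProds B l D) (B a) := by
      rw [modeProds_cons, modeProds_cons, modeProd_mat_sub, modeProd_sub]; abel
    have h1 : ‖modeProd a (modeProds A l C) (A a - B a)‖ ≤ δ * (2 ^ l.length * 2) := by
      refine (norm_modeProd_le_l2 _ _ _).trans ?_
      gcongr
      · exact hAB a
      · exact (norm_modeProds_le hA l C).trans (by gcongr)
    have h2 : ‖modeProd a (modeProds A l C - modeProds B l D) (B a)‖
        ≤ 2 * (2 ^ l.length * (l.length + 1) * δ) := by
      refine (norm_modeProd_le_l2 _ _ _).trans ?_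
      gcongr
      exact hB a
    rw [e]
    refine (norm_add_le _ _).trans ((add_le_add h1 h2).trans_eq ?_)
    rw [List.length_cons]; push_cast; ring

/-- The tensor with given core and factors. -/
noncomputable def tuckerOf {ρ : Fin m → ℕ} (e : TuckerParam d ρ) : Tensor d :=
  modeProds (fun k => (e.2 k : Matrix (Fin (d k)) (Fin (d k)) ℝ)) (List.finRange m) e.1

theorem tuckerOf_zero {ρ : Fin m → ℕ} : tuckerOf (0 : TuckerParam d ρ) = 0 :=
  modeProds_zero _ _

theorem norm_tuckerOf_sub_le {ρ : Fin m → ℕ} {e f : TuckerParam d ρ} (he : ‖e‖ ≤ 2)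
    (hf : ‖f‖ ≤ 2) : ‖tuckerOf e - tuckerOf f‖ ≤ 2 ^ m * (m + 1) * ‖e - f‖ := by
  have h := norm_modeProds_sub_le (d := d) (δ := ‖e - f‖) (C := e.1) (D := f.1)
    (A := fun k => (e.2 k : Matrix (Fin (d k)) (Fin (d k)) ℝ))
    (B := fun k => (f.2 k : Matrix (Fin (d k)) (Fin (d k)) ℝ))
    (fun k => ((norm_le_pi_norm e.2 k).trans (norm_snd_le e)).trans he)
    (fun k => ((norm_le_pi_norm f.2 k).trans (norm_snd_le f)).trans hf)
    (fun k => (norm_le_pi_norm (e - f).2 k).trans (norm_snd_le (e - f)))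
    ((norm_fst_le e).trans he) (norm_fst_le (e - f)) (List.finRange m)
  simpa [tuckerOf] using h

/-- The columns of `O` extend an orthonormal basis of the mode space to the whole space, basis
first; the later columns are orthogonal to the range of the projection. -/
theorem exists_orthogonal_adapted (T : Tensor d) (k : Fin m) {ρ : ℕ}
    (hρ : (matricize k T).rank ≤ ρ) :
    ∃ O : Matrix (Fin (d k)) (Fin (d k)) ℝ, O.transpose * O = 1 ∧ O * O.transpose = 1 ∧
      ∀ i j : Fin (d k), ρ ≤ (i : ℕ) → (O.transpose * factorProj T k) i j = 0 := by
  set n := Module.finrank ℝ (modeSpace T k) with hn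
  have hnρ : n ≤ ρ := by rw [hn, finrank_modeSpace]; exact hρ
  set u := stdOrthonormalBasis ℝ (modeSpace T k) with hu
  let v : Fin (d k) → EuclideanSpace ℝ (Fin (d k)) := fun i => if h : (i : ℕ) < n then u ⟨i, h⟩ else 0
  let s : Set (Fin (d k)) := {i | (i : ℕ) < n}
  have hv : Orthonormal ℝ (s.domRestrict v) := by
    have e : s.domRestrict v = fun i : s => (u ⟨i.1, i.2⟩ : EuclideanSpace ℝ (Fin (d k))) := by
      funext i
      exact dif_pos i.2
    rw [e]
    have h1 : Orthonormal ℝ fun a => (u a : EuclideanSpace ℝ (Fin (d k))) :=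
      u.orthonormal.comp_linearIsometry (modeSpace T k).subtypeₗᵢ
    exact h1.comp (fun i : s => (⟨i.1, i.2⟩ : Fin n)) fun i j h => by
      have := congrArg Fin.val h
      exact Subtype.ext (Fin.ext this)
  obtain ⟨b, hb⟩ := hv.exists_orthonormalBasis_extension_of_card_eq (by simp)
  have hnd : n ≤ d k := by
    have := (modeSpace T k).finrank_le
    simpa using this
  let O : Matrix (Fin (d k)) (Fin (d k)) ℝ := Matrix.of fun i j => b j i
  have hO : O.transpose * O = 1 := by
    ext i j
    have h := orthonormal_iff_ite.1 b.orthonormal i j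
    rw [PiLp.inner_apply] at h
    simpa [Matrix.mul_apply, O, Matrix.one_apply, mul_comm] using h
  refine ⟨O, hO, mul_eq_one_comm.1 hO, fun i j hi => ?_⟩
  rw [factorProj, ← Matrix.mul_assoc, Matrix.mul_apply]
  refine Finset.sum_eq_zero fun a _ => ?_
  have h : (O.transpose * tuckerFactor T k) i a = 0 := by
    have ha : (a : ℕ) < d k := a.2.trans_le hnd
    have hba : b ⟨a, ha⟩ = u a := by
      rw [hb ⟨a, ha⟩ (show (a : ℕ) < n from a.2)]
      exact dif_pos a.2
    have hne : i ≠ ⟨a, ha⟩ := by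
      rintro rfl
      have := a.2
      simp only at hi
      omega
    have h : inner ℝ (b i) (b ⟨a, ha⟩) = 0 := b.orthonormal.2 hne
    rw [hba, PiLp.inner_apply] at h
    simpa [Matrix.mul_apply, O, tuckerFactor, mul_comm] using h
  rw [h, zero_mul]

/-- The diagonal projection onto the first `ρ` coordinates. -/
def headProj (n ρ : ℕ) : Matrix (Fin n) (Fin n) ℝ :=
  Matrix.diagonal fun i => if (i : ℕ) < ρ then 1 else 0

theorem norm_headProj_le (n ρ : ℕ) : ‖headProj n ρ‖ ≤ 1 := by
  rw [headProj, Matrix.l2_opNorm_diagonal]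
  refine (pi_norm_le_iff_of_nonneg zero_le_one).2 fun i => ?_
  split_ifs <;> simp

theorem norm_le_one_of_transpose_mul_self {n : ℕ} {O : Matrix (Fin n) (Fin n) ℝ}
    (h : O.transpose * O = 1) : ‖O‖ ≤ 1 := by
  have h1 := Matrix.l2_opNorm_conjTranspose_mul_self O
  rw [Matrix.conjTranspose_eq_transpose_of_trivial, h] at h1
  have h2 : ‖(1 : Matrix (Fin n) (Fin n) ℝ)‖ ≤ 1 := by
    rw [← Matrix.diagonal_one, Matrix.l2_opNorm_diagonal]
    exact (pi_norm_le_iff_of_nonneg zero_le_one).2 fun i => by simp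
  nlinarith [norm_nonneg O]

/-- The core is `Z` rotated by `(O k)ᵀ` in each mode, so its norm does not grow, and since `Q k`
fixes `Z` it lives on the first `ρ k` coordinates. The clause on modes outside `l` is needed for the
induction: it carries support properties through products in other modes. -/
theorem exists_modeProds_eq {ρ : Fin m → ℕ} {O Q : (k : Fin m) → Matrix (Fin (d k)) (Fin (d k)) ℝ}
    (hO' : ∀ k, O k * (O k).transpose = 1)
    (hQ : ∀ k (i j : Fin (d k)), ρ k ≤ (i : ℕ) → ((O k).transpose * Q k) i j = 0) {l : List (Fin m)}
    (hl : l.Nodup) : ∀ Z : Tensor d, (∀ k ∈ l, modeProd k Z (Q k) = Z) →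
    ∃ C : Tensor d, ‖C‖ ≤ ‖Z‖ ∧ (∀ k ∈ l, modeProd k C (headProj (d k) (ρ k)) = C) ∧
      (∀ k ∉ l, ∀ B, modeProd k Z B = Z → modeProd k C B = C) ∧
      modeProds (fun k => O k * headProj (d k) (ρ k)) l C = Z := by
  induction l with
  | nil => exact fun Z _ => ⟨Z, le_rfl, by simp, fun _ _ _ h => h, rfl⟩
  | cons a l ih =>
    intro Z hZ
    rw [List.nodup_cons] at hl
    obtain ⟨C, h1, h2, h3, h4⟩ := ih hl.2 (modeProd a Z (O a).transpose) fun k hk => by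
      rw [modeProd_comm fun h : k = a => hl.1 (h ▸ hk), hZ k (List.mem_cons_of_mem _ hk)]
    have hJ : headProj (d a) (ρ a) * ((O a).transpose * Q a) = (O a).transpose * Q a := by
      ext i j
      rw [headProj, Matrix.diagonal_mul]
      split_ifs with hi
      · rw [one_mul]
      · rw [zero_mul, hQ a i j (not_lt.1 hi)]
    have hJZ : modeProd a (modeProd a Z (O a).transpose) (headProj (d a) (ρ a))
        = modeProd a Z (O a).transpose := by
      nth_rw 1 [← hZ a List.mem_cons_self]
      rw [← modeProd_mul, ← modeProd_mul, mul_assoc, hJ, modeProd_mul, hZ a List.mem_cons_self]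
    refine ⟨C, h1.trans ?_, ?_, ?_, ?_⟩
    · refine (norm_modeProd_le_l2 _ _ _).trans ?_
      have : ‖(O a).transpose‖ ≤ 1 :=
        norm_le_one_of_transpose_mul_self (by rw [Matrix.transpose_transpose, hO'])
      exact mul_le_of_le_one_left (norm_nonneg _) this
    · intro k hk
      rcases List.mem_cons.1 hk with rfl | hk
      · exact h3 _ hl.1 _ hJZ
      · exact h2 k hk
    · intro k hk B hB
      rw [List.mem_cons, not_or] at hk
      exact h3 k hk.2 B (by rw [modeProd_comm hk.1, hB])
    · rw [modeProds_cons, h4, modeProd_mul, hJZ, ← modeProd_mul, hO', modeProd_one]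

/-- The parameter space has the maximum of the Frobenius norm of the core and the spectral norms of
the factors. Orthonormal factors have spectral norm at most one, so the unit ball of parameters
reaches the whole unit ball of low-rank tensors. -/
theorem exists_tuckerOf_eq {ρ : Fin m → ℕ} (Z : Tensor d) (hZ : ∀ k, (matricize k Z).rank ≤ ρ k)
    (hZ1 : ‖Z‖ ≤ 1) : ∃ e : TuckerParam d ρ, ‖e‖ ≤ 1 ∧ tuckerOf e = Z := by
  choose O hO hO' hQ using fun k => exists_orthogonal_adapted Z k (hZ k)
  obtain ⟨C, h1, h2, -, h4⟩ := exists_modeProds_eq hO' hQ (List.nodup_finRange m) Z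
    fun k _ => modeProd_factorProj Z k
  have hC : C ∈ coreSpace d ρ := by
    rintro i ⟨k, hk⟩
    rw [← h2 k (List.mem_finRange k), modeProd_apply]
    refine Finset.sum_eq_zero fun j _ => ?_
    rw [headProj, Matrix.diagonal_apply]
    split_ifs with h h'
    · subst h; omega
    · simp
    · simp
  have hU (k : Fin m) : O k * headProj (d k) (ρ k) ∈ factorSpace (d k) (ρ k) := by
    intro i j hj
    rw [headProj, Matrix.mul_diagonal, if_neg (not_lt.2 hj), mul_zero]
  have hn (k : Fin m) : ‖O k * headProj (d k) (ρ k)‖ ≤ 1 :=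
    (Matrix.l2_opNorm_mul _ _).trans (mul_le_one₀ (norm_le_one_of_transpose_mul_self (hO k))
      (norm_nonneg _) (norm_headProj_le _ _))
  let c : coreSpace d ρ := ⟨C, hC⟩
  let u : (k : Fin m) → factorSpace (d k) (ρ k) := fun k => ⟨_, hU k⟩
  have hc : ‖c‖ ≤ 1 := h1.trans hZ1
  have hu : ‖u‖ ≤ 1 := (pi_norm_le_iff_of_nonneg zero_le_one).2 hn
  exact ⟨(c, u), norm_prod_le_iff.2 ⟨hc, hu⟩, h4⟩

end LowRank

/-! ### Nets and chaining in finite-dimensional normed spaces. -/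

section Chaining

open Filter Topology

/-- A maximal `1/2`-separated subset of the unit ball is a net; doubling it gives a `1`-separated
set in the ball of radius two, whose cardinality is at most `5 ^ dim`. -/
theorem exists_half_net (E : Type*) [NormedAddCommGroup E] [NormedSpace ℝ E]
    [FiniteDimensional ℝ E] :
    ∃ N : Finset E, N.card ≤ 5 ^ Module.finrank ℝ E ∧ (∀ v ∈ N, ‖v‖ ≤ 1) ∧
      ∀ x : E, ‖x‖ ≤ 1 → ∃ v ∈ N, ‖x - v‖ ≤ 1 / 2 := by
  classical
  let Sep (s : Finset E) : Prop :=
    (∀ c ∈ s, ‖c‖ ≤ 1) ∧ ∀ c ∈ s, ∀ e ∈ s, c ≠ e → 1 / 2 ≤ ‖c - e‖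
  have hcard (s : Finset E) (hs : Sep s) : s.card ≤ 5 ^ Module.finrank ℝ E := by
    have hinj : Function.Injective fun x : E => (2 : ℝ) • x := smul_right_injective E two_ne_zero
    rw [← Finset.card_image_of_injective s hinj]
    refine Besicovitch.card_le_of_separated _ ?_ ?_
    · intro c hc
      obtain ⟨x, hx, rfl⟩ := Finset.mem_image.1 hc
      rw [norm_smul, Real.norm_ofNat]
      linarith [hs.1 x hx]
    · intro c hc e he hce
      obtain ⟨x, hx, rfl⟩ := Finset.mem_image.1 hc
      obtain ⟨y, hy, rfl⟩ := Finset.mem_image.1 he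
      have := hs.2 x hx y hy fun h => hce (h ▸ rfl)
      rw [← smul_sub, norm_smul, Real.norm_ofNat]
      linarith
  let A : Set ℕ := {n | ∃ s : Finset E, Sep s ∧ s.card = n}
  have hA : BddAbove A := ⟨_, by rintro _ ⟨s, hs, rfl⟩; exact hcard s hs⟩
  obtain ⟨s, hs, hsc⟩ := Nat.sSup_mem (s := A) ⟨0, ∅, ⟨by simp, by simp⟩, rfl⟩ hA
  refine ⟨s, hcard s hs, hs.1, fun x hx => ?_⟩
  by_contra! h
  have hxs : x ∉ s := fun hxs => by have := h x hxs; simp at this; linarith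
  have hins : Sep (insert x s) := by
    refine ⟨fun c hc => ?_, fun c hc e he hce => ?_⟩
    · rcases Finset.mem_insert.1 hc with rfl | hc
      · exact hx
      · exact hs.1 c hc
    · rw [Finset.mem_insert] at hc he
      rcases hc with rfl | hc <;> rcases he with rfl | he
      · exact absurd rfl hce
      · exact (h e he).le
      · rw [norm_sub_rev]; exact (h c hc).le
      · exact hs.2 c hc e he hce
  have := le_csSup hA ⟨_, hins, rfl⟩
  rw [Finset.card_insert_of_notMem hxs] at this
  omega

/-- Partial sums of dyadic expansions with digits in `N`. -/
noncomputable def dyadicSums {E : Type*} [NormedAddCommGroup E] [NormedSpace ℝ E] [DecidableEq E]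
    (N : Finset E) : ℕ → Finset E
  | 0 => {0}
  | j + 1 => Finset.image₂ (fun u v => u + ((1 / 2 : ℝ) ^ j) • v) (dyadicSums N j) N

theorem card_dyadicSums_le {E : Type*} [NormedAddCommGroup E] [NormedSpace ℝ E] [DecidableEq E]
    (N : Finset E) (j : ℕ) : (dyadicSums N j).card ≤ N.card ^ j := by
  induction j with
  | zero => simp [dyadicSums]
  | succ j ih =>
    rw [pow_succ]
    exact (Finset.card_image₂_le _ _ _).trans (Nat.mul_le_mul_right _ ih)

theorem norm_le_of_mem_dyadicSums {E : Type*} [NormedAddCommGroup E] [NormedSpace ℝ E]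
    [DecidableEq E] {N : Finset E} (hN : ∀ v ∈ N, ‖v‖ ≤ 1) (j : ℕ) :
    ∀ u ∈ dyadicSums N j, ‖u‖ ≤ 2 := by
  have h : ∀ u ∈ dyadicSums N j, ‖u‖ ≤ 2 - 2 * (1 / 2) ^ j := by
    induction j with
    | zero => simp [dyadicSums]
    | succ j ih =>
      intro u hu
      obtain ⟨w, hw, v, hv, rfl⟩ := Finset.mem_image₂.1 hu
      have h1 := ih w hw
      have h2 : ‖((1 / 2 : ℝ) ^ j) • v‖ ≤ (1 / 2) ^ j := by
        rw [norm_smul, norm_pow, Real.norm_of_nonneg (by norm_num)]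
        exact mul_le_of_le_one_right (by positivity) (hN v hv)
      have h3 := norm_add_le w (((1 / 2 : ℝ) ^ j) • v)
      rw [pow_succ]; linarith
  intro u hu
  have := h u hu
  have : (0 : ℝ) ≤ (1 / 2) ^ j := by positivity
  linarith

/-- With `x = j + 1`, the entropy costs at most `exp (2 D x)` and the tail gains `exp (-8 D x)`; the
surplus `6 D x ≥ 2 D + 4 x` is divided between the overall probability and the geometric decay in
`j`. -/
theorem chaining_term_le (D x : ℝ) (n j : ℕ) (hx : x = j + 1) (hn : (n : ℝ) ≤ D) (hD : 1 ≤ D) :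
    ((5 ^ n) ^ (j + 1) : ℝ) * (2 * Real.exp (-(4 * x * Real.sqrt D) ^ 2 / 2))
      ≤ Real.exp (-2 * D) * (1 / 2) ^ (j + 1) := by
  have hx1 : 1 ≤ x := by rw [hx]; linarith [(Nat.cast_nonneg j : (0 : ℝ) ≤ j)]
  have h5 : (5 : ℝ) ≤ Real.exp 2 := by
    have := Real.exp_one_gt_d9
    rw [show (2 : ℝ) = 1 + 1 by norm_num, Real.exp_add]; nlinarith
  have h4 : Real.exp (-4) ≤ 1 / 4 := by
    rw [Real.exp_neg, ← one_div]
    exact one_div_le_one_div_of_le (by norm_num) (by linarith [Real.add_one_le_exp (4 : ℝ)])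
  have e1 : ((5 ^ n) ^ (j + 1) : ℝ) ≤ Real.exp (2 * (D * x)) := by
    calc ((5 ^ n) ^ (j + 1) : ℝ) = 5 ^ (n * (j + 1)) := by rw [pow_mul]
      _ ≤ Real.exp 2 ^ (n * (j + 1)) := by gcongr
      _ = Real.exp (2 * (n * x)) := by rw [← Real.exp_nat_mul, hx]; push_cast; ring_nf
      _ ≤ _ := by gcongr
  have e2 : Real.exp (-(4 * x * Real.sqrt D) ^ 2 / 2) ≤ Real.exp (-8 * (D * x)) := by
    rw [Real.exp_le_exp, mul_pow, Real.sq_sqrt (by linarith)]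
    nlinarith [mul_nonneg (mul_nonneg (sub_nonneg.2 hx1) (by linarith : (0:ℝ) ≤ x))
      (by linarith : (0:ℝ) ≤ D)]
  have e3 : 2 * Real.exp (-4 * x) ≤ (1 / 2) ^ (j + 1) := by
    have : Real.exp (-4 * x) = Real.exp (-4) ^ (j + 1) := by
      rw [← Real.exp_nat_mul, hx]; push_cast; ring_nf
    rw [this]
    calc 2 * Real.exp (-4) ^ (j + 1) ≤ 2 * (1 / 4) ^ (j + 1) := by gcongr
      _ = (2 * (1 / 2) ^ (j + 1)) * (1 / 2) ^ (j + 1) := by rw [mul_assoc, ← mul_pow]; norm_num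
      _ ≤ 1 * (1 / 2) ^ (j + 1) := by
        gcongr
        rw [pow_succ]
        have : ((1 : ℝ) / 2) ^ j ≤ 1 := pow_le_one₀ (by norm_num) (by norm_num)
        linarith
      _ = _ := one_mul _
  calc _ ≤ Real.exp (2 * (D * x)) * (2 * Real.exp (-8 * (D * x))) := by gcongr
    _ = 2 * Real.exp (-6 * (D * x)) := by
      rw [mul_left_comm, ← Real.exp_add]; ring_nf
    _ ≤ 2 * Real.exp (-2 * D + -4 * x) := by
      gcongr
      nlinarith [mul_nonneg (sub_nonneg.2 hx1) (by linarith : (0:ℝ) ≤ D),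
        mul_nonneg (sub_nonneg.2 hD) (by linarith : (0:ℝ) ≤ x)]
    _ = Real.exp (-2 * D) * (2 * Real.exp (-4 * x)) := by rw [Real.exp_add]; ring
    _ ≤ _ := by gcongr

/-- **Chaining**: a process with sub-Gaussian increments on a normed space of dimension at most `D`
is of order `√D` on the unit ball. -/
theorem exists_exceptional_set_of_subgaussian_increments {E : Type*} [NormedAddCommGroup E]
    [NormedSpace ℝ E] [FiniteDimensional ℝ E] {Ω : Type*} [MeasurableSpace Ω] (P : Measure Ω)
    [IsFiniteMeasure P] (W : E → Ω → ℝ) {D : ℕ} (hD : 1 ≤ D) (hED : Module.finrank ℝ E ≤ D)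
    (hW0 : ∀ ω, W 0 ω = 0) (hWc : ∀ ω, ContinuousOn (fun e => W e ω) (Metric.closedBall 0 2))
    (hW : ∀ u v : E, ‖u‖ ≤ 2 → ‖v‖ ≤ 2 → ∀ t : ℝ, 0 ≤ t →
      P.real {ω | t * ‖u - v‖ < |W u ω - W v ω|} ≤ 2 * Real.exp (-t ^ 2 / 2)) :
    ∃ B : Set Ω, MeasurableSet B ∧ P.real B ≤ Real.exp (-2 * D) ∧
      ∀ ω ∉ B, ∀ e : E, ‖e‖ ≤ 1 → |W e ω| ≤ 16 * Real.sqrt D := by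
  classical
  obtain ⟨N, hNc, hN1, hN⟩ := exists_half_net E
  -- The linear growth in `j` beats the number of links, while the links have length at most `(1/2)
  -- ^ j` and `∑ (j + 1) / 2 ^ j = 4`, whence the final constant `16`.
  let t (j : ℕ) : ℝ := 4 * (j + 1) * Real.sqrt D
  let next (j : ℕ) (u v : E) : E := u + ((1 / 2 : ℝ) ^ j) • v
  let bad (j : ℕ) : Set Ω := ⋃ p ∈ dyadicSums N j ×ˢ N,
    {ω | t j * ‖next j p.1 p.2 - p.1‖ < |W (next j p.1 p.2) ω - W p.1 ω|}
  have hmem (j : ℕ) {u v : E} (hu : u ∈ dyadicSums N j) (hv : v ∈ N) :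
      next j u v ∈ dyadicSums N (j + 1) := Finset.mem_image₂_of_mem hu hv
  have hbad (j : ℕ) : P.real (bad j) ≤ Real.exp (-2 * D) * (1 / 2) ^ (j + 1) := by
    refine (measureReal_biUnion_finset_le _ _).trans ?_
    have h1 : ∀ p ∈ dyadicSums N j ×ˢ N,
        P.real {ω | t j * ‖next j p.1 p.2 - p.1‖ < |W (next j p.1 p.2) ω - W p.1 ω|}
          ≤ 2 * Real.exp (-(t j) ^ 2 / 2) := by
      intro p hp
      rw [Finset.mem_product] at hp
      exact hW _ _ (norm_le_of_mem_dyadicSums hN1 _ _ (hmem j hp.1 hp.2))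
        (norm_le_of_mem_dyadicSums hN1 _ _ hp.1) _ (by positivity)
    refine (Finset.sum_le_sum h1).trans ?_
    rw [Finset.sum_const, nsmul_eq_mul]
    refine le_trans ?_ (chaining_term_le D (j + 1) (Module.finrank ℝ E) j rfl
      (by exact_mod_cast hED) (by exact_mod_cast hD))
    gcongr
    rw [Finset.card_product]
    have h2 : (dyadicSums N j).card * N.card ≤ (5 ^ Module.finrank ℝ E) ^ (j + 1) := by
      rw [pow_succ]
      exact Nat.mul_le_mul ((card_dyadicSums_le N j).trans (Nat.pow_le_pow_left hNc j)) hNc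
    exact_mod_cast h2
  -- No measurability of `W` is assumed, so the bad event is replaced by its measurable hull.
  refine ⟨toMeasurable P (⋃ j, bad j), measurableSet_toMeasurable _ _, ?_, ?_⟩
  · rw [measureReal_def, measure_toMeasurable]
    refine ENNReal.toReal_le_of_le_ofReal (by positivity) ?_
    refine (measure_iUnion_le bad).trans ?_
    have hs : HasSum (fun j : ℕ => Real.exp (-2 * D) * (1 / 2 : ℝ) ^ (j + 1)) (Real.exp (-2 * D)) := by
      have := (hasSum_geometric_two.mul_left (1 / 2 : ℝ)).mul_left (Real.exp (-2 * D))
      simpa [pow_succ, mul_comm] using this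
    rw [← hs.tsum_eq, ENNReal.ofReal_tsum_of_nonneg (fun j => by positivity) hs.summable]
    refine ENNReal.tsum_le_tsum fun j => ?_
    rw [← ofReal_measureReal (measure_ne_top P _)]
    exact ENNReal.ofReal_le_ofReal (hbad j)
  · intro ω hω e he
    have hω' (j : ℕ) : ω ∉ bad j := fun h =>
      hω (subset_toMeasurable P _ (Set.mem_iUnion.2 ⟨j, h⟩))
    -- The bracket `4 - (2 j + 4) / 2 ^ j` is the partial sum of `(i + 1) / 2 ^ i` over `i < j`.
    have hstep (j : ℕ) : ∃ x ∈ dyadicSums N j, ‖e - x‖ ≤ (1 / 2) ^ j ∧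
        |W x ω| ≤ 4 * Real.sqrt D * (4 - (2 * j + 4) * (1 / 2) ^ j) := by
      induction j with
      | zero => exact ⟨0, by simp [dyadicSums], by simpa using he, by simp [hW0]⟩
      | succ j ih =>
        obtain ⟨x, hx, hex, hWx⟩ := ih
        obtain ⟨v, hv, hxv⟩ := hN (((2 : ℝ) ^ j) • (e - x)) (by
          rw [norm_smul, norm_pow, Real.norm_ofNat]
          calc (2 : ℝ) ^ j * ‖e - x‖ ≤ 2 ^ j * (1 / 2) ^ j := by gcongr
            _ = 1 := by rw [← mul_pow]; norm_num)
        refine ⟨next j x v, hmem j hx hv, ?_, ?_⟩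
        · have : e - next j x v = ((1 / 2 : ℝ) ^ j) • (((2 : ℝ) ^ j) • (e - x) - v) := by
            rw [smul_sub, smul_smul, ← mul_pow]; norm_num [next]; abel
          rw [this, norm_smul, norm_pow, Real.norm_of_nonneg (by norm_num), pow_succ]
          gcongr
        · have h1 : |W (next j x v) ω - W x ω| ≤ t j * ‖next j x v - x‖ := by
            by_contra! h
            exact hω' j (Set.mem_biUnion (x := (x, v)) (Finset.mem_product.2 ⟨hx, hv⟩) h)
          have h2 : ‖next j x v - x‖ ≤ (1 / 2) ^ j := by
            simp only [next, add_sub_cancel_left]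
            rw [norm_smul, norm_pow, Real.norm_of_nonneg (by norm_num)]
            exact mul_le_of_le_one_right (by positivity) (hN1 v hv)
          have h3 : t j * ‖next j x v - x‖ ≤ t j * (1 / 2) ^ j := by gcongr
          have h4 : |W (next j x v) ω| ≤ |W x ω| + |W (next j x v) ω - W x ω| := by
            have := abs_add_le (W x ω) (W (next j x v) ω - W x ω)
            rwa [add_sub_cancel] at this
          refine h4.trans ((add_le_add hWx (h1.trans h3)).trans_eq ?_)
          simp only [t]; push_cast; ring
    choose x hx hex hWx using hstep
    have hlim : Tendsto x atTop (𝓝 e) := by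
      rw [tendsto_iff_norm_sub_tendsto_zero]
      refine squeeze_zero (fun _ => norm_nonneg _) (fun j => ?_)
        (tendsto_pow_atTop_nhds_zero_of_lt_one (by norm_num) (by norm_num : (1 / 2 : ℝ) < 1))
      rw [norm_sub_rev]; exact hex j
    have hlim' : Tendsto (fun j => |W (x j) ω|) atTop (𝓝 |W e ω|) :=
      ((hWc ω e (by rw [mem_closedBall_zero_iff]; linarith)).tendsto.comp
        (tendsto_nhdsWithin_iff.2 ⟨hlim, Eventually.of_forall fun j =>
          mem_closedBall_zero_iff.2 (norm_le_of_mem_dyadicSums hN1 j _ (hx j))⟩)).abs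
    refine le_of_tendsto hlim' (Eventually.of_forall fun j => (hWx j).trans ?_)
    have : 0 ≤ (2 * (j : ℝ) + 4) * (1 / 2) ^ j := by positivity
    nlinarith [Real.sqrt_nonneg (D : ℝ)]

end Chaining

/-! ### Sub-Gaussian deviation of the absolute loss, uniformly over low-rank tensors. -/

section Deviation

variable {m : ℕ} {d : Fin m → ℕ}

/-- The change of the absolute loss `|t - x|` between `t = δ` and `t = 0`. -/
def lossDiff (δ x : ℝ) : ℝ := |δ - x| - |x|

/-- The centred total change of the absolute loss along `Z`, for the noise `X`. -/
noncomputable def lossDeviation (ν : Measure ℝ) (Z X : Tensor d) : ℝ :=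
  ∑ i, (lossDiff (Z i) (X i) - ∫ x, lossDiff (Z i) x ∂ν)

theorem continuous_lossDiff (δ : ℝ) : Continuous (lossDiff δ) := by
  unfold lossDiff; fun_prop

theorem abs_lossDiff_sub_le (δ δ' x : ℝ) : |lossDiff δ x - lossDiff δ' x| ≤ |δ - δ'| := by
  have := abs_abs_sub_abs_le_abs_sub (δ - x) (δ' - x)
  simpa [lossDiff] using this

theorem abs_lossDiff_le (δ x : ℝ) : |lossDiff δ x| ≤ |δ| := by
  simpa [lossDiff] using abs_lossDiff_sub_le δ 0 x

theorem integrable_lossDiff (ν : Measure ℝ) [IsFiniteMeasure ν] (δ : ℝ) :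
    Integrable (lossDiff δ) ν :=
  Integrable.of_bound (continuous_lossDiff δ).aestronglyMeasurable |δ|
    (Filter.Eventually.of_forall fun x => abs_lossDiff_le δ x)

theorem lossDeviation_zero (ν : Measure ℝ) (X : Tensor d) : lossDeviation ν 0 X = 0 := by
  simp [lossDeviation, lossDiff]

theorem continuous_integral_lossDiff (ν : Measure ℝ) [IsProbabilityMeasure ν] :
    Continuous fun δ => ∫ x, lossDiff δ x ∂ν := by
  refine LipschitzWith.continuous (K := 1) (LipschitzWith.of_dist_le_mul fun δ δ' => ?_)
  rw [dist_eq_norm, ← integral_sub (integrable_lossDiff ν δ) (integrable_lossDiff ν δ')]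
  have := norm_integral_le_of_norm_le_const (μ := ν) (C := |δ - δ'|)
    (f := fun x => lossDiff δ x - lossDiff δ' x)
    (Filter.Eventually.of_forall fun x => abs_lossDiff_sub_le δ δ' x)
  simpa [Real.dist_eq] using this

theorem continuous_lossDeviation (ν : Measure ℝ) [IsProbabilityMeasure ν] (X : Tensor d) :
    Continuous fun Z : Tensor d => lossDeviation ν Z X := by
  unfold lossDeviation
  refine continuous_finsetSum _ fun i _ => Continuous.sub ?_ ?_
  · unfold lossDiff; fun_prop
  · exact (continuous_integral_lossDiff ν).comp (by fun_prop)

/-- The loss is `1`-Lipschitz in its argument, so the `i`-th summand of the increment is bounded by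
`|(Y - Z) i|` for every value of the noise. Hoeffding's lemma applies without any moment of the
noise, and the variance proxies add up to `‖Y - Z‖²`. -/
theorem measure_lossDeviation_sub_le {ν : Measure ℝ} [IsProbabilityMeasure ν] {Ω : Type*}
    [MeasurableSpace Ω] (P : Measure Ω) [IsProbabilityMeasure P] {Ξ : Ω → Tensor d}
    (hm : ∀ i, Measurable fun ω => Ξ ω i) (hi : iIndepFun (fun i ω => Ξ ω i) P)
    (hν : ∀ i, P.map (fun ω => Ξ ω i) = ν) (Y Z : Tensor d) {t : ℝ} (ht : 0 ≤ t) :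
    P.real {ω | t * ‖Y - Z‖ < |lossDeviation ν Y (Ξ ω) - lossDeviation ν Z (Ξ ω)|}
      ≤ 2 * Real.exp (-t ^ 2 / 2) := by
  rcases eq_or_ne Y Z with rfl | hYZ
  · simp only [sub_self, norm_zero, mul_zero, abs_zero, lt_irrefl, Set.ofPred_false,
      measureReal_empty]
    positivity
  have hpos : 0 < ‖Y - Z‖ := norm_pos_iff.2 (sub_ne_zero.2 hYZ)
  let ψ (i : (k : Fin m) → Fin (d k)) (x : ℝ) : ℝ := lossDiff (Y i) x - lossDiff (Z i) x
  have hψ (i) : Measurable (ψ i) :=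
    ((continuous_lossDiff (Y i)).sub (continuous_lossDiff (Z i))).measurable
  let V (i : (k : Fin m) → Fin (d k)) (ω : Ω) : ℝ := ψ i (Ξ ω i) - ∫ ω', ψ i (Ξ ω' i) ∂P
  have hV : iIndepFun V P := by
    exact hi.comp (fun i x => ψ i x - ∫ ω', ψ i (Ξ ω' i) ∂P) fun i => (hψ i).sub_const _
  have hsub (i) : HasSubgaussianMGF (V i) (‖(Y - Z) i‖₊ ^ 2) P := by
    have h := hasSubgaussianMGF_of_mem_Icc (μ := P) (X := fun ω => ψ i (Ξ ω i))
      (a := -|(Y - Z) i|) (b := |(Y - Z) i|) ((hψ i).comp (hm i)).aemeasurable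
      (Filter.Eventually.of_forall fun ω => abs_le.1 (abs_lossDiff_sub_le _ _ _))
    convert h using 2
    rw [sub_neg_eq_add, ← two_mul, nnnorm_mul, Real.nnnorm_abs, Real.nnnorm_ofNat]
    rw [mul_div_cancel_left₀ _ two_ne_zero]
  have hsum (ω : Ω) : lossDeviation ν Y (Ξ ω) - lossDeviation ν Z (Ξ ω) = ∑ i, V i ω := by
    unfold lossDeviation
    rw [← Finset.sum_sub_distrib]
    refine Finset.sum_congr rfl fun i _ => ?_
    have : ∫ ω', ψ i (Ξ ω' i) ∂P = (∫ x, lossDiff (Y i) x ∂ν) - ∫ x, lossDiff (Z i) x ∂ν := by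
      rw [← integral_sub (integrable_lossDiff ν _) (integrable_lossDiff ν _), ← hν i,
        integral_map (hm i).aemeasurable (hψ i).aestronglyMeasurable]
    simp only [V, this, ψ]; ring
  have hc : ((∑ i, ‖(Y - Z) i‖₊ ^ 2 : NNReal) : ℝ) = ‖Y - Z‖ ^ 2 := by
    rw [EuclideanSpace.norm_sq_eq]; push_cast; rfl
  have hexp : -(t * ‖Y - Z‖) ^ 2 / (2 * ((∑ i, ‖(Y - Z) i‖₊ ^ 2 : NNReal) : ℝ)) = -t ^ 2 / 2 := by
    rw [hc]; field_simp
  have h1 := HasSubgaussianMGF.measure_sum_ge_le_of_iIndepFun hV (s := Finset.univ)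
    (fun i _ => hsub i) (ε := t * ‖Y - Z‖) (by positivity)
  have h2 := HasSubgaussianMGF.measure_sum_ge_le_of_iIndepFun (X := fun i => -V i)
    (hV.comp (fun _ x => -x) fun _ => measurable_neg) (s := Finset.univ)
    (fun i _ => (hsub i).neg) (ε := t * ‖Y - Z‖) (by positivity)
  rw [hexp] at h1 h2
  calc _ ≤ P.real ({ω | t * ‖Y - Z‖ ≤ ∑ i, V i ω} ∪ {ω | t * ‖Y - Z‖ ≤ ∑ i, (-V i) ω}) := by
        refine measureReal_mono fun ω hω => ?_
        rw [Set.mem_ofPred_eq, hsum] at hω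
        rcases lt_abs.1 hω with h | h
        · exact Or.inl h.le
        · right; simpa using h.le
    _ ≤ _ := (measureReal_union_le _ _).trans (by linarith)

-- Chaining runs in the parameter space, with the process divided by `s` times the Lipschitz
-- constant of `tuckerOf`.
open scoped Matrix.Norms.L2Operator in
theorem exists_exceptional_set_lossDeviation {ν : Measure ℝ} [IsProbabilityMeasure ν] {Ω : Type*}
    [MeasurableSpace Ω] (P : Measure Ω) [IsProbabilityMeasure P] {Ξ : Ω → Tensor d}
    (hm : ∀ i, Measurable fun ω => Ξ ω i) (hi : iIndepFun (fun i ω => Ξ ω i) P)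
    (hν : ∀ i, P.map (fun ω => Ξ ω i) = ν) (ρ : Fin m → ℕ) {D : ℕ} (hD : 1 ≤ D)
    (hρD : (∏ k, ρ k) + ∑ k, d k * ρ k ≤ D) {s : ℝ} (hs : 0 < s) :
    ∃ B : Set Ω, MeasurableSet B ∧ P.real B ≤ Real.exp (-2 * D) ∧
      ∀ ω ∉ B, ∀ Z : Tensor d, (∀ k, (matricize k Z).rank ≤ ρ k) → ‖Z‖ ≤ s →
        |lossDeviation ν Z (Ξ ω)| ≤ 16 * (2 ^ m * (m + 1)) * s * Real.sqrt D := by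
  set L : ℝ := 2 ^ m * (m + 1) with hL
  have hLpos : 0 < L := by positivity
  have hlip {e f : TuckerParam d ρ} (he : ‖e‖ ≤ 2) (hf : ‖f‖ ≤ 2) :
      ‖s • tuckerOf e - s • tuckerOf f‖ ≤ s * L * ‖e - f‖ := by
    rw [← smul_sub, norm_smul, Real.norm_of_nonneg hs.le, mul_assoc]
    exact mul_le_mul_of_nonneg_left (norm_tuckerOf_sub_le he hf) hs.le
  obtain ⟨B, hB, hPB, hBW⟩ := exists_exceptional_set_of_subgaussian_increments
    (E := TuckerParam d ρ) P (fun e ω => lossDeviation ν (s • tuckerOf e) (Ξ ω) / (s * L)) hD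
    ((finrank_tuckerParam_le d ρ).trans hρD)
    (fun ω => by rw [tuckerOf_zero, smul_zero, lossDeviation_zero, zero_div])
    (fun ω => by
      refine ContinuousOn.div_const ((continuous_lossDeviation ν (Ξ ω)).comp_continuousOn ?_) _
      refine LipschitzOnWith.continuousOn (K := (s * L).toNNReal)
        (LipschitzOnWith.of_dist_le_mul fun e he f hf => ?_)
      rw [dist_eq_norm, dist_eq_norm, Real.coe_toNNReal _ (by positivity)]
      exact hlip (mem_closedBall_zero_iff.1 he) (mem_closedBall_zero_iff.1 hf))
    (fun u v hu hv t ht => by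
      refine le_trans (measureReal_mono fun ω hω => ?_)
        (measure_lossDeviation_sub_le P hm hi hν (s • tuckerOf u) (s • tuckerOf v) ht)
      rw [Set.mem_ofPred_eq, ← sub_div, abs_div, abs_of_pos (mul_pos hs hLpos),
        lt_div_iff₀ (mul_pos hs hLpos)] at hω
      refine lt_of_le_of_lt ?_ hω
      calc _ ≤ t * (s * L * ‖u - v‖) := mul_le_mul_of_nonneg_left (hlip hu hv) ht
        _ = _ := by ring)
  refine ⟨B, hB, hPB, fun ω hω Z hZ hZs => ?_⟩
  obtain ⟨e, he, heZ⟩ := exists_tuckerOf_eq (ρ := ρ) (s⁻¹ • Z)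
    (fun k => (rank_matricize_smul_le k s⁻¹ Z).trans (hZ k))
    (by
      rw [norm_smul, Real.norm_of_nonneg (by positivity)]
      exact inv_mul_le_one_of_le₀ hZs hs.le)
  have h := hBW ω hω e he
  rw [heZ, smul_smul, mul_inv_cancel₀ hs.ne', one_smul, abs_div, abs_of_pos (mul_pos hs hLpos),
    div_le_iff₀ (mul_pos hs hLpos)] at h
  linarith

end Deviation

/-! ### Tail bound for sums of heavy-tailed absolute values. -/

section Moments

variable {Ω : Type*} [MeasurableSpace Ω] {P : Measure Ω} [IsProbabilityMeasure P]

theorem integrable_of_measurable_of_abs_le {f : Ω → ℝ} (hf : Measurable f) {b : ℝ}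
    (hb : ∀ ω, |f ω| ≤ b) : Integrable f P :=
  Integrable.of_bound hf.aestronglyMeasurable b (Filter.Eventually.of_forall hb)

theorem integral_add_pow_four_le {S V : Ω → ℝ} (hS : Measurable S) (hV : Measurable V) {a b : ℝ}
    (ha : ∀ ω, |S ω| ≤ a) (hb : ∀ ω, |V ω| ≤ b) (h : IndepFun S V P) (hS0 : ∫ ω, S ω ∂P = 0)
    (hV0 : ∫ ω, V ω ∂P = 0) :
    ∫ ω, (S ω + V ω) ^ 2 ∂P = ∫ ω, S ω ^ 2 ∂P + ∫ ω, V ω ^ 2 ∂P ∧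
    ∫ ω, (S ω + V ω) ^ 4 ∂P = ∫ ω, S ω ^ 4 ∂P
      + 6 * ((∫ ω, S ω ^ 2 ∂P) * ∫ ω, V ω ^ 2 ∂P) + ∫ ω, V ω ^ 4 ∂P := by
  have hi (p q : ℕ) : Integrable (fun ω => S ω ^ p * V ω ^ q) P := by
    refine integrable_of_measurable_of_abs_le (b := a ^ p * b ^ q) (by fun_prop) fun ω => ?_
    rw [abs_mul, abs_pow, abs_pow]
    have h1 := ha ω
    have h2 := hb ω
    have := (abs_nonneg _).trans h1
    gcongr
  have hind (p q : ℕ) : ∫ ω, S ω ^ p * V ω ^ q ∂P = (∫ ω, S ω ^ p ∂P) * ∫ ω, V ω ^ q ∂P :=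
    (h.comp (φ := fun x => x ^ p) (ψ := fun x => x ^ q) (by fun_prop)
      (by fun_prop)).integral_fun_mul_eq_mul_integral (by fun_prop) (by fun_prop)
  constructor
  · have e : (fun ω => (S ω + V ω) ^ 2)
        = fun ω => (S ω ^ 2 * V ω ^ 0 + 2 * (S ω ^ 1 * V ω ^ 1)) + S ω ^ 0 * V ω ^ 2 := by
      funext ω; ring
    have i1 : Integrable (fun ω => S ω ^ 2 * V ω ^ 0 + 2 * (S ω ^ 1 * V ω ^ 1)) P :=
      (hi 2 0).add ((hi 1 1).const_mul 2)
    rw [e, integral_add i1 (hi _ _),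
      integral_add (hi _ _) ((hi _ _).const_mul _), integral_const_mul, hind 1 1]
    simp [hS0]
  · have e : (fun ω => (S ω + V ω) ^ 4)
        = fun ω => (((S ω ^ 4 * V ω ^ 0 + 4 * (S ω ^ 3 * V ω ^ 1)) + 6 * (S ω ^ 2 * V ω ^ 2))
          + 4 * (S ω ^ 1 * V ω ^ 3)) + S ω ^ 0 * V ω ^ 4 := by
      funext ω; ring
    have i1 : Integrable (fun ω => S ω ^ 4 * V ω ^ 0 + 4 * (S ω ^ 3 * V ω ^ 1)) P :=
      (hi 4 0).add ((hi 3 1).const_mul 4)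
    have i2 : Integrable (fun ω => S ω ^ 4 * V ω ^ 0 + 4 * (S ω ^ 3 * V ω ^ 1)
        + 6 * (S ω ^ 2 * V ω ^ 2)) P := i1.add ((hi 2 2).const_mul 6)
    have i3 : Integrable (fun ω => S ω ^ 4 * V ω ^ 0 + 4 * (S ω ^ 3 * V ω ^ 1)
        + 6 * (S ω ^ 2 * V ω ^ 2) + 4 * (S ω ^ 1 * V ω ^ 3)) P := i2.add ((hi 1 3).const_mul 4)
    rw [e, integral_add i3 (hi _ _), integral_add i2 ((hi _ _).const_mul _),
      integral_add i1 ((hi _ _).const_mul _), integral_add (hi _ _) ((hi _ _).const_mul _),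
      integral_const_mul, integral_const_mul, integral_const_mul, hind 3 1, hind 2 2, hind 1 3]
    simp [hS0, hV0]

theorem integral_sum_pow_four_le {ι : Type*} {V : ι → Ω → ℝ} (hm : ∀ i, Measurable (V i))
    (hi : iIndepFun V P) {b σ κ : ℝ} (hb : ∀ i ω, |V i ω| ≤ b) (h0 : ∀ i, ∫ ω, V i ω ∂P = 0)
    (h2 : ∀ i, ∫ ω, V i ω ^ 2 ∂P ≤ σ) (h4 : ∀ i, ∫ ω, V i ω ^ 4 ∂P ≤ κ) (s : Finset ι) :
    ∫ ω, (∑ i ∈ s, V i ω) ∂P = 0 ∧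
    ∫ ω, (∑ i ∈ s, V i ω) ^ 2 ∂P ≤ s.card * σ ∧
    ∫ ω, (∑ i ∈ s, V i ω) ^ 4 ∂P ≤ s.card * κ + 3 * s.card ^ 2 * σ ^ 2 := by
  classical
  induction s using Finset.induction_on with
  | empty => simp
  | insert i s his ih =>
    obtain ⟨i1, i2, i3⟩ := ih
    have hS : Measurable fun ω => ∑ j ∈ s, V j ω := Finset.measurable_sum s fun j _ => hm j
    have hSb (ω : Ω) : |∑ j ∈ s, V j ω| ≤ s.card * b := by
      refine (Finset.abs_sum_le_sum_abs _ _).trans ((Finset.sum_le_sum fun j _ => hb j ω).trans ?_)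
      simp
    have hind : IndepFun (fun ω => ∑ j ∈ s, V j ω) (V i) P := by
      have := hi.indepFun_finsetSum_of_notMem hm his
      convert this using 1
      ext ω; simp
    obtain ⟨e2, e4⟩ := integral_add_pow_four_le hS (hm i) hSb (hb i) hind i1 (h0 i)
    have hsum (ω : Ω) : ∑ j ∈ insert i s, V j ω = ∑ j ∈ s, V j ω + V i ω := by
      rw [Finset.sum_insert his, add_comm]
    have n2 : 0 ≤ ∫ ω, V i ω ^ 2 ∂P := integral_nonneg fun ω => sq_nonneg _
    have hσ : 0 ≤ σ := n2.trans (h2 i)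
    have hprod : (∫ ω, (∑ j ∈ s, V j ω) ^ 2 ∂P) * ∫ ω, V i ω ^ 2 ∂P ≤ s.card * σ * σ :=
      mul_le_mul i2 (h2 i) n2 (by positivity)
    simp only [hsum, Finset.card_insert_of_notMem his]
    push_cast
    refine ⟨?_, ?_, ?_⟩
    · rw [integral_add (integrable_of_measurable_of_abs_le hS hSb)
        (integrable_of_measurable_of_abs_le (hm i) (hb i)), i1, h0, add_zero]
    · rw [e2]; linarith [h2 i]
    · rw [e4]; nlinarith [h4 i, sq_nonneg σ]

/-- Weighted AM–GM, with second number `1`; applied to `u = |x| / γ` and integrated, it gives the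
monotonicity of moments. -/
theorem rpow_le_add_of_le {q p u : ℝ} (hq : 0 < q) (hqp : q ≤ p) (hu : 0 ≤ u) :
    u ^ q ≤ q / p * u ^ p + (1 - q / p) := by
  have hp : 0 < p := hq.trans_le hqp
  have h := Real.geom_mean_le_arith_mean2_weighted (w₁ := q / p) (w₂ := 1 - q / p) (p₁ := u ^ p)
    (p₂ := 1) (by positivity) (sub_nonneg.2 ((div_le_one hp).2 hqp)) (by positivity) zero_le_one
    (by ring)
  rwa [← Real.rpow_mul hu, Real.one_rpow, mul_one, mul_one, mul_div_cancel₀ _ hp.ne'] at h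

theorem integral_rpow_le_of_le {ν : Measure ℝ} [IsProbabilityMeasure ν] {q p γ : ℝ} (hq : 0 < q)
    (hqp : q ≤ p) (hγ : 0 < γ) (hi : Integrable (fun x => |x| ^ p) ν)
    (hp : ∫ x, |x| ^ p ∂ν = γ ^ p) :
    Integrable (fun x => |x| ^ q) ν ∧ ∫ x, |x| ^ q ∂ν ≤ γ ^ q := by
  have hp0 : 0 < p := hq.trans_le hqp
  have hle (x : ℝ) : |x| ^ q ≤ γ ^ q * (q / p * (γ ^ p)⁻¹ * |x| ^ p + (1 - q / p)) := by
    have h := rpow_le_add_of_le hq hqp (u := |x| / γ) (by positivity)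
    rw [Real.div_rpow (abs_nonneg _) hγ.le, Real.div_rpow (abs_nonneg _) hγ.le,
      div_le_iff₀ (by positivity)] at h
    calc _ ≤ _ := h
      _ = _ := by rw [div_eq_mul_inv (|x| ^ p)]; ring
  have hi' : Integrable (fun x => γ ^ q * (q / p * (γ ^ p)⁻¹ * |x| ^ p + (1 - q / p))) ν :=
    ((hi.const_mul _).add (integrable_const _)).const_mul _
  have hI : Integrable (fun x => |x| ^ q) ν := by
    refine hi'.mono' (Measurable.aestronglyMeasurable (by fun_prop))
      (Filter.Eventually.of_forall fun x => ?_)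
    rw [Real.norm_of_nonneg (by positivity)]
    exact hle x
  refine ⟨hI, (integral_mono hI hi' hle).trans_eq ?_⟩
  rw [integral_const_mul, integral_add (hi.const_mul _) (integrable_const _), integral_const_mul,
    hp, mul_assoc, inv_mul_cancel₀ (by positivity)]
  simp

/-- Truncate at `nγ`. Some variable exceeds this level with probability at most `n · n ^ (-q)`, by
Markov. Otherwise the centred truncated sum exceeds `2nγ`, and its fourth moment makes this as rare.
The mean accounts for the third `nγ`. -/
theorem measure_sum_abs_gt_le {ν : Measure ℝ} [IsProbabilityMeasure ν] {ι : Type*} [Fintype ι]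
    [Nonempty ι] {X : ι → Ω → ℝ} (hm : ∀ i, Measurable (X i)) (hi : iIndepFun X P)
    (hν : ∀ i, P.map (X i) = ν) {q γ : ℝ} (hq2 : 2 ≤ q) (hq3 : q ≤ 3) (hγ : 0 < γ)
    (h1 : ∫ x, |x| ∂ν ≤ γ) (h1i : Integrable (fun x => |x|) ν)
    (h2 : ∫ x, x ^ 2 ∂ν ≤ γ ^ 2) (h2i : Integrable (fun x : ℝ => x ^ 2) ν)
    (h3 : ∫ x, |x| ^ q ∂ν ≤ γ ^ q) (h3i : Integrable (fun x => |x| ^ q) ν) :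
    P.real {ω | 3 * Fintype.card ι * γ < ∑ i, |X i ω|} ≤ 2 * (Fintype.card ι : ℝ) ^ (1 - q) := by
  set n : ℝ := (Fintype.card ι : ℝ) with hn
  have hn1 : 1 ≤ n := by rw [hn]; exact_mod_cast Fintype.card_pos
  have hn0 : 0 < n := by linarith
  set c : ℝ := n * γ with hc
  have hcpos : 0 < c := by positivity
  let u (x : ℝ) : ℝ := min |x| c
  have hu : Measurable u := by fun_prop
  have hu0 (x : ℝ) : 0 ≤ u x := le_min (abs_nonneg x) hcpos.le
  have huc (x : ℝ) : u x ≤ c := min_le_right _ _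
  have hux (x : ℝ) : u x ≤ |x| := min_le_left _ _
  have hub (k : ℕ) : Integrable (fun x => u x ^ k) ν :=
    integrable_of_measurable_of_abs_le (b := c ^ k) (by fun_prop) fun x => by
      rw [abs_of_nonneg (pow_nonneg (hu0 x) k)]; exact pow_le_pow_left₀ (hu0 x) (huc x) k
  have hui : Integrable u ν := by simpa using hub 1
  set e : ℝ := ∫ x, u x ∂ν with he
  have he0 : 0 ≤ e := integral_nonneg hu0
  have heγ : e ≤ γ := (integral_mono hui h1i hux).trans h1
  have hu2 : ∫ x, u x ^ 2 ∂ν ≤ γ ^ 2 := by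
    refine (integral_mono (hub 2) h2i fun x => ?_).trans h2
    simpa using pow_le_pow_left₀ (hu0 x) (hux x) 2
  have hnq : 0 < n ^ (4 - q) := by positivity
  have hu4 : ∫ x, u x ^ 4 ∂ν ≤ n ^ (4 - q) * γ ^ 4 := by
    have hle (x : ℝ) : u x ^ 4 ≤ c ^ (4 - q) * |x| ^ q := by
      have e4 : u x ^ 4 = u x ^ (4 - q) * u x ^ q := by
        rw [← Real.rpow_add_of_nonneg (hu0 x) (by linarith) (by linarith)]
        rw [sub_add_cancel]; norm_cast
      rw [e4]
      exact mul_le_mul (Real.rpow_le_rpow (hu0 x) (huc x) (by linarith))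
        (Real.rpow_le_rpow (hu0 x) (hux x) (by linarith)) (Real.rpow_nonneg (hu0 x) _)
        (by positivity)
    calc _ ≤ ∫ x, c ^ (4 - q) * |x| ^ q ∂ν := integral_mono (hub 4) (h3i.const_mul _) hle
      _ ≤ c ^ (4 - q) * γ ^ q := by rw [integral_const_mul]; gcongr
      _ = n ^ (4 - q) * (γ ^ (4 - q) * γ ^ q) := by
        rw [hc, Real.mul_rpow hn0.le hγ.le, mul_assoc]
      _ = _ := by rw [← Real.rpow_add hγ, sub_add_cancel]; norm_cast
  let v (x : ℝ) : ℝ := u x - e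
  have hv : Measurable v := hu.sub_const e
  have hvb (x : ℝ) : |v x| ≤ c + γ := by
    have h1 := hu0 x
    have h2 := huc x
    exact abs_le.2 ⟨by simp only [v]; linarith, by simp only [v]; linarith⟩
  have hv0 : ∫ x, v x ∂ν = 0 := by
    simp only [v]
    rw [integral_sub hui (integrable_const _)]; simp [he]
  have hv2 : ∫ x, v x ^ 2 ∂ν ≤ γ ^ 2 := by
    have e2 : (fun x => v x ^ 2) = fun x => (u x ^ 2 - (2 * e) * u x) + e ^ 2 := by
      funext x; simp only [v]; ring
    have i1 : Integrable (fun x => u x ^ 2 - (2 * e) * u x) ν := (hub 2).sub (hui.const_mul _)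
    rw [e2, integral_add i1 (integrable_const _),
      integral_sub (hub 2) (hui.const_mul _), integral_const_mul, ← he]
    simp; nlinarith
  have hv4 : ∫ x, v x ^ 4 ∂ν ≤ 2 * n ^ (4 - q) * γ ^ 4 := by
    -- A difference of two non-negative numbers is at most the larger one in absolute value.
    have hle (x : ℝ) : v x ^ 4 ≤ u x ^ 4 + e ^ 4 := by
      have hx := hu0 x
      rcases le_total (u x) e with h | h
      · have : v x ^ 4 ≤ e ^ 4 := by
          rw [show v x ^ 4 = (e - u x) ^ 4 by simp only [v]; ring]
          exact pow_le_pow_left₀ (by linarith) (by linarith) 4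
        nlinarith [pow_nonneg hx 4]
      · have : v x ^ 4 ≤ u x ^ 4 := pow_le_pow_left₀ (by simp only [v]; linarith)
          (by simp only [v]; linarith) 4
        nlinarith [pow_nonneg he0 4]
    have h4 : e ^ 4 ≤ n ^ (4 - q) * γ ^ 4 := by
      calc e ^ 4 ≤ 1 * γ ^ 4 := by rw [one_mul]; gcongr
        _ ≤ _ := by gcongr; exact Real.one_le_rpow hn1 (by linarith)
    have hvi : Integrable (fun x => v x ^ 4) ν :=
      integrable_of_measurable_of_abs_le (b := (c + γ) ^ 4) (by fun_prop) fun x => by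
        rw [abs_pow]; exact pow_le_pow_left₀ (abs_nonneg _) (hvb x) 4
    have := integral_mono hvi ((hub 4).add (integrable_const (e ^ 4))) hle
    simp only [Pi.add_apply] at this
    rw [integral_add (hub 4) (integrable_const _)] at this
    simp at this
    linarith
  have htr {f : ℝ → ℝ} (hf : Measurable f) (i : ι) : ∫ ω, f (X i ω) ∂P = ∫ x, f x ∂ν := by
    rw [← hν i, integral_map (hm i).aemeasurable hf.aestronglyMeasurable]
  obtain ⟨-, -, hS4⟩ := integral_sum_pow_four_le (P := P) (V := fun i ω => v (X i ω))
    (fun i => hv.comp (hm i)) (hi.comp (fun _ => v) fun _ => hv) (b := c + γ) (σ := γ ^ 2)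
    (κ := 2 * n ^ (4 - q) * γ ^ 4) (fun i ω => hvb _) (fun i => by rw [htr hv, hv0])
    (fun i => by rw [htr (f := fun x => v x ^ 2) (by fun_prop)]; exact hv2)
    (fun i => by rw [htr (f := fun x => v x ^ 4) (by fun_prop)]; exact hv4) Finset.univ
  rw [Finset.card_univ, ← hn] at hS4
  have hpow : n * n ^ (4 - q) = n ^ 4 * n ^ (1 - q) := by
    have : n ^ 4 = n ^ (4 : ℝ) := by norm_cast
    rw [this, ← Real.rpow_add hn0]
    nth_rw 1 [← Real.rpow_one n]
    rw [← Real.rpow_add hn0]; ring_nf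
  -- The variance part of the fourth moment is of order `n ^ 2`; it is dominated exactly when `q ≤
  -- 3`, which explains the `min 1 ε` in the exponent.
  have hsq : n ^ 2 ≤ n ^ 4 * n ^ (1 - q) := by
    have h4 : n ^ 4 = n ^ (4 : ℝ) := by norm_cast
    have h2 : n ^ 2 = n ^ (2 : ℝ) := by norm_cast
    rw [h4, h2, ← Real.rpow_add hn0]
    exact Real.rpow_le_rpow_of_exponent_le hn1 (by linarith)
  have hA : P.real {ω | (2 * c) ^ 4 ≤ (∑ i, v (X i ω)) ^ 4} ≤ n ^ (1 - q) := by
    have hmark := mul_meas_ge_le_integral_of_nonneg (μ := P)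
      (f := fun ω => (∑ i, v (X i ω)) ^ 4)
      (Filter.Eventually.of_forall fun ω => by positivity)
      (integrable_of_measurable_of_abs_le (b := (n * (c + γ)) ^ 4)
        ((Finset.measurable_sum _ fun i _ => hv.comp (hm i)).pow_const 4) fun ω => by
          rw [abs_pow]
          refine pow_le_pow_left₀ (abs_nonneg _) ?_ 4
          refine (Finset.abs_sum_le_sum_abs _ _).trans
            ((Finset.sum_le_sum fun i _ => hvb (X i ω)).trans ?_)
          simp [hn, mul_add]) ((2 * c) ^ 4)
    have hpos : 0 < (2 * c) ^ 4 := by positivity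
    refine le_of_mul_le_mul_left (hmark.trans (hS4.trans ?_)) hpos
    have hγ4 : 0 < γ ^ 4 := by positivity
    calc n * (2 * n ^ (4 - q) * γ ^ 4) + 3 * n ^ 2 * (γ ^ 2) ^ 2
        = (2 * (n * n ^ (4 - q)) + 3 * n ^ 2) * γ ^ 4 := by ring
      _ ≤ (16 * (n ^ 4 * n ^ (1 - q))) * γ ^ 4 := by
        gcongr; rw [hpow]; have : 0 ≤ n ^ 4 * n ^ (1 - q) := by positivity
        linarith
      _ = _ := by rw [hc]; ring
  have hB (i : ι) : P.real {ω | c < |X i ω|} ≤ n ^ (-q) := by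
    have hmark := mul_meas_ge_le_integral_of_nonneg (μ := ν) (f := fun x => |x| ^ q)
      (Filter.Eventually.of_forall fun x => by positivity) h3i (c ^ q)
    have hcq : 0 < c ^ q := by positivity
    have h5 : P.real {ω | c < |X i ω|} ≤ ν.real {x | c ^ q ≤ |x| ^ q} := by
      rw [← hν i, map_measureReal_apply (hm i) (measurableSet_le measurable_const (by fun_prop))]
      refine measureReal_mono fun ω hω => ?_
      exact Real.rpow_le_rpow hcpos.le (le_of_lt hω) (by linarith)
    refine h5.trans (le_of_mul_le_mul_left (hmark.trans (h3.trans_eq ?_)) hcq)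
    rw [hc, Real.mul_rpow hn0.le hγ.le, mul_right_comm, ← Real.rpow_add hn0]
    simp
  have hsub : {ω | 3 * n * γ < ∑ i, |X i ω|} ⊆
      (⋃ i ∈ (Finset.univ : Finset ι), {ω | c < |X i ω|}) ∪
        {ω | (2 * c) ^ 4 ≤ (∑ i, v (X i ω)) ^ 4} := by
    intro ω hω
    by_cases h : ∃ i, c < |X i ω|
    · left
      obtain ⟨i, hi⟩ := h
      exact Set.mem_biUnion (Finset.mem_univ i) hi
    · right
      push Not at h
      have e1 : ∑ i, v (X i ω) = ∑ i, |X i ω| - n * e := by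
        simp only [v, Finset.sum_sub_distrib]
        rw [Finset.sum_const, Finset.card_univ, nsmul_eq_mul]
        congr 1
        exact Finset.sum_congr rfl fun i _ => min_eq_left (h i)
      have h2 : n * e ≤ c := by rw [hc]; gcongr
      have h3 : 3 * n * γ = 3 * c := by rw [hc]; ring
      rw [Set.mem_ofPred_eq, h3] at hω
      refine pow_le_pow_left₀ (by positivity : 0 ≤ 2 * c) ?_ 4
      rw [e1]; linarith
  calc _ ≤ _ := measureReal_mono hsub
    _ ≤ P.real (⋃ i ∈ (Finset.univ : Finset ι), {ω | c < |X i ω|}) + n ^ (1 - q) :=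
      (measureReal_union_le _ _).trans (by gcongr)
    _ ≤ ∑ i : ι, n ^ (-q) + n ^ (1 - q) := by
      gcongr
      exact (measureReal_biUnion_finset_le _ _).trans (Finset.sum_le_sum fun i _ => hB i)
    _ = 2 * n ^ (1 - q) := by
      rw [Finset.sum_const, Finset.card_univ, nsmul_eq_mul, ← hn]
      nth_rw 1 [← Real.rpow_one n]
      rw [← Real.rpow_add hn0]; ring_nf

end Moments

/-! ### The mean of the loss under the noise law. -/

section NoiseLaw

variable {ν : Measure ℝ} {h : ℝ → ℝ} {ε b₀ b₁ K : ℝ}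

theorem lossDiff_eq (δ x : ℝ) : lossDiff δ x = -δ + 2 * δ * (Set.Iic (0 : ℝ)).indicator 1 x
    + 2 * (Set.uIoc 0 δ).indicator (fun x => |δ - x|) x := by
  unfold lossDiff
  rcases le_total 0 δ with hδ | hδ
  · rw [Set.uIoc_of_le hδ]
    rcases le_or_gt x 0 with hx | hx
    · rw [Set.indicator_of_mem (Set.mem_Iic.2 hx),
        Set.indicator_of_notMem fun h => absurd h.1 (not_lt.2 hx), abs_of_nonneg (by linarith),
        abs_of_nonpos hx, Pi.one_apply]
      ring
    · rw [Set.indicator_of_notMem (Set.notMem_Iic.2 hx), abs_of_pos hx]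
      rcases le_or_gt x δ with hxδ | hxδ
      · rw [Set.indicator_of_mem (Set.mem_Ioc.2 ⟨hx, hxδ⟩), abs_of_nonneg (by linarith)]
        ring
      · rw [Set.indicator_of_notMem fun h => absurd h.2 (not_le.2 hxδ), abs_of_neg (by linarith)]
        ring
  · rw [Set.uIoc_of_ge hδ]
    rcases le_or_gt x 0 with hx | hx
    · rw [Set.indicator_of_mem (Set.mem_Iic.2 hx), abs_of_nonpos hx, Pi.one_apply]
      rcases le_or_gt x δ with hxδ | hxδ
      · rw [Set.indicator_of_notMem fun h => absurd h.1 (not_lt.2 hxδ),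
          abs_of_nonneg (by linarith)]
        ring
      · rw [Set.indicator_of_mem (Set.mem_Ioc.2 ⟨hxδ, hx⟩), abs_of_neg (by linarith)]
        ring
    · rw [Set.indicator_of_notMem (Set.notMem_Iic.2 hx), abs_of_pos hx,
        Set.indicator_of_notMem fun h => absurd h.2 (not_le.2 hx), abs_of_neg (by linarith)]
      ring

theorem integral_uIoc_abs_sub (δ : ℝ) : ∫ x in Set.uIoc 0 δ, |δ - x| = δ ^ 2 / 2 := by
  rcases le_total 0 δ with hδ | hδ
  · rw [Set.uIoc_of_le hδ, setIntegral_congr_fun measurableSet_Ioc (g := fun x => δ - x)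
      (fun x hx => abs_of_nonneg (sub_nonneg.2 hx.2)), ← intervalIntegral.integral_of_le hδ]
    rw [intervalIntegral.integral_sub (by simp) (by simp)]
    simp; ring
  · rw [Set.uIoc_of_ge hδ, setIntegral_congr_fun measurableSet_Ioc (g := fun x => x - δ)
      (fun x hx => by
        simp only; rw [abs_of_nonpos (by linarith [hx.1])]; ring),
      ← intervalIntegral.integral_of_le hδ]
    rw [intervalIntegral.integral_sub (by simp) (by simp)]
    simp; ring

/-- In `lossDiff_eq` the two linear terms cancel on average because the median is zero. What remains
integrates a tent over the interval between `0` and `δ`, so bounds on the density give quadratic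
bounds. -/
theorem integral_lossDiff_eq [IsProbabilityMeasure ν] (hN : NoiseCondition ν h ε b₀ b₁ K) (δ : ℝ) :
    ∫ x, lossDiff δ x ∂ν = 2 * ∫ x in Set.uIoc 0 δ, h x * |δ - x| := by
  have hm : MeasurableSet (Set.uIoc 0 δ) := measurableSet_uIoc
  have i1 : Integrable ((Set.Iic (0 : ℝ)).indicator (1 : ℝ → ℝ)) ν :=
    (integrable_const (1 : ℝ)).indicator measurableSet_Iic
  have i2 : Integrable ((Set.uIoc 0 δ).indicator fun x => |δ - x|) ν := by
    refine Integrable.of_bound ((Measurable.indicator (by fun_prop) hm).aestronglyMeasurable) |δ|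
      (Filter.Eventually.of_forall fun x => ?_)
    by_cases hx : x ∈ Set.uIoc 0 δ
    · rw [Set.indicator_of_mem hx, Real.norm_eq_abs, abs_abs, abs_sub_comm]
      have := Set.abs_sub_right_of_mem_uIcc (Set.uIoc_subset_uIcc hx)
      rwa [sub_zero, abs_sub_comm] at this
    · rw [Set.indicator_of_notMem hx]; simp
  have e1 : ∫ x, (Set.Iic (0 : ℝ)).indicator (1 : ℝ → ℝ) x ∂ν = 1 / 2 := by
    rw [integral_indicator_one measurableSet_Iic, measureReal_def, hN.median]; simp
  have e2 : ∫ x, (Set.uIoc 0 δ).indicator (fun x => |δ - x|) x ∂ν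
      = ∫ x in Set.uIoc 0 δ, h x * |δ - x| := by
    rw [integral_indicator hm]
    nth_rw 1 [hN.density]
    rw [setIntegral_withDensity_eq_setIntegral_toReal_smul hN.density_measurable.ennreal_ofReal
      (Filter.Eventually.of_forall fun x => ENNReal.ofReal_lt_top) _ hm]
    refine integral_congr_ae (Filter.Eventually.of_forall fun x => ?_)
    simp only [smul_eq_mul]
    rw [ENNReal.toReal_ofReal (hN.density_nonneg x)]
  have i3 : Integrable (fun x => -δ + 2 * δ * (Set.Iic (0 : ℝ)).indicator 1 x) ν :=
    (integrable_const _).add (i1.const_mul _)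
  simp_rw [lossDiff_eq δ]
  rw [integral_add i3 (i2.const_mul _), integral_add (integrable_const _) (i1.const_mul _),
    integral_const_mul, integral_const_mul, e1, e2]
  simp only [integral_const, probReal_univ, smul_eq_mul]
  ring

theorem integrableOn_abs_sub (δ : ℝ) : IntegrableOn (fun x => |δ - x|) (Set.uIoc 0 δ) := by
  have : IntegrableOn (fun x => |δ - x|) (Set.uIcc 0 δ) :=
    ContinuousOn.integrableOn_compact isCompact_uIcc (by fun_prop)
  exact this.mono_set Set.uIoc_subset_uIcc

theorem integrableOn_density_mul (hN : NoiseCondition ν h ε b₀ b₁ K) (δ : ℝ) :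
    IntegrableOn (fun x => h x * |δ - x|) (Set.uIoc 0 δ) := by
  refine ((integrableOn_abs_sub δ).const_mul b₁⁻¹).mono'
    ((hN.density_measurable.mul (by fun_prop)).aestronglyMeasurable)
    (Filter.Eventually.of_forall fun x => ?_)
  rw [Real.norm_of_nonneg (mul_nonneg (hN.density_nonneg x) (abs_nonneg _))]
  exact mul_le_mul_of_nonneg_right (hN.upper x) (abs_nonneg _)

theorem integral_lossDiff_nonneg [IsProbabilityMeasure ν] (hN : NoiseCondition ν h ε b₀ b₁ K)
    (δ : ℝ) : 0 ≤ ∫ x, lossDiff δ x ∂ν := by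
  rw [integral_lossDiff_eq hN]
  exact mul_nonneg zero_le_two
    (integral_nonneg fun x => mul_nonneg (hN.density_nonneg x) (abs_nonneg _))

theorem integral_lossDiff_le [IsProbabilityMeasure ν] (hN : NoiseCondition ν h ε b₀ b₁ K) (δ : ℝ) :
    ∫ x, lossDiff δ x ∂ν ≤ b₁⁻¹ * δ ^ 2 := by
  rw [integral_lossDiff_eq hN]
  have h1 := setIntegral_mono_on (integrableOn_density_mul hN δ)
    ((integrableOn_abs_sub δ).const_mul b₁⁻¹) measurableSet_uIoc
    fun x _ => mul_le_mul_of_nonneg_right (hN.upper x) (abs_nonneg _)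
  rw [integral_const_mul, integral_uIoc_abs_sub] at h1
  linarith

theorem le_integral_lossDiff [IsProbabilityMeasure ν] (hN : NoiseCondition ν h ε b₀ b₁ K) {δ : ℝ}
    (hδ : |δ| ≤ K * noiseScale ν ε) : b₀⁻¹ * δ ^ 2 ≤ ∫ x, lossDiff δ x ∂ν := by
  rw [integral_lossDiff_eq hN]
  have h1 := setIntegral_mono_on ((integrableOn_abs_sub δ).const_mul b₀⁻¹)
    (integrableOn_density_mul hN δ) measurableSet_uIoc fun x hx => by
      refine mul_le_mul_of_nonneg_right (hN.lower x (le_trans ?_ hδ)) (abs_nonneg _)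
      have := Set.abs_sub_left_of_mem_uIcc (Set.uIoc_subset_uIcc hx)
      simpa using this
  rw [integral_const_mul, integral_uIoc_abs_sub] at h1
  linarith

/-- The interval `[-Kγ, Kγ]` has mass at most one and density at least `1 / b₀`. This makes `b₀` an
upper bound on the admissible entries of `T - T*`, so finitely many dyadic multiples of `b₀` cover
their norms. -/
theorem NoiseCondition.two_mul_le [IsProbabilityMeasure ν] (hN : NoiseCondition ν h ε b₀ b₁ K) :
    2 * (K * noiseScale ν ε) ≤ b₀ := by
  set a := K * noiseScale ν ε with ha
  have hb : 0 < b₀⁻¹ := inv_pos.2 hN.b₀_pos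
  have h1 : ENNReal.ofReal (b₀⁻¹ * (2 * a)) ≤ ν (Set.Icc (-a) a) := by
    rw [hN.density, withDensity_apply _ measurableSet_Icc]
    calc _ = ∫⁻ _ in Set.Icc (-a) a, ENNReal.ofReal b₀⁻¹ := by
          rw [setLIntegral_const, Real.volume_Icc, ENNReal.ofReal_mul hb.le]; ring_nf
      _ ≤ _ := setLIntegral_mono hN.density_measurable.ennreal_ofReal fun x hx =>
          ENNReal.ofReal_le_ofReal (hN.lower x (abs_le.2 hx))
  have h2 := h1.trans prob_le_one
  rw [ENNReal.ofReal_le_one, inv_mul_le_iff₀ hN.b₀_pos] at h2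
  linarith

theorem NoiseCondition.inv_le_inv (hN : NoiseCondition ν h ε b₀ b₁ K)
    (hK : 0 ≤ K * noiseScale ν ε) : b₀⁻¹ ≤ b₁⁻¹ :=
  (hN.lower 0 (by simpa using hK)).trans (hN.upper 0)

/-- A vanishing moment would concentrate the law at `0`, but a law with a density has no atoms. -/
theorem NoiseCondition.noiseScale_pos [IsProbabilityMeasure ν]
    (hN : NoiseCondition ν h ε b₀ b₁ K) : 0 < noiseScale ν ε := by
  have hε := hN.eps_pos
  refine Real.rpow_pos_of_pos ?_ _
  refine (integral_nonneg fun x => by positivity).lt_of_ne fun h0 => ?_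
  have h1 := (integral_eq_zero_iff_of_nonneg (fun x => by positivity) hN.moment).1 h0.symm
  have h2 : ∀ᵐ x ∂ν, x = 0 := by
    filter_upwards [h1] with x hx
    simp only [Pi.zero_apply] at hx
    rw [Real.rpow_eq_zero (abs_nonneg _) (by linarith)] at hx
    simpa using hx
  have h3 : ∀ᵐ x ∂ν, x ≠ 0 := by
    rw [hN.density]
    exact (withDensity_absolutelyContinuous _ _).ae_le (Measure.ae_ne volume 0)
  obtain ⟨x, hx, hx'⟩ := (h2.and h3).exists
  exact hx' hx

theorem NoiseCondition.noiseScale_rpow [IsProbabilityMeasure ν]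
    (hN : NoiseCondition ν h ε b₀ b₁ K) :
    ∫ x, |x| ^ (2 + ε) ∂ν = noiseScale ν ε ^ (2 + ε) := by
  have hε := hN.eps_pos
  rw [noiseScale, ← Real.rpow_mul (integral_nonneg fun x => by positivity),
    one_div_mul_cancel (by linarith), Real.rpow_one]

theorem NoiseCondition.measure_sum_abs_gt_le [IsProbabilityMeasure ν]
    (hN : NoiseCondition ν h ε b₀ b₁ K) {Ω : Type*} [MeasurableSpace Ω] (P : Measure Ω)
    [IsProbabilityMeasure P] {ι : Type*} [Fintype ι] [Nonempty ι] {X : ι → Ω → ℝ}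
    (hm : ∀ i, Measurable (X i)) (hi : iIndepFun X P) (hν : ∀ i, P.map (X i) = ν) :
    P.real {ω | 3 * Fintype.card ι * noiseScale ν ε < ∑ i, |X i ω|}
      ≤ 2 * (Fintype.card ι : ℝ) ^ (-1 - min 1 ε) := by
  have hε := hN.eps_pos
  have hγ := hN.noiseScale_pos
  have hle {q : ℝ} (h0 : 0 < q) (h1 : q ≤ 2 + ε) :=
    integral_rpow_le_of_le h0 h1 hγ hN.moment hN.noiseScale_rpow
  have h1 := hle zero_lt_one (by linarith)
  have h2 := hle zero_lt_two (by linarith)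
  have h3 := hle (q := 2 + min 1 ε) (by positivity) (by gcongr; exact min_le_right _ _)
  simp only [Real.rpow_one, Real.rpow_ofNat, sq_abs] at h1 h2
  have := RobustTensor.measure_sum_abs_gt_le hm hi hν (q := 2 + min 1 ε)
    (le_add_of_nonneg_right (by positivity)) (by linarith [min_le_left 1 ε]) hγ h1.2 h1.1 h2.2 h2.1
    h3.2 h3.1
  rwa [show (1 : ℝ) - (2 + min 1 ε) = -1 - min 1 ε by ring] at this

end NoiseLaw

/-! ### Pointwise comparison of losses with outliers, and the first-phase bound. -/

section Loss

theorem lossDiff_sub_le_abs_sub (δ x s : ℝ) :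
    lossDiff δ x - 2 * (if s ≠ 0 then |δ| else 0) ≤ |δ - x - s| - |x + s| := by
  unfold lossDiff
  split_ifs with h
  · have h1 := abs_sub_abs_le_abs_sub (δ - x) (-x)
    have h2 := abs_sub_abs_le_abs_sub (-(x + s)) (δ - x - s)
    rw [abs_neg, show δ - x - -x = δ by ring] at h1
    rw [abs_neg, show -(x + s) - (δ - x - s) = -δ by ring, abs_neg] at h2
    linarith
  · push Not at h
    subst h
    simp

theorem abs_sub_le_lossDiff_sub (δ z x s : ℝ) :
    |δ + z - x - s| - |δ - x - s|
      ≤ lossDiff (δ + z) x - lossDiff δ x + 2 * (if s ≠ 0 then |z| else 0) := by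
  unfold lossDiff
  split_ifs with h
  · have h1 := abs_sub_abs_le_abs_sub (δ + z - x - s) (δ - x - s)
    have h2 := abs_sub_abs_le_abs_sub (δ - x) (δ + z - x)
    rw [show δ + z - x - s - (δ - x - s) = z by ring] at h1
    rw [show δ - x - (δ + z - x) = -z by ring, abs_neg] at h2
    linarith
  · push Not at h
    subst h
    simp

theorem abs_le_linfNorm {ι : Type*} [Finite ι] (x : ι → ℝ) (i : ι) : |x i| ≤ linfNorm x :=
  le_ciSup (f := fun i => |x i|) (Set.finite_range _).bddAbove i

theorem linfNorm_nonneg {ι : Type*} (x : ι → ℝ) : 0 ≤ linfNorm x :=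
  Real.iSup_nonneg fun _ => abs_nonneg _

/-- Stated for arbitrary finite families so that it serves both the whole tensor and a single slice.
-/
theorem inv_linfNorm_mul_le_l1_sub {ι : Type*} [Fintype ι] (δ x s : ι → ℝ) {N τ : ℝ}
    (hs : ((Finset.univ.filter fun i => s i ≠ 0).card : ℝ) ≤ τ) (hx : ∑ i, |x i| ≤ N) :
    (linfNorm δ)⁻¹ * (∑ i, δ i ^ 2 - 2 * τ * linfNorm δ ^ 2) - 2 * N
      ≤ ∑ i, |δ i - x i - s i| - ∑ i, |x i + s i| := by
  set M := linfNorm δ with hM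
  have hM0 : 0 ≤ M := linfNorm_nonneg δ
  have h1 : ∑ i, |δ i| - 2 * ∑ i, |x i| - 2 * ∑ i, (if s i ≠ 0 then |δ i| else 0)
      ≤ ∑ i, |δ i - x i - s i| - ∑ i, |x i + s i| := by
    rw [Finset.mul_sum, Finset.mul_sum, ← Finset.sum_sub_distrib, ← Finset.sum_sub_distrib,
      ← Finset.sum_sub_distrib]
    refine Finset.sum_le_sum fun i _ => le_trans ?_ (lossDiff_sub_le_abs_sub (δ i) (x i) (s i))
    have := abs_sub_abs_le_abs_sub (δ i) (x i)
    unfold lossDiff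
    linarith
  have h2 : ∑ i, (if s i ≠ 0 then |δ i| else 0) ≤ τ * M := by
    rw [← Finset.sum_filter]
    refine (Finset.sum_le_sum fun i _ => abs_le_linfNorm δ i).trans ?_
    rw [Finset.sum_const, nsmul_eq_mul]
    gcongr
  have h3 : M⁻¹ * (∑ i, δ i ^ 2 - 2 * τ * M ^ 2) ≤ ∑ i, |δ i| - 2 * (τ * M) := by
    -- If the sup norm is zero, its inverse is zero too, and the left side vanishes.
    rcases hM0.eq_or_lt with h0 | h0
    · rw [← h0]
      simp [Finset.sum_nonneg fun i _ => abs_nonneg (δ i)]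
    · rw [inv_mul_le_iff₀ h0]
      have : ∑ i, δ i ^ 2 ≤ M * ∑ i, |δ i| := by
        rw [Finset.mul_sum]
        refine Finset.sum_le_sum fun i _ => ?_
        rw [← sq_abs, sq]
        exact mul_le_mul_of_nonneg_right (abs_le_linfNorm δ i) (abs_nonneg _)
      nlinarith
  linarith

variable {m : ℕ} {d : Fin m → ℕ}

/-- Changing one entry of `T` by `±1` changes the loss by at most one. -/
theorem abs_le_one_of_isL1Subgradient {Y T G : Tensor d} (h : IsL1Subgradient Y T G)
    (i : (k : Fin m) → Fin (d k)) : |G i| ≤ 1 := by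
  have key (a : ℝ) (ha : |a| ≤ 1) : a * G i ≤ 1 := by
    have h1 := h (T + EuclideanSpace.single i a)
    rw [add_sub_cancel_left, EuclideanSpace.inner_single_right] at h1
    have h2 : l1Norm (T + EuclideanSpace.single i a - Y) ≤ l1Norm (T - Y) + |a| := by
      unfold l1Norm
      have h3 : ∑ j, |(EuclideanSpace.single i a : Tensor d) j| = |a| := by
        rw [Finset.sum_eq_single i]
        · simp
        · intro j _ hj; simp [hj]
        · simp
      rw [← h3, ← Finset.sum_add_distrib]
      refine Finset.sum_le_sum fun j _ => ?_
      have : (T + EuclideanSpace.single i a - Y) j = (T - Y) j + (EuclideanSpace.single i a : Tensor d) j := by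
        simp only [PiLp.sub_apply, PiLp.add_apply]; ring
      rw [this]
      exact abs_add_le _ _
    rw [conj_trivial] at h1
    linarith
  refine abs_le.2 ⟨?_, ?_⟩
  · linarith [key (-1) (by simp)]
  · linarith [key 1 (by simp)]

end Loss

/-! ### Deterministic consequences of incoherence and sparsity. -/

section Deterministic

variable {m : ℕ} {d r : Fin m → ℕ}

theorem card_coIndex (d : Fin m → ℕ) (k : Fin m) :
    (Fintype.card (CoIndex d k) : ℝ) = dMinus d k := by
  rw [Fintype.card_pi, dMinus]
  push_cast
  simp only [Fintype.card_fin]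
  rw [← Finset.prod_subtype (Finset.univ.erase k) (fun l => by simp) fun l => (d l : ℝ)]

theorem dStar_eq_mul (d : Fin m → ℕ) (k : Fin m) : dStar d = d k * dMinus d k :=
  (Finset.mul_prod_erase Finset.univ (fun l => (d l : ℝ)) (Finset.mem_univ k)).symm

theorem dStar_nonneg (d : Fin m → ℕ) : 0 ≤ dStar d := Finset.prod_nonneg fun _ _ => by positivity

theorem dMinus_nonneg (d : Fin m → ℕ) (k : Fin m) : 0 ≤ dMinus d k :=
  Finset.prod_nonneg fun _ _ => by positivity

theorem norm_sq_le_of_abs_le {G : Tensor d} {a : ℝ} (hG : ∀ i, |G i| ≤ a) :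
    ‖G‖ ^ 2 ≤ dStar d * a ^ 2 := by
  rw [norm_sq_eq_sum]
  calc _ ≤ ∑ _i : (k : Fin m) → Fin (d k), a ^ 2 := Finset.sum_le_sum fun i _ => by
        rw [← sq_abs]; exact pow_le_pow_left₀ (abs_nonneg _) (hG i) 2
    _ = _ := by simp [dStar]

theorem norm_tangentProj_le {T G : Tensor d} (hG : ∀ i, |G i| ≤ 1) :
    ‖tangentProj T G‖ ≤ Real.sqrt (dStar d) := by
  refine ((tangentSpace T).norm_starProjection_apply_le G).trans (Real.le_sqrt_of_sq_le ?_)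
  simpa using norm_sq_le_of_abs_le hG

theorem matrix_eq_zero_of_rank_eq_zero {ι κ : Type*} [Fintype ι] [Fintype κ] {A : Matrix ι κ ℝ}
    (h : A.rank = 0) : A = 0 := by
  classical
  rw [Matrix.rank, Submodule.finrank_eq_zero, LinearMap.range_eq_bot] at h
  exact Matrix.ext_of_mulVec_single fun i => by
    rw [← Matrix.mulVecLin_apply, h, LinearMap.zero_apply, Matrix.zero_mulVec]

theorem twoInfNorm_tangentProj_le (hr : ∀ k, 1 ≤ r k) {μ : ℝ} (hμ : 0 < μ) {T G : Tensor d}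
    (hT : T ∈ incoherentTensors d r μ) (hG : ∀ i, |G i| ≤ 1) (k : Fin m) :
    twoInfNorm (matricize k (tangentProj T G)) ≤ Real.sqrt (3 * μ * (r k : ℝ) * dMinus d k) := by
  refine Real.iSup_le (fun j => ?_) (Real.sqrt_nonneg _)
  refine Real.sqrt_le_sqrt ?_
  have hm0 := dMinus_nonneg d k
  have hr0 : (0 : ℝ) ≤ r k := by positivity
  -- If `T = 0`, tangent vectors vanish as well, by the rank bound. Otherwise `μ r_k ≥ 1`, so the
  -- contribution of the slice of `G` is absorbed into `μ r_k d_k^-`.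
  rcases Nat.eq_zero_or_pos (matricize k T).rank with h0 | h0
  · have h1 := rank_matricize_add_le_of_mem_tangentSpace
      ((tangentSpace T).starProjection_apply_mem G) k
    rw [h0, mul_zero, Nat.le_zero] at h1
    replace h1 := matrix_eq_zero_of_rank_eq_zero h1
    rw [matricize_add, matrix_eq_zero_of_rank_eq_zero h0, zero_add] at h1
    change matricize k (tangentProj T G) = 0 at h1
    rw [h1]
    simp only [Matrix.zero_apply]
    simp only [ne_eq, OfNat.ofNat_ne_zero, not_false_eq_true, zero_pow, Finset.sum_const_zero]
    positivity
  · have hd : (0 : ℝ) < d k := by exact_mod_cast j.pos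
    have h1 : (1 : ℝ) ≤ μ * r k :=
      le_trans (by exact_mod_cast h0) (rank_le_mul_incoherence hr T hT.2 k j.pos)
    have h2 := sum_row_starProjection_le T G k j
    have h3 : ∑ c, matricize k G j c ^ 2 ≤ dMinus d k := by
      rw [← card_coIndex]
      calc _ ≤ ∑ _c : CoIndex d k, (1 : ℝ) := Finset.sum_le_sum fun c _ => by
            rw [← sq_abs]; exact pow_le_one₀ (abs_nonneg _) (hG _)
        _ = _ := by simp
    have h4 : l2Norm (tuckerFactor T k j) ^ 2 * ‖G‖ ^ 2 ≤ μ * r k * dMinus d k := by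
      have h5 : ‖G‖ ^ 2 ≤ dStar d := by simpa using norm_sq_le_of_abs_le hG
      calc _ ≤ μ * r k / d k * dStar d :=
            mul_le_mul (l2Norm_tuckerFactor_sq_le hr T hT.2 k j) h5 (by positivity) (by positivity)
        _ = _ := by rw [dStar_eq_mul d k]; field_simp
    nlinarith

/-- The set of the non-zero entries. -/
noncomputable def supp (S : Tensor d) : Finset ((k : Fin m) → Fin (d k)) :=
  Finset.univ.filter fun i => S i ≠ 0

theorem card_supp_row_le {α : ℝ} {S : Tensor d} (hS : IsFractionSparse α S) (k : Fin m)
    (j : Fin (d k)) :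
    ((Finset.univ.filter fun c => matricize k S j c ≠ 0).card : ℝ) ≤ α * dMinus d k := by
  refine le_trans (le_of_eq ?_) (hS k j)
  rw [← Set.ncard_coe_finset]
  simp

theorem card_supp_le (hm : 1 ≤ m) {α : ℝ} {S : Tensor d} (hS : IsFractionSparse α S) :
    ((supp S).card : ℝ) ≤ α * dStar d := by
  let k : Fin m := ⟨0, hm⟩
  have h1 : ((supp S).card : ℝ)
      = ∑ j, ((Finset.univ.filter fun c => matricize k S j c ≠ 0).card : ℝ) := by
    rw [supp, Finset.card_eq_sum_ones, Finset.sum_filter, sum_eq_sum_joinIndex k]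
    push_cast
    refine Finset.sum_congr rfl fun j _ => ?_
    rw [Finset.card_eq_sum_ones, Finset.sum_filter]
    push_cast
    rfl
  rw [h1]
  refine (Finset.sum_le_sum fun j _ => card_supp_row_le hS k j).trans_eq ?_
  rw [Finset.sum_const, Finset.card_univ, Fintype.card_fin, nsmul_eq_mul, dStar_eq_mul d k]
  ring

theorem isSpreadIn_of_fixed (hr : ∀ k, 1 ≤ r k) {T Z : Tensor d} {M : ℝ} (hT : incoherence r T ≤ M)
    {l : Fin m} (h : modeProd l Z (factorProj T l) = Z) : IsSpreadIn (M * r l / d l) l Z :=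
  ⟨factorProj T l, fun j => by
    rw [sum_factorProj_row]; exact l2Norm_tuckerFactor_sq_le hr T hT l j, h⟩

/-- One factor `√α` comes from Cauchy–Schwarz with the size of the support, the other from the
restricted norm: a slice holds at most `α d_k^-` outliers, and the spread constants of the other
modes cancel `d_k^-`. -/
theorem sum_abs_supp_le (hm : 1 ≤ m) (hr : ∀ k, 1 ≤ r k) (hd : ∀ k, 1 ≤ d k) {α M : ℝ}
    (hα : 0 ≤ α) (hM : 1 ≤ M) {T Z S : Tensor d} (hT : incoherence r T ≤ M)
    (hS : IsFractionSparse α S)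
    (hZ : ∀ k l, l ≠ k → IsSpreadIn (M * r l / d l) l (modeProd k Z (1 - factorProj T k))) :
    ∑ i ∈ supp S, |Z i|
      ≤ α * Real.sqrt (((m : ℝ) + 1) * M ^ m * dStar r * dStar d) * ‖Z‖ := by
  have hrs := dStar_nonneg r
  have hds := dStar_nonneg d
  have hM0 : 0 ≤ M := by linarith
  have hMr (l : Fin m) : 1 ≤ M * r l :=
    one_le_mul_of_one_le_of_one_le hM (by exact_mod_cast hr l)
  have hβ : Real.sqrt (α * (M ^ m * dStar r)) ^ 2 = α * (M ^ m * dStar r) :=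
    Real.sq_sqrt (by positivity)
  have h1 : ‖restrictTo (supp S) Z‖
      ≤ Real.sqrt (α * (M ^ m * dStar r)) * Real.sqrt (m + 1) * ‖Z‖ := by
    refine norm_restrictTo_le (ν := fun l => M * r l / d l) (fun l => by positivity)
      (Real.sqrt_nonneg _) hm (supp S) (fun k j => ?_) (factorProj T)
      (factorProj_transpose T) (factorProj_mul_self T)
      (fun k j => by
        rw [sum_factorProj_row]; exact l2Norm_tuckerFactor_sq_le hr T hT k j) Z hZ
    rw [hβ]
    have h2 : ((Finset.univ.filter fun c => joinIndex k j c ∈ supp S).card : ℝ)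
        ≤ α * dMinus d k := by
      have e : (Finset.univ.filter fun c => joinIndex k j c ∈ supp S)
          = Finset.univ.filter fun c => matricize k S j c ≠ 0 := by
        ext c
        simp only [supp, Finset.mem_filter, Finset.mem_univ, true_and]
        rfl
      rw [e]
      exact card_supp_row_le hS k j
    have h3 : 0 ≤ ∏ l ∈ Finset.univ.erase k, M * r l / d l :=
      Finset.prod_nonneg fun l _ => by positivity
    calc _ ≤ (∏ l ∈ Finset.univ.erase k, M * r l / d l) * (α * dMinus d k) :=
          mul_le_mul_of_nonneg_left h2 h3
      _ = α * ∏ l ∈ Finset.univ.erase k, M * r l := by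
        rw [mul_left_comm, dMinus, ← Finset.prod_mul_distrib]
        congr 1
        refine Finset.prod_congr rfl fun l _ => ?_
        have : (d l : ℝ) ≠ 0 := by have := hd l; positivity
        field_simp
      _ ≤ α * ∏ l, M * r l := by
        refine mul_le_mul_of_nonneg_left ?_ hα
        rw [← Finset.mul_prod_erase Finset.univ _ (Finset.mem_univ k)]
        exact le_mul_of_one_le_left (Finset.prod_nonneg fun l _ => by positivity) (hMr k)
      _ = _ := by rw [Finset.prod_mul_distrib]; simp [dStar]
  have h4 : Real.sqrt (supp S).card ≤ Real.sqrt (α * dStar d) :=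
    Real.sqrt_le_sqrt (card_supp_le hm hS)
  calc _ ≤ Real.sqrt (supp S).card * ‖restrictTo (supp S) Z‖ := sum_abs_le_norm_restrictTo _ _
    _ ≤ Real.sqrt (α * dStar d)
        * (Real.sqrt (α * (M ^ m * dStar r)) * Real.sqrt (m + 1) * ‖Z‖) := by gcongr
    _ = Real.sqrt (α ^ 2 * (((m : ℝ) + 1) * M ^ m * dStar r * dStar d)) * ‖Z‖ := by
      rw [← mul_assoc, ← mul_assoc, ← Real.sqrt_mul (by positivity), ← Real.sqrt_mul (by positivity)]
      congr 2; ring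
    _ = _ := by rw [Real.sqrt_mul (by positivity), Real.sqrt_sq hα]

theorem one_le_incoherence (hm : 1 ≤ m) (hr : ∀ k, 1 ≤ r k) {T : Tensor d}
    (hT : HasTuckerRank r T) (hd : ∀ k, 1 ≤ d k) : 1 ≤ incoherence r T := by
  let k : Fin m := ⟨0, hm⟩
  have h := rank_le_mul_incoherence hr T le_rfl k (hd k)
  rw [hT k] at h
  have : (0 : ℝ) < r k := by exact_mod_cast hr k
  exact le_of_mul_le_mul_right (by rwa [one_mul]) this

theorem HasTuckerRank.one_le (hr : ∀ k, 1 ≤ r k) {T : Tensor d} (hT : HasTuckerRank r T)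
    (k : Fin m) : 1 ≤ d k := by
  have h := (matricize k T).rank_le_card_height
  rw [hT k, Fintype.card_fin] at h
  exact (hr k).trans h

end Deterministic

/-! ### The second phase: the quadratic term dominates the fluctuation and the outliers. -/

section TwoPhase

variable {m : ℕ} {d r : Fin m → ℕ}

theorem exists_dyadic_scale {b x : ℝ} {N : ℕ} (hb : 0 < b) (h1 : b ≤ 2 * x)
    (h2 : 2 * x ≤ 2 ^ N * b) : ∃ j < N + 1, 2 * x ≤ 2 ^ (j + 1) * b ∧ 2 ^ (j + 1) * b ≤ 4 * x := by
  obtain ⟨n, hn1, hn2⟩ := exists_nat_pow_near (x := 2 * x / b) (y := 2)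
    ((one_le_div hb).2 h1) one_lt_two
  rw [le_div_iff₀ hb] at hn1
  rw [div_lt_iff₀ hb] at hn2
  refine ⟨n, ?_, hn2.le, by rw [pow_succ]; linarith⟩
  have : (2 : ℝ) ^ n ≤ 2 ^ N := le_of_mul_le_mul_right (hn1.trans h2) hb
  have := (pow_le_pow_iff_right₀ (one_lt_two : (1 : ℝ) < 2)).1 this
  omega

/-- The crude bound `d* ≤ 2 ^ ∑ d_k` suffices: it only limits the number of dyadic scales, and that
number enters through the union bound. -/
theorem norm_le_of_abs_le_half {Δ : Tensor d} {b : ℝ} (hb : 0 ≤ b) (h : ∀ i, 2 * |Δ i| ≤ b) :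
    2 * ‖Δ‖ ≤ 2 ^ (∑ k, d k) * b := by
  have h1 := norm_sq_le_of_abs_le (G := Δ) (a := b / 2) fun i => by linarith [h i]
  have h2 : dStar d ≤ 2 ^ (∑ k, d k) := by
    rw [dStar, ← Finset.prod_pow_eq_pow_sum]
    refine Finset.prod_le_prod (fun _ _ => by positivity) fun k _ => ?_
    exact_mod_cast (Nat.lt_two_pow_self (n := d k)).le
  have h3 : (1 : ℝ) ≤ 2 ^ (∑ k, d k) := one_le_pow₀ (by norm_num)
  refine abs_le_of_sq_le_sq' ?_ (by positivity) |>.2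
  have h4 : dStar d * (b / 2) ^ 2 ≤ 2 ^ (∑ k, d k) * (2 ^ (∑ k, d k) * (b / 2) ^ 2) := by
    refine mul_le_mul h2 ?_ (by positivity) (by positivity)
    exact le_mul_of_one_le_left (by positivity) h3
  nlinarith

theorem l1_sub_ge_of_deviation {Tstar X S T : Tensor d} {ν : Measure ℝ} {b₀ dev sp : ℝ}
    (hg : ∀ i, b₀⁻¹ * (T - Tstar) i ^ 2 ≤ ∫ x, lossDiff ((T - Tstar) i) x ∂ν)
    (hdev : |lossDeviation ν (T - Tstar) X| ≤ dev)
    (hsp : ∑ i ∈ supp S, |(T - Tstar) i| ≤ sp) :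
    b₀⁻¹ * ‖T - Tstar‖ ^ 2 - dev - 2 * sp
      ≤ l1Norm (T - (Tstar + X + S)) - l1Norm (Tstar - (Tstar + X + S)) := by
  set Δ := T - Tstar with hΔ
  have h1 : l1Norm (T - (Tstar + X + S)) - l1Norm (Tstar - (Tstar + X + S))
      = ∑ i, (|Δ i - X i - S i| - |X i + S i|) := by
    unfold l1Norm
    rw [Finset.sum_sub_distrib]
    congr 1
    · refine Finset.sum_congr rfl fun i _ => congrArg _ ?_
      simp only [hΔ, PiLp.sub_apply, PiLp.add_apply]; ring
    · refine Finset.sum_congr rfl fun i _ => ?_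
      rw [← abs_neg]
      refine congrArg _ ?_
      simp only [PiLp.sub_apply, PiLp.add_apply]; ring
  have h2 := Finset.sum_le_sum fun i (_ : i ∈ Finset.univ) =>
    lossDiff_sub_le_abs_sub (Δ i) (X i) (S i)
  have h3 : ∑ i, lossDiff (Δ i) (X i) = lossDeviation ν Δ X + ∑ i, ∫ x, lossDiff (Δ i) x ∂ν := by
    rw [lossDeviation, ← Finset.sum_add_distrib]
    simp
  have h4 : b₀⁻¹ * ‖Δ‖ ^ 2 ≤ ∑ i, ∫ x, lossDiff (Δ i) x ∂ν := by
    rw [norm_sq_eq_sum, Finset.mul_sum]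
    exact Finset.sum_le_sum fun i _ => hg i
  rw [Finset.sum_sub_distrib, h3, ← Finset.mul_sum, ← Finset.sum_filter] at h2
  rw [h1]
  have h5 := (abs_le.1 hdev).1
  rw [supp] at hsp
  linarith

theorem l1_add_sub_le_of_deviation {Tstar X S T Z : Tensor d} {ν : Measure ℝ} {b₁ dev sp : ℝ}
    (hg : ∀ δ, ∫ x, lossDiff δ x ∂ν ≤ b₁⁻¹ * δ ^ 2) (hg0 : ∀ δ, 0 ≤ ∫ x, lossDiff δ x ∂ν)
    (hdev : |lossDeviation ν (T - Tstar) X| ≤ dev)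
    (hdev' : |lossDeviation ν (T + Z - Tstar) X| ≤ dev)
    (hsp : ∑ i ∈ supp S, |Z i| ≤ sp) :
    l1Norm (T + Z - (Tstar + X + S)) - l1Norm (T - (Tstar + X + S))
      ≤ b₁⁻¹ * ‖T + Z - Tstar‖ ^ 2 + 2 * dev + 2 * sp := by
  set Δ := T - Tstar with hΔ
  have hΔ' : T + Z - Tstar = Δ + Z := by rw [hΔ]; abel
  rw [hΔ'] at hdev' ⊢
  have h1 : l1Norm (T + Z - (Tstar + X + S)) - l1Norm (T - (Tstar + X + S))
      = ∑ i, (|Δ i + Z i - X i - S i| - |Δ i - X i - S i|) := by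
    unfold l1Norm
    rw [Finset.sum_sub_distrib]
    congr 1
    · refine Finset.sum_congr rfl fun i _ => congrArg _ ?_
      simp only [hΔ, PiLp.sub_apply, PiLp.add_apply]; ring
    · refine Finset.sum_congr rfl fun i _ => congrArg _ ?_
      simp only [hΔ, PiLp.sub_apply, PiLp.add_apply]; ring
  have h2 := Finset.sum_le_sum fun i (_ : i ∈ Finset.univ) =>
    abs_sub_le_lossDiff_sub (Δ i) (Z i) (X i) (S i)
  have h3 (W : Tensor d) :
      ∑ i, lossDiff (W i) (X i) = lossDeviation ν W X + ∑ i, ∫ x, lossDiff (W i) x ∂ν := by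
    rw [lossDeviation, ← Finset.sum_add_distrib]
    simp
  have h4 : ∑ i, ∫ x, lossDiff ((Δ + Z) i) x ∂ν ≤ b₁⁻¹ * ‖Δ + Z‖ ^ 2 := by
    rw [norm_sq_eq_sum, Finset.mul_sum]
    exact Finset.sum_le_sum fun i _ => hg _
  have h5 : 0 ≤ ∑ i, ∫ x, lossDiff (Δ i) x ∂ν := Finset.sum_nonneg fun i _ => hg0 _
  have h6 := h3 (Δ + Z)
  simp only [PiLp.add_apply] at h6
  rw [Finset.sum_add_distrib, Finset.sum_sub_distrib, Finset.sum_sub_distrib, h6, h3, ← Finset.mul_sum,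
    ← Finset.sum_filter] at h2
  simp only [PiLp.add_apply] at h4
  rw [h1, Finset.sum_sub_distrib]
  have h7 := (abs_le.1 hdev).1
  have h8 := (abs_le.1 hdev').2
  rw [supp] at hsp
  linarith

/-- The projection `1 - factorProj T k` kills `T`, so only a mode-`k` product of `T*` is left, and
it inherits the incoherence of `T*` in the other modes. Here both `μ*` and `μ` enter. -/
theorem isSpreadIn_sub (hr : ∀ k, 1 ≤ r k) {T Tstar : Tensor d} {M : ℝ}
    (hM : incoherence r Tstar ≤ M) {k l : Fin m} (hl : l ≠ k) :
    IsSpreadIn (M * r l / d l) l (modeProd k (T - Tstar) (1 - factorProj T k)) := by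
  refine isSpreadIn_of_fixed hr hM ?_
  have h : modeProd k T (1 - factorProj T k) = 0 := by
    rw [modeProd_mat_sub, modeProd_one, modeProd_factorProj, sub_self]
  have h0 : modeProd l (0 : Tensor d) (factorProj Tstar l) = 0 := modeProd_zero _ _
  rw [modeProd_sub, h, modeProd_sub, h0, modeProd_comm hl, modeProd_factorProj]

theorem rank_matricize_sub_le (k : Fin m) (S T : Tensor d) :
    (matricize k (S - T)).rank ≤ (matricize k S).rank + (matricize k T).rank := by
  have e : S - T = S + (-1 : ℝ) • T := by rw [neg_one_smul, sub_eq_add_neg]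
  rw [e, matricize_add]
  refine (matrix_rank_add_le _ _).trans ?_
  gcongr
  exact rank_matricize_smul_le _ _ _

/-- The second phase, on the event that the loss process is controlled at all dyadic scales. -/
theorem two_phase_of_deviation (hm : 1 ≤ m) (hr : ∀ k, 1 ≤ r k) {Tstar : Tensor d}
    (hTs : HasTuckerRank r Tstar) {ν : Measure ℝ} [IsProbabilityMeasure ν] {h : ℝ → ℝ}
    {ε b₀ b₁ K C : ℝ} (hN : NoiseCondition ν h ε b₀ b₁ K) {X S : Tensor d} (hC : 0 ≤ C)
    (hdev : ∀ j < (∑ k, d k) + 1, ∀ Z : Tensor d, (∀ k, (matricize k Z).rank ≤ 3 * r k) →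
      ‖Z‖ ≤ 2 ^ (j + 1) * b₀ →
        |lossDeviation ν Z X| ≤ C * (2 ^ (j + 1) * b₀) * Real.sqrt (dof d r))
    {α : ℝ} (hα : 0 ≤ α) (hS : IsFractionSparse α S) {μ : ℝ} {T G : Tensor d}
    (hT : T ∈ incoherentTensors d r μ) (hG : IsL1Subgradient (Tstar + X + S) T G)
    (hinf : linfNorm (T - Tstar) ≤ K * noiseScale ν ε) (hdof : 1 ≤ dof d r)
    (hlow : (8 * C + 4) * b₀ * max (Real.sqrt (dof d r))
          (α * Real.sqrt (((m : ℝ) + 1) * max (incoherence r Tstar) μ ^ m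
            * dStar r * dStar d)) ≤ ‖T - Tstar‖) :
    ‖tangentProj T G‖ ≤ 5 * Real.sqrt ((m : ℝ) + 1) * b₁⁻¹ * ‖T - Tstar‖ ∧
    (2 * b₀)⁻¹ * ‖T - Tstar‖ ^ 2
      ≤ l1Norm (T - (Tstar + X + S)) - l1Norm (Tstar - (Tstar + X + S)) := by
  have hd := hTs.one_le hr
  have hb₀ := hN.b₀_pos
  have hb₁ := hN.b₁_pos
  set M := max (incoherence r Tstar) μ with hM
  have hM1 : 1 ≤ M := (one_le_incoherence hm hr hTs hd).trans (le_max_left _ _)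
  set σ := α * Real.sqrt (((m : ℝ) + 1) * M ^ m * dStar r * dStar d) with hσ
  set Δ := T - Tstar with hΔ
  set D := Real.sqrt (dof d r) with hD
  have hD1 : 1 ≤ D := Real.one_le_sqrt.2 hdof
  have hK0 : 0 ≤ K * noiseScale ν ε := (linfNorm_nonneg _).trans hinf
  have hΔinf (i) : |Δ i| ≤ K * noiseScale ν ε := (abs_le_linfNorm _ i).trans hinf
  have hCb : 0 < (8 * C + 4) * b₀ := by positivity
  have hlowD : (8 * C + 4) * b₀ * D ≤ ‖Δ‖ :=
    (mul_le_mul_of_nonneg_left (le_max_left _ _) hCb.le).trans hlow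
  have hlowσ : (8 * C + 4) * b₀ * σ ≤ ‖Δ‖ :=
    (mul_le_mul_of_nonneg_left (le_max_right _ _) hCb.le).trans hlow
  have hbD : b₀ * D ≤ ‖Δ‖ / (8 * C + 4) := by
    rw [le_div_iff₀ (by positivity)]; linarith
  have hbσ : b₀ * σ ≤ ‖Δ‖ / (8 * C + 4) := by
    rw [le_div_iff₀ (by positivity)]; linarith
  have hΔb : b₀ ≤ ‖Δ‖ := by
    refine le_trans ?_ hlowD
    have : 1 * b₀ * 1 ≤ (8 * C + 4) * b₀ * D := by gcongr; linarith
    linarith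
  have hΔpos : 0 < ‖Δ‖ := hb₀.trans_le hΔb
  -- The scale is chosen to cover `2‖Δ‖`, not just `‖Δ‖`, since the gradient bound also needs the
  -- deviation at `Δ + τ • Z`.
  obtain ⟨j, hj, hj1, hj2⟩ := exists_dyadic_scale (x := ‖Δ‖) hb₀ (by linarith)
    (norm_le_of_abs_le_half hb₀.le fun i => by linarith [hΔinf i, hN.two_mul_le])
  have hdev' (Z : Tensor d) (hZ : ∀ k, (matricize k Z).rank ≤ 3 * r k) (hZn : ‖Z‖ ≤ 2 * ‖Δ‖) :
      |lossDeviation ν Z X| ≤ C * (4 * ‖Δ‖) * D :=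
    (hdev j hj Z hZ (hZn.trans hj1)).trans (by gcongr)
  have hsp (Z : Tensor d) (hZ : ∀ k l, l ≠ k →
      IsSpreadIn (M * r l / d l) l (modeProd k Z (1 - factorProj T k))) :
      ∑ i ∈ supp S, |Z i| ≤ σ * ‖Z‖ :=
    sum_abs_supp_le hm hr hd hα hM1 (hT.2.trans (le_max_right _ _)) hS hZ
  have hΔdev := hdev' Δ (fun k => by
    have h1 : (matricize k Δ).rank ≤ _ := rank_matricize_sub_le k T Tstar
    have h2 := hT.1 k
    have h3 := hTs k
    omega) (by linarith)
  -- the total error terms are at most half of the main term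
  have herr : b₀ * (C * (4 * ‖Δ‖) * D + 2 * (σ * ‖Δ‖)) ≤ ‖Δ‖ ^ 2 / 2 := by
    calc _ = (4 * C * (b₀ * D) + 2 * (b₀ * σ)) * ‖Δ‖ := by ring
      _ ≤ (4 * C * (‖Δ‖ / (8 * C + 4)) + 2 * (‖Δ‖ / (8 * C + 4))) * ‖Δ‖ := by gcongr
      -- The threshold constant is chosen for this: `(4C + 2) / (8C + 4) = 1/2`.
      _ = _ := by field_simp; ring
  constructor
  · set Z := tangentProj T G with hZ
    rcases (norm_nonneg Z).eq_or_lt with h0 | hZpos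
    · rw [← h0]; positivity
    -- With this step length, the inner product of `G` with `τ • Z` is `‖Z‖ ‖Δ‖`, while the
    -- quadratic loss bound is of order `‖Δ‖²`; dividing by `‖Δ‖` bounds `‖Z‖`.
    set τ := ‖Δ‖ / ‖Z‖ with hτ
    have hτpos : 0 < τ := by positivity
    have hZT : Z ∈ tangentSpace T := (tangentSpace T).starProjection_apply_mem G
    have hτZ : τ • Z ∈ tangentSpace T := (tangentSpace T).smul_mem τ hZT
    have hτn : ‖τ • Z‖ = ‖Δ‖ := by
      rw [norm_smul, Real.norm_of_nonneg hτpos.le, hτ, div_mul_cancel₀ _ hZpos.ne']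
    have hsum : T + τ • Z - Tstar = Δ + τ • Z := by rw [hΔ]; abel
    have hn2 : ‖T + τ • Z - Tstar‖ ≤ 2 * ‖Δ‖ := by
      rw [hsum]; refine (norm_add_le _ _).trans ?_; rw [hτn]; linarith
    have h1 := l1_add_sub_le_of_deviation (Z := τ • Z) (S := S) (integral_lossDiff_le hN)
      (integral_lossDiff_nonneg hN) hΔdev
      -- `T + τ • Z` has rank at most `2 r_k` and `T*` adds `r_k`: hence the rank bound `3 r_k` in
      -- the deviation hypothesis.
      (hdev' _ (fun k => by
        have h1 := rank_matricize_sub_le k (T + τ • Z) Tstar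
        have h2 := hT.1 k
        have h3 := hTs k
        have h4 := rank_matricize_add_le_of_mem_tangentSpace hτZ k
        omega) hn2)
      (hsp (τ • Z) fun k l hl => isSpreadIn_of_fixed hr (hT.2.trans (le_max_right _ _))
        (modeProd_one_sub_of_mem_tangentSpace hτZ hl))
    rw [hτn] at h1
    have h2 := hG (T + τ • Z)
    have hin : inner ℝ G (T + τ • Z - T) = ‖Z‖ * ‖Δ‖ := by
      rw [add_sub_cancel_left, inner_smul_right]
      have : inner ℝ G Z = ‖Z‖ ^ 2 := by
        have hZZ := (tangentSpace T).starProjection_eq_self_iff.2 hZT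
        rw [← real_inner_self_eq_norm_sq]
        nth_rw 1 [← hZZ]
        rw [← (tangentSpace T).inner_starProjection_left_eq_right]
        rfl
      rw [this, hτ]; field_simp
    rw [hin] at h2
    have hb : b₀⁻¹ ≤ b₁⁻¹ := hN.inv_le_inv hK0
    -- The mean loss contributes `4 / b₁` and all errors together `1 / b₀ ≤ 1 / b₁`; this is the
    -- constant `5`.
    have h3 : ‖Z‖ * ‖Δ‖ ≤ b₁⁻¹ * (2 * ‖Δ‖) ^ 2 + b₀⁻¹ * ‖Δ‖ ^ 2 := by
      have h4 : b₁⁻¹ * ‖T + τ • Z - Tstar‖ ^ 2 ≤ b₁⁻¹ * (2 * ‖Δ‖) ^ 2 := by gcongr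
      have h5 : 2 * (C * (4 * ‖Δ‖) * D) + 2 * (σ * ‖Δ‖) ≤ b₀⁻¹ * ‖Δ‖ ^ 2 := by
        rw [← div_eq_inv_mul, le_div_iff₀ hb₀]
        have : 0 ≤ b₀ * (σ * ‖Δ‖) := by positivity
        nlinarith
      linarith
    have h6 : ‖Z‖ * ‖Δ‖ ≤ (5 * b₁⁻¹ * ‖Δ‖) * ‖Δ‖ := by
      have : b₀⁻¹ * ‖Δ‖ ^ 2 ≤ b₁⁻¹ * ‖Δ‖ ^ 2 := by gcongr
      nlinarith
    have h7 := le_of_mul_le_mul_right h6 hΔpos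
    have h8 : 1 ≤ Real.sqrt ((m : ℝ) + 1) := Real.one_le_sqrt.2 (by linarith [(Nat.cast_nonneg m : (0:ℝ) ≤ m)])
    calc _ ≤ 5 * 1 * b₁⁻¹ * ‖Δ‖ := by linarith
      _ ≤ _ := by gcongr
  · have h1 := l1_sub_ge_of_deviation (S := S) (fun i => le_integral_lossDiff hN (hΔinf i)) hΔdev
      (hsp Δ fun k l hl => isSpreadIn_sub hr (le_max_left _ _) hl)
    refine le_trans ?_ h1
    have h2 : C * (4 * ‖Δ‖) * D + 2 * (σ * ‖Δ‖) ≤ b₀⁻¹ * (‖Δ‖ ^ 2 / 2) := by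
      rw [← div_eq_inv_mul, le_div_iff₀ hb₀]; linarith
    rw [mul_inv]
    change _ ≤ b₀⁻¹ * ‖Δ‖ ^ 2 - _ - _
    linarith

end TwoPhase

/-! ### The exceptional sets and the assembly. -/

section Main

variable {m : ℕ} {d r : Fin m → ℕ}

theorem one_le_dof (hr : ∀ k, 1 ≤ r k) : 1 ≤ dof d r := by
  have h1 : (1 : ℝ) ≤ ∏ k, (r k : ℝ) := by
    rw [← Finset.prod_const_one (s := (Finset.univ : Finset (Fin m)))]
    exact Finset.prod_le_prod (fun _ _ => zero_le_one) fun k _ => by exact_mod_cast hr k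
  have h2 : (0 : ℝ) ≤ ∑ k, (d k : ℝ) * (r k : ℝ) := Finset.sum_nonneg fun k _ => by positivity
  rw [dof]; linarith

theorem sum_le_dof (hr : ∀ k, 1 ≤ r k) : ((∑ k, d k : ℕ) : ℝ) + 1 ≤ dof d r := by
  have h1 : (1 : ℝ) ≤ ∏ k, (r k : ℝ) := by
    rw [← Finset.prod_const_one (s := (Finset.univ : Finset (Fin m)))]
    exact Finset.prod_le_prod (fun _ _ => zero_le_one) fun k _ => by exact_mod_cast hr k
  have h2 : ∑ k, (d k : ℝ) ≤ ∑ k, (d k : ℝ) * (r k : ℝ) := Finset.sum_le_sum fun k _ =>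
    le_mul_of_one_le_right (by positivity) (by exact_mod_cast hr k)
  rw [dof]; push_cast; linarith

/-- With high probability the loss process is controlled at all dyadic scales. -/
theorem exists_exceptional_set_scales (hm1 : 1 ≤ m) (hr : ∀ k, 1 ≤ r k) {ν : Measure ℝ}
    [IsProbabilityMeasure ν] {Ω : Type*} [MeasurableSpace Ω] (P : Measure Ω)
    [IsProbabilityMeasure P] {Ξ : Ω → Tensor d} (hm : ∀ i, Measurable fun ω => Ξ ω i)
    (hi : iIndepFun (fun i ω => Ξ ω i) P) (hν : ∀ i, P.map (fun ω => Ξ ω i) = ν) {b₀ : ℝ}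
    (hb₀ : 0 < b₀) :
    ∃ B : Set Ω, MeasurableSet B ∧ P.real B < Real.exp (-dof d r / 2) ∧
      ∀ ω ∉ B, ∀ j < (∑ k, d k) + 1, ∀ Z : Tensor d, (∀ k, (matricize k Z).rank ≤ 3 * r k) →
        ‖Z‖ ≤ 2 ^ (j + 1) * b₀ →
          |lossDeviation ν Z (Ξ ω)|
            ≤ 16 * 4 ^ m * (m + 1) * (2 ^ (j + 1) * b₀) * Real.sqrt (dof d r) := by
  set D : ℕ := (∏ k, 3 * r k) + ∑ k, d k * (3 * r k) with hD
  have hdof := one_le_dof (d := d) hr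
  have h3 : (3 : ℝ) ≤ 3 ^ m := by
    calc (3 : ℝ) = 3 ^ 1 := by norm_num
      _ ≤ _ := pow_le_pow_right₀ (by norm_num) hm1
  have hprod : (0 : ℝ) ≤ ∏ k, (r k : ℝ) := Finset.prod_nonneg fun k _ => by positivity
  have hsum : (0 : ℝ) ≤ ∑ k, (d k : ℝ) * (r k : ℝ) := Finset.sum_nonneg fun k _ => by positivity
  have hDcast : (D : ℝ) = 3 ^ m * (∏ k, (r k : ℝ)) + 3 * ∑ k, (d k : ℝ) * (r k : ℝ) := by
    rw [hD]
    push_cast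
    rw [Finset.prod_mul_distrib, Finset.mul_sum]
    simp [mul_left_comm]
  -- Tripling the ranks changes the degrees of freedom by a factor between `1` and `3 ^ m`; the
  -- lower bound serves the probability, the upper one the size of the deviation.
  have hDge : dof d r ≤ D := by rw [hDcast, dof]; nlinarith
  have hDle : (D : ℝ) ≤ 3 ^ m * dof d r := by rw [hDcast, dof]; nlinarith
  have hD1 : 1 ≤ D := by exact_mod_cast hdof.trans hDge
  choose B hBm hBP hB using fun j : ℕ => exists_exceptional_set_lossDeviation P hm hi hν
    (fun k => 3 * r k) hD1 le_rfl (s := 2 ^ (j + 1) * b₀) (by positivity)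
  refine ⟨⋃ j ∈ Finset.range ((∑ k, d k) + 1), B j,
    Finset.measurableSet_biUnion _ fun j _ => hBm j, ?_, ?_⟩
  · calc _ ≤ ∑ j ∈ Finset.range ((∑ k, d k) + 1), P.real (B j) := measureReal_biUnion_finset_le _ _
      _ ≤ ∑ _j ∈ Finset.range ((∑ k, d k) + 1), Real.exp (-2 * D) :=
        Finset.sum_le_sum fun j _ => hBP j
      _ = (((∑ k, d k : ℕ) : ℝ) + 1) * Real.exp (-2 * D) := by
        rw [Finset.sum_const, Finset.card_range, nsmul_eq_mul]; push_cast; rfl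
      -- The number of scales is at most `dof d r`, so the union bound costs only a factor `exp (dof
      -- d r)`.
      _ ≤ Real.exp (dof d r) * Real.exp (-2 * dof d r) := by
        gcongr ?_ * Real.exp ?_
        · exact (sum_le_dof hr).trans ((le_add_of_nonneg_right zero_le_one).trans
            (Real.add_one_le_exp _))
        · linarith
      _ = Real.exp (-dof d r) := by rw [← Real.exp_add]; ring_nf
      _ < _ := Real.exp_lt_exp.2 (by linarith)
  · intro ω hω j hj Z hZ hZn
    have hωj : ω ∉ B j := fun h => hω (Set.mem_biUnion (Finset.mem_coe.2 (Finset.mem_range.2 hj)) h)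
    refine (hB j ω hωj Z hZ hZn).trans ?_
    have hs : Real.sqrt D ≤ 2 ^ m * Real.sqrt (dof d r) := by
      calc Real.sqrt D ≤ Real.sqrt ((2 ^ m) ^ 2 * dof d r) := by
            refine Real.sqrt_le_sqrt (hDle.trans ?_)
            gcongr
            rw [← pow_mul, mul_comm, pow_mul]
            gcongr; norm_num
        _ = _ := by rw [Real.sqrt_mul (by positivity), Real.sqrt_sq (by positivity)]
    calc _ ≤ 16 * (2 ^ m * (m + 1)) * (2 ^ (j + 1) * b₀) * (2 ^ m * Real.sqrt (dof d r)) := by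
          gcongr
      _ = _ := by
        rw [show (4 : ℝ) ^ m = 2 ^ m * 2 ^ m by rw [← mul_pow]; norm_num]; ring

/-- With high probability all slices of the noise have a small `ℓ₁` norm. -/
theorem exists_exceptional_set_rows (hd : ∀ k, 1 ≤ d k) {ν : Measure ℝ}
    [IsProbabilityMeasure ν] {h : ℝ → ℝ} {ε b₀ b₁ K : ℝ} (hN : NoiseCondition ν h ε b₀ b₁ K)
    {Ω : Type*} [MeasurableSpace Ω] (P : Measure Ω)
    [IsProbabilityMeasure P] {Ξ : Ω → Tensor d} (hm : ∀ i, Measurable fun ω => Ξ ω i)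
    (hi : iIndepFun (fun i ω => Ξ ω i) P) (hν : ∀ i, P.map (fun ω => Ξ ω i) = ν) :
    ∃ B : Set Ω, MeasurableSet B ∧
      P.real B ≤ 2 * ∑ k, (d k : ℝ) * dMinus d k ^ (-1 - min 1 ε) ∧
      ∀ ω ∉ B, ∀ k j, ∑ c, |matricize k (Ξ ω) j c| ≤ 3 * dMinus d k * noiseScale ν ε := by
  let B (k : Fin m) (j : Fin (d k)) : Set Ω :=
    {ω | 3 * dMinus d k * noiseScale ν ε < ∑ c, |matricize k (Ξ ω) j c|}
  have hBm (k : Fin m) (j : Fin (d k)) : MeasurableSet (B k j) := by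
    refine measurableSet_lt measurable_const (Finset.measurable_sum _ fun c _ => ?_)
    exact (hm (joinIndex k j c)).abs
  have hBP (k : Fin m) (j : Fin (d k)) : P.real (B k j) ≤ 2 * dMinus d k ^ (-1 - min 1 ε) := by
    have hne : Nonempty (CoIndex d k) := ⟨fun l => ⟨0, hd l⟩⟩
    -- Distinct column indices name distinct entries, so the entries of a slice form an independent
    -- family.
    have hinj : Function.Injective fun c : CoIndex d k => joinIndex k j c := fun c c' h => by
      have := (Equiv.piSplitAt k fun l => Fin (d l)).symm.injective h
      exact (Prod.mk.inj this).2
    have h := hN.measure_sum_abs_gt_le P (X := fun (c : CoIndex d k) ω => Ξ ω (joinIndex k j c))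
      (fun c => hm _) (hi.precomp hinj) fun c => hν _
    rw [card_coIndex] at h
    exact h
  refine ⟨⋃ k ∈ (Finset.univ : Finset (Fin m)), ⋃ j ∈ (Finset.univ : Finset (Fin (d k))), B k j,
    Finset.measurableSet_biUnion _ fun k _ => Finset.measurableSet_biUnion _ fun j _ => hBm k j,
    ?_, ?_⟩
  · refine (measureReal_biUnion_finset_le _ _).trans ?_
    rw [Finset.mul_sum]
    refine Finset.sum_le_sum fun k _ => ?_
    refine (measureReal_biUnion_finset_le _ _).trans
      ((Finset.sum_le_sum fun j _ => hBP k j).trans_eq ?_)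
    rw [Finset.sum_const, Finset.card_univ, Fintype.card_fin, nsmul_eq_mul]; ring
  · intro ω hω k j
    by_contra! hlt
    exact hω (Set.mem_biUnion (Finset.mem_coe.2 (Finset.mem_univ k))
      (Set.mem_biUnion (Finset.mem_coe.2 (Finset.mem_univ j)) hlt))

/-- The first phase for the whole tensor. -/
theorem l1_sub_ge (hm : 1 ≤ m) {Tstar X S T : Tensor d} {α γ : ℝ} (hS : IsFractionSparse α S)
    (hX : ∀ k j, ∑ c, |matricize k X j c| ≤ 3 * dMinus d k * γ) :
    (linfNorm (T - Tstar))⁻¹ * (‖T - Tstar‖ ^ 2 - 2 * α * dStar d * linfNorm (T - Tstar) ^ 2)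
        - 6 * dStar d * γ
      ≤ l1Norm (T - (Tstar + X + S)) - l1Norm (Tstar - (Tstar + X + S)) := by
  let k : Fin m := ⟨0, hm⟩
  have hsum : ∑ i, |X i| ≤ 3 * dStar d * γ := by
    rw [sum_eq_sum_joinIndex k, dStar_eq_mul d k]
    refine (Finset.sum_le_sum fun j _ => hX k j).trans_eq ?_
    rw [Finset.sum_const, Finset.card_univ, Fintype.card_fin, nsmul_eq_mul]; ring
  have h := inv_linfNorm_mul_le_l1_sub (T - Tstar) X S (card_supp_le hm hS) hsum
  rw [norm_sq_eq_sum]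
  refine le_trans (le_of_eq ?_) (h.trans_eq ?_)
  · ring
  · unfold l1Norm
    congr 1
    · refine Finset.sum_congr rfl fun i _ => congrArg _ ?_
      simp only [PiLp.sub_apply, PiLp.add_apply]; ring
    · refine Finset.sum_congr rfl fun i _ => ?_
      rw [← abs_neg]
      refine congrArg _ ?_
      simp only [PiLp.sub_apply, PiLp.add_apply]; ring

/-- The first phase for a single slice. -/
theorem l1_row_sub_ge {Tstar X S T : Tensor d} {α γ : ℝ} (hS : IsFractionSparse α S)
    (k : Fin m) (j : Fin (d k)) (hX : ∑ c, |matricize k X j c| ≤ 3 * dMinus d k * γ) :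
    (linfNorm (matricize k (T - Tstar) j))⁻¹ * (l2Norm (matricize k (T - Tstar) j) ^ 2
          - 2 * α * dMinus d k * linfNorm (matricize k (T - Tstar) j) ^ 2) - 6 * dMinus d k * γ
      ≤ l1Norm (matricize k (T - (Tstar + X + S)) j)
        - l1Norm (matricize k (Tstar - (Tstar + X + S)) j) := by
  have h := inv_linfNorm_mul_le_l1_sub (matricize k (T - Tstar) j) (matricize k X j)
    (matricize k S j) (card_supp_row_le hS k j) hX
  rw [l2Norm_sq]
  refine le_trans (le_of_eq ?_) (h.trans_eq ?_)
  · ring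
  · unfold l1Norm
    congr 1
    · refine Finset.sum_congr rfl fun i _ => congrArg _ ?_
      simp only [matricize_sub, matricize_add, Matrix.sub_apply, Matrix.add_apply]; ring
    · refine Finset.sum_congr rfl fun i _ => ?_
      rw [← abs_neg]
      refine congrArg _ ?_
      simp only [matricize_sub, matricize_add, Matrix.sub_apply, Matrix.add_apply]; ring

end Main

end RobustTensor

theorem mainTheorem7 :
    ∃ c c₂ : ℝ, 0 < c ∧ 0 < c₂ ∧ ∀ m : ℕ, 1 ≤ m → ∃ c₁ : ℝ, 0 < c₁ ∧
    ∀ (d r : Fin m → ℕ), (∀ k, 1 ≤ r k) →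
    ∀ (Tstar : Tensor d), HasTuckerRank r Tstar →
    ∀ (ν : Measure ℝ) (h : ℝ → ℝ) (ε b₀ b₁ K : ℝ),
      K = noiseConst m (incoherence r Tstar) (dStar r) (condNumber r Tstar) →
      NoiseCondition ν h ε b₀ b₁ K →
    ∀ {Ω : Type*} [MeasurableSpace Ω] (P : Measure Ω) [IsProbabilityMeasure P]
      (Ξ : Ω → Tensor d),
      (∀ i, Measurable fun ω => Ξ ω i) →
      iIndepFun (fun i ω => Ξ ω i) P →
      (∀ i, P.map (fun ω => Ξ ω i) = ν) →
    ∀ (α : ℝ), 0 < α → α < 1 →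
    ∀ (S : Ω → Tensor d), (∀ ω, IsFractionSparse α (S ω)) →
    ∀ (μ : ℝ), 0 < μ →
    ∃ A : Set Ω, MeasurableSet A ∧
      1 - c * ∑ k, (d k : ℝ) * dMinus d k ^ (-1 - min 1 ε) - Real.exp (-dof d r / 2) < P.real A ∧
      ∀ ω ∈ A, ∀ Y : Tensor d, Y = Tstar + Ξ ω + S ω →
        (∀ T G : Tensor d, IsL1Subgradient Y T G →
          ‖tangentProj T G‖ ≤ Real.sqrt (dStar d) ∧
          (linfNorm (T - Tstar))⁻¹ *
              (‖T - Tstar‖ ^ 2 - 2 * α * dStar d * linfNorm (T - Tstar) ^ 2)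
              - 6 * dStar d * noiseScale ν ε
            ≤ l1Norm (T - Y) - l1Norm (Tstar - Y) ∧
          ∀ (k : Fin m) (j : Fin (d k)), T ∈ incoherentTensors d r μ →
            twoInfNorm (matricize k (tangentProj T G))
              ≤ Real.sqrt (3 * μ * (r k : ℝ) * dMinus d k) ∧
            (linfNorm (matricize k (T - Tstar) j))⁻¹ *
                (l2Norm (matricize k (T - Tstar) j) ^ 2
                  - 2 * α * dMinus d k * linfNorm (matricize k (T - Tstar) j) ^ 2)
                - 6 * dMinus d k * noiseScale ν ε
              ≤ l1Norm (matricize k (T - Y) j) - l1Norm (matricize k (Tstar - Y) j)) ∧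
        (∀ T ∈ incoherentTensors d r μ, ∀ G : Tensor d, IsL1Subgradient Y T G →
          linfNorm (T - Tstar) ≤ K * noiseScale ν ε →
          c₁ * b₀ * max (Real.sqrt (dof d r))
              (α * Real.sqrt (((m : ℝ) + 1) * max (incoherence r Tstar) μ ^ m
                * dStar r * dStar d))
            ≤ ‖T - Tstar‖ →
          ‖tangentProj T G‖ ≤ c₂ * Real.sqrt ((m : ℝ) + 1) * b₁⁻¹ * ‖T - Tstar‖ ∧
          (2 * b₀)⁻¹ * ‖T - Tstar‖ ^ 2 ≤ l1Norm (T - Y) - l1Norm (Tstar - Y)) := by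
  -- The value of `c₁` is `8C + 4` for the deviation constant `C = 16 · 4 ^ m (m + 1)`. The slices
  -- need only `c = 2`; strictness in the probability bound comes from the strict bound on `B₂`.
  refine ⟨3, 5, by norm_num, by norm_num, fun m hm => ⟨8 * (16 * 4 ^ m * (m + 1)) + 4,
    by positivity, ?_⟩⟩
  intro d r hr Tstar hTs ν h ε b₀ b₁ K _ hN Ω _ P _ Ξ hΞm hΞi hΞν α hα _ S hS μ hμ
  have hd := hTs.one_le hr
  have hν : IsProbabilityMeasure ν := by
    rw [← hΞν fun k => ⟨0, hd k⟩]
    exact Measure.isProbabilityMeasure_map (hΞm _).aemeasurable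
  obtain ⟨B₁, hB₁m, hB₁P, hB₁⟩ := exists_exceptional_set_rows hd hN P hΞm hΞi hΞν
  obtain ⟨B₂, hB₂m, hB₂P, hB₂⟩ := exists_exceptional_set_scales hm hr P hΞm hΞi hΞν hN.b₀_pos
  refine ⟨(B₁ ∪ B₂)ᶜ, (hB₁m.union hB₂m).compl, ?_, ?_⟩
  · rw [probReal_compl_eq_one_sub (hB₁m.union hB₂m)]
    have h1 := measureReal_union_le (μ := P) B₁ B₂
    have h2 : 0 ≤ ∑ k, (d k : ℝ) * dMinus d k ^ (-1 - min 1 ε) :=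
      Finset.sum_nonneg fun k _ => mul_nonneg (by positivity)
        (Real.rpow_nonneg (dMinus_nonneg d k) _)
    linarith
  · rintro ω hω Y rfl
    rw [Set.mem_compl_iff, Set.mem_union, not_or] at hω
    have hX := hB₁ ω hω.1
    refine ⟨fun T G hG => ⟨norm_tangentProj_le (abs_le_one_of_isL1Subgradient hG),
      l1_sub_ge hm (hS ω) hX, fun k j hT => ⟨twoInfNorm_tangentProj_le hr hμ hT
        (abs_le_one_of_isL1Subgradient hG) k, l1_row_sub_ge (hS ω) k j (hX k j)⟩⟩, ?_⟩
    intro T hT G hG hinf hlow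
    exact two_phase_of_deviation hm hr hTs hN (by positivity) (hB₂ ω hω.2) hα.le (hS ω) hT hG hinf
      (one_le_dof hr) hlow
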